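/- **Setting.** For probability measures on $\mathbb R^d$ let $\mathrm{TV}(\nu,\eta)=\sup_A|\nu(A)-\eta(A)|$ (supremum over Borel sets) and let $W^1(\nu,\eta)\in[0,\infty]$ be the $L^1$-Wasserstein distance for the Euclidean metric. Let $U:\mathbb R^d\to\mathbb R$ satisfy $\int e^{-U}dx<\infty$, put $\mu(dx)\propto e^{-U(x)}dx$, and assume * (A1) $U$ has a global minimum at $0$ and $U(0)=0$; * (A2)–(A4) $U\in C^4(\mathbb R^d)$ and $\|D^2U\|\le L$, $\|D^3U\|\le L_H$, $\|D^4U\|\le L_I$ everywhere, in the operator norm of multilinear forms. Let $T,h>0$ with $N=T/h\in\mathbb N$. Velocity Verlet is the iteration $q_{k+1}=q_k+hv_k-\frac{h^2}{2}\nabla U(q_k)$, $v_{k+1}=v_k-\frac h2(\nabla U(q_k)+\nabla U(q_{k+1}))$; write $\tilde q_T(x,v)=q_N$ when $(q_0,v_0)=(x,v)$. The transition kernel of unadjusted HMC (uHMC) is $\tilde\pi(x,\cdot)=\mathrm{Law}(\tilde q_T(x,\xi))$ with $\xi\sim\mathcal N(0,I_d)$. Assume $L(T^2+Th)\le 1/6$,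 and that there are an invariant probability measure $\tilde\mu$ of $\tilde\pi$ and constants $M_1,c,M_2\in(0,\infty)$ with * (A5) $W^1(\nu\tilde\pi^m,\tilde\mu)\le M_1e^{-cm}W^1(\nu,\tilde\mu)$ for all $m\ge1$ and all probability measures $\nu$; * (A6) $W^1(\mu,\tilde\mu)\le M_2h^2$. **(i) Bound.** For all integers $m\ge0$ and all probability measures $\nu$ on $\mathbb R^d$, $$\mathrm{TV}(\mu,\nu\tilde\pi^{m+1})\le \tfrac32\big(T^{-2}+27\,d\,L_H^2T^4\big)^{1/2}M_1\,W^1(\tilde\mu,\nu)\,e^{-cm}+h^2\Big[\tfrac32\big(T^{-2}+27\,d\,L_H^2T^4\big)^{1/2}M_2+C\Big],$$ where (with $C=\infty$ allowed) $$\begin{aligned}C=\Big[&d^3(4L_I^2T^4+14L_H^2L_IT^6+14L_H^4T^8)+d^2(35L_H^2T^2+8L_I^2T^4+28L_H^2L_IT^6+28L_H^4T^8)\\&+d(16L^2+4L_H^2T^2)+(2dL_H^2+L^2T^{-2})\textstyle\int|x|^2\mu(dx)\\&+(dL_I^2+dL_H^2L_IT^2+dL_H^4T^4+L_H^2T^{-2})\textstyle\int|x|^4\mu(dx)\Big]^{1/2}.\end{aligned}$$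 **(ii) Gradient evaluations.** Fix $T,c,h_0,A>0$, $L,L_H,L_I$ and $p\in\mathbb N$ with $L(T^2+Th_0)\le1/6$. There is a constant $K$, depending only on these numbers, such that for every $d\ge1$ and $\varepsilon\in(0,1/2]$ there are a step size $h=T/N\le h_0$, $N\in\mathbb N$, and a number $m+1$ of transition steps (both depending only on $d$, $\varepsilon$ and the fixed numbers) for which: uHMC with $m+1$ transition steps, run as an algorithm that accesses $U$ only by evaluating $\nabla U$ at points, makes at most $$K\,d^{3/4}\,\varepsilon^{-1/2}\,\log(d/\varepsilon)$$ gradient evaluations; and for every $U$ on $\mathbb R^d$ satisfying $\int e^{-U}dx<\infty$, (A1)–(A4) with $L,L_H,L_I$, and $C\le A\,d^{3/2}$, and every initial law $\nu$, such that for every $h'\in(0,h_0]$ with $T/h'\in\mathbb N$ there is an invariant probability measure $\tilde\mu_{h'}$ satisfying (A5), (A6) with rate $c$ and constants $M_1\le A\,d^p$, $M_2\le A\,d$, and $W^1(\tilde\mu_{h'},\nu)\le A\,d^p$, the output of the algorithm started from $\nu$ has law $\nu\tilde\pi^{m+1}$ and $$\mathrm{TV}(\mu,\nu\tilde\pi^{m+1})\le\varepsilon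 .$$ -/

import Mathlib

open MeasureTheory ProbabilityTheory
open scoped ENNReal Gradient

noncomputable section

namespace UHMC

/-- The space `ℝ^d` with its Euclidean norm. -/
abbrev E (d : ℕ) : Type := EuclideanSpace ℝ (Fin d)

/-! ### Distances between probability measures -/

/-- Total variation distance: the supremum of `|ν(A) - η(A)|` over Borel sets `A`
(a bounded family for probability measures). -/
def tvDist {d : ℕ} (ν η : Measure (E d)) : ℝ :=
  ⨆ A : {A : Set (E d) // MeasurableSet A}, |ν.real A.1 - η.real A.1|

/-- `γ` is a coupling of `ν` and `η`. -/
def IsCoupling {d : ℕ} (γ : Measure (E d × E d)) (ν η : Measure (E d)) : Prop :=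
  γ.map Prod.fst = ν ∧ γ.map Prod.snd = η

/-- The `L¹`-Wasserstein distance for the Euclidean metric, with values in `[0, ∞]`. -/
def wasserstein1 {d : ℕ} (ν η : Measure (E d)) : ℝ≥0∞ :=
  ⨅ (γ : Measure (E d × E d)) (_ : IsCoupling γ ν η), ∫⁻ z, edist z.1 z.2 ∂γ

/-! ### Target measure, velocity Verlet, and the uHMC transition kernel -/

/-- The target measure `μ(dx) = Z⁻¹ exp(-U(x)) dx`, where `Z = ∫ exp(-U(x)) dx`. -/
def target {d : ℕ} (U : E d → ℝ) : Measure (E d) :=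
  (volume : Measure (E d)).tilted (fun x => -U x)

/-- One step of velocity Verlet with step size `h`, acting on (position, velocity). -/
def verletStep {d : ℕ} (U : E d → ℝ) (h : ℝ) (z : E d × E d) : E d × E d :=
  let q' := z.1 + h • z.2 - (h ^ 2 / 2) • ∇ U z.1
  (q', z.2 - (h / 2) • (∇ U z.1 + ∇ U q'))

/-- `q̃_T(x, v)` for `T = N h`: the position after `N` Verlet steps started at `(x, v)`. -/
def verletPos {d : ℕ} (U : E d → ℝ) (h : ℝ) (N : ℕ) (z : E d × E d) : E d :=
  ((verletStep U h)^[N] z).1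

/-- The one-step transition kernel of uHMC: `π̃(x, ·)` is the law of `q̃_T(x, ξ)`, `T = N h`,
with `ξ` standard normal (see `uhmcKernel_apply`). -/
def uhmcKernel {d : ℕ} (U : E d → ℝ) (h : ℝ) (N : ℕ) : Kernel (E d) (E d) :=
  (Kernel.id ×ₖ Kernel.const (E d) (stdGaussian (E d))).map (verletPos U h N)

/-- `ν π̃^m`: the law after `m` transition steps of uHMC from the initial law `ν`. -/
def uhmcLaw {d : ℕ} (U : E d → ℝ) (h : ℝ) (N m : ℕ) (ν : Measure (E d)) : Measure (E d) :=
  ν.bind (uhmcKernel U h N ^ m : Kernel (E d) (E d))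

/-! ### Assumptions -/

/-- The assumptions (A1)-(A4) on the potential. The norms are operator norms of the second, third
and fourth derivative as multilinear forms; `L`, `LH`, `LI` may be the suprema of these norms or
any larger numbers. -/
structure PotentialAssumptions {d : ℕ} (U : E d → ℝ) (L LH LI : ℝ) : Prop where
  zero : U 0 = 0
  min : ∀ x, U 0 ≤ U x
  smooth : ContDiff ℝ 4 U
  bound2 : ∀ x, ‖iteratedFDeriv ℝ 2 U x‖ ≤ L
  bound3 : ∀ x, ‖iteratedFDeriv ℝ 3 U x‖ ≤ LH
  bound4 : ∀ x, ‖iteratedFDeriv ℝ 4 U x‖ ≤ LI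

/-- The assumptions (A5)-(A6): `μt` is an invariant probability measure of the uHMC kernel with
step size `h` and duration `N h`, to which uHMC converges geometrically in `W¹` with constants
`M1` and `c`, and whose `W¹` distance to the target is at most `M2 h²`. -/
structure WassersteinAssumptions {d : ℕ} (U : E d → ℝ) (h : ℝ) (N : ℕ) (M1 c M2 : ℝ)
    (μt : Measure (E d)) : Prop where
  prob : IsProbabilityMeasure μt
  invariant : (uhmcKernel U h N).Invariant μt
  M1_pos : 0 < M1
  c_pos : 0 < c
  M2_pos : 0 < M2
  contraction : ∀ m : ℕ, 1 ≤ m → ∀ ν : Measure (E d), IsProbabilityMeasure ν →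
    wasserstein1 (uhmcLaw U h N m ν) μt
      ≤ ENNReal.ofReal (M1 * Real.exp (-c * m)) * wasserstein1 ν μt
  bias : wasserstein1 (target U) μt ≤ ENNReal.ofReal (M2 * h ^ 2)

/-! ### The constants of the bound -/

/-- `(3/2) (T⁻² + 27 d L_H² T⁴)^{1/2}`. -/
def regConst (d : ℕ) (T LH : ℝ) : ℝ :=
  3 / 2 * Real.sqrt (T⁻¹ ^ 2 + 27 * d * LH ^ 2 * T ^ 4)

/-- The constant `C` of the `h²` bias bound; it is infinite if a moment of `μ` that occurs with a
nonzero coefficient is infinite. -/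
def biasConst (d : ℕ) (T L LH LI : ℝ) (μ : Measure (E d)) : ℝ≥0∞ :=
  (ENNReal.ofReal
      ((d : ℝ) ^ 3 * (4 * LI ^ 2 * T ^ 4 + 14 * LH ^ 2 * LI * T ^ 6 + 14 * LH ^ 4 * T ^ 8)
        + (d : ℝ) ^ 2 * (35 * LH ^ 2 * T ^ 2 + 8 * LI ^ 2 * T ^ 4
            + 28 * LH ^ 2 * LI * T ^ 6 + 28 * LH ^ 4 * T ^ 8)
        + d * (16 * L ^ 2 + 4 * LH ^ 2 * T ^ 2))
    + ENNReal.ofReal (2 * d * LH ^ 2 + L ^ 2 * T⁻¹ ^ 2) * ∫⁻ x, ‖x‖ₑ ^ 2 ∂μ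
    + ENNReal.ofReal
        (d * LI ^ 2 + d * LH ^ 2 * LI * T ^ 2 + d * LH ^ 4 * T ^ 4 + LH ^ 2 * T⁻¹ ^ 2)
      * ∫⁻ x, ‖x‖ₑ ^ 4 ∂μ) ^ (1 / 2 : ℝ)

/-! ### uHMC as a randomized algorithm with a gradient oracle -/

/-- Randomized algorithms on `ℝ^d` that access a gradient field only through point evaluations and
that may draw independent standard normal vectors; the result is a point of `ℝ^d`. -/
inductive GradAlg (d : ℕ) : Type
  | ret (x : E d) : GradAlg d
  | eval (x : E d) (next : E d → GradAlg d) : GradAlg d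
  | normal (next : E d → GradAlg d) : GradAlg d

/-- The law of the result when evaluations are answered by the vector field `G`. -/
def GradAlg.law {d : ℕ} (G : E d → E d) : GradAlg d → Measure (E d)
  | .ret x => Measure.dirac x
  | .eval x next => (next (G x)).law G
  | .normal next => (stdGaussian (E d)).bind fun v => (next v).law G

/-- The number of evaluations of `G` that the algorithm makes (worst case over the random draws). -/
def GradAlg.evals {d : ℕ} (G : E d → E d) : GradAlg d → ℕ∞
  | .ret _ => 0
  | .eval x next => 1 + (next (G x)).evals G
  | .normal next => ⨆ v, (next v).evals G

/-- `N` steps of velocity Verlet from position `q` and velocity `v`, where `g` is the stored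
gradient at `q`; continue with the final position and the gradient there. -/
def verletAlg {d : ℕ} (h : ℝ) :
    ℕ → E d → E d → E d → (E d → E d → GradAlg d) → GradAlg d
  | 0, q, _, g, next => next q g
  | N + 1, q, v, g, next =>
    let q' := q + h • v - (h ^ 2 / 2) • g
    .eval q' fun g' => verletAlg h N q' (v - (h / 2) • (g + g')) g' next

/-- `n` transition steps of uHMC (each with a fresh normal velocity and `N` Verlet steps) from
position `q` with stored gradient `g`. -/
def uhmcLoop {d : ℕ} (h : ℝ) (N : ℕ) : ℕ → E d → E d → GradAlg d
  | 0, q, _ => .ret q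
  | n + 1, q, g => .normal fun v => verletAlg h N q v g (uhmcLoop h N n)

/-- `n` transition steps of uHMC with step size `h` and duration `N h` from the position `x`. -/
def uhmcAlg {d : ℕ} (h : ℝ) (N n : ℕ) (x : E d) : GradAlg d :=
  .eval x fun g => uhmcLoop h N n x g

/-! ### The transition kernel is the intended one -/

lemma measurable_verletPos {d : ℕ} {U : E d → ℝ} (hU : ContDiff ℝ 1 U) (h : ℝ) (N : ℕ) :
    Measurable (verletPos U h N) := by
  have hg : Continuous (∇ U) :=
    (InnerProductSpace.toDual ℝ (E d)).symm.continuous.comp (hU.continuous_fderiv one_ne_zero)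
  have hs : Continuous (verletStep U h) := by
    unfold verletStep
    fun_prop
  exact (continuous_fst.comp (hs.iterate N)).measurable

lemma uhmcKernel_apply {d : ℕ} {U : E d → ℝ} (hU : ContDiff ℝ 1 U) (h : ℝ) (N : ℕ) (x : E d) :
    uhmcKernel U h N x = (stdGaussian (E d)).map fun v => verletPos U h N (x, v) := by
  have hm := measurable_verletPos hU h N
  rw [uhmcKernel, Kernel.map_apply _ hm, Kernel.prod_apply, Kernel.id_apply, Kernel.const_apply,
    Measure.dirac_prod, Measure.map_map hm (by fun_prop)]
  rfl

end UHMC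

end

/-! The passage from μ to (νπ̃^m)π̃ is split at μπ̃ and μ̃π̃. Two of the three pieces compare one
transition from two initial laws. Regularization handles them: after one transition, total variation
is at most (2/5)·`regConst` times the W¹ distance of the initial laws (`ofReal_abs_bind_sub_le`),
and (A5), (A6) bound that distance. The third piece, μ against μπ̃, is the one-step bias.

Regularization and bias both reduce to comparing the laws of two maps F₀, F₁ of a Gaussian vector
whose derivatives are within T/11 of T·Id (`abs_map_stdGaussian_sub_le`). Along G_t = F₀ + t(F₁ −
F₀), the derivative of E f(G_t) is E Df(G_t)(F₁ − F₀). Solving DG_t w = F₁ − F₀ turns it into E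
D(f∘G_t)(w), and Gaussian integration by parts into E (f∘G_t − 1/2) δw with δw = ⟨v, w⟩ − tr Dw.
Since |f − 1/2| ≤ 1/2 and E (δw)² ≤ E(|w|² + d‖Dw‖²), no derivative of f survives. The bounds on F₁
− F₀ and on its derivative come from a discrete Gronwall inequality for Verlet recursions with LT² ≤
1/6.

For the bias the exact Hamiltonian flow is never needed. Verlet with step h is compared with Verlet
with step h/2: on the coarse grid the fine scheme is the coarse one with local errors O(h³), so the
kernels differ by O(h²) (`abs_uhmcKernel_half_sub_le`). Repeated halving gives a geometric series
with (3/4)·Σ 4⁻ᵏ = 1. Its limit is μ itself, because Verlet preserves Lebesgue measure and its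
energy error tends to zero (`tendsto_bind_uhmcKernel`).

At m = 0, where (A5) is silent, the bound needs M₁ ≥ 2/5. This is forced: a transition moves
far-away points only by a small fraction of their norm, so W¹ cannot shrink too fast
(`two_fifths_le_of_wassersteinAssumptions`).

For the gradient count, the bias is of order h²d^{3/2}; hence N of order d^{3/4}ε^{-1/2} and m of
order log(d/ε) suffice (`exists_steps`). -/

noncomputable section

/-! ### Standard Gaussian measure: density, Stein's identity, moments. -/

namespace UHMC
open scoped RealInnerProductSpace

/-- The density of the standard Gaussian measure with respect to Lebesgue measure. -/
def gaussDens {d : ℕ} (v : E d) : ℝ :=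
  ((2 * Real.pi) ^ ((d : ℝ) / 2))⁻¹ * Real.exp (-(1 / 2) * ‖v‖ ^ 2)

variable {d : ℕ}

lemma gaussDens_pos (v : E d) : 0 < gaussDens v := by
  unfold gaussDens
  positivity

lemma contDiff_gaussDens {n : WithTop ℕ∞} : ContDiff ℝ n (gaussDens (d := d)) := by
  unfold gaussDens
  exact contDiff_const.mul (contDiff_const.mul (contDiff_norm_sq ℝ)).exp

lemma integrable_gaussDens : Integrable (gaussDens (d := d)) := by
  have h := (GaussianFourier.integrable_cexp_neg_mul_sq_norm_add (V := E d) (b := 1 / 2)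
    (by norm_num) 0 0).norm
  refine (h.const_mul (((2 * Real.pi) ^ ((d : ℝ) / 2))⁻¹)).congr (Filter.Eventually.of_forall ?_)
  intro v
  simp only [gaussDens, Complex.norm_exp]
  congr 2
  simp [← Complex.ofReal_pow]

/-- Both measures are finite and have characteristic function exp(−‖t‖²/2). The density opens the
way to integration by parts for Lebesgue measure. -/
lemma stdGaussian_eq_withDensity :
    stdGaussian (E d) = volume.withDensity fun v => ENNReal.ofReal (gaussDens v) := by
  have hfin : IsFiniteMeasure (volume.withDensity fun v : E d => ENNReal.ofReal (gaussDens v)) :=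
    isFiniteMeasure_withDensity_ofReal integrable_gaussDens.2
  apply Measure.ext_of_charFun
  ext t
  rw [charFun_stdGaussian, charFun_apply, integral_withDensity_eq_integral_toReal_smul
    (by have := (contDiff_gaussDens (d := d) (n := 0)).continuous.measurable; fun_prop)
    (by simp)]
  have h := GaussianFourier.integral_cexp_neg_mul_sq_norm_add (V := E d) (b := 1 / 2)
    (by norm_num) Complex.I t
  have e : ∀ v : E d, (ENNReal.ofReal (gaussDens v)).toReal • Complex.exp (⟪v, t⟫ * Complex.I)
      = (((2 * Real.pi) ^ ((d : ℝ) / 2))⁻¹ : ℝ)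
        * Complex.exp (-(1 / 2) * ‖v‖ ^ 2 + Complex.I * ⟪t, v⟫) := by
    intro v
    rw [ENNReal.toReal_ofReal (gaussDens_pos v).le, gaussDens, Complex.real_smul, Complex.exp_add,
      real_inner_comm, mul_comm Complex.I]
    push_cast
    ring
  simp_rw [e]
  rw [integral_const_mul, h, ← mul_assoc]
  have hc : ((Real.pi : ℂ) / (1 / 2)) ^ ((Module.finrank ℝ (E d) : ℂ) / 2)
      = (((2 * Real.pi) ^ ((d : ℝ) / 2) : ℝ) : ℂ) := by
    rw [Complex.ofReal_cpow (by positivity), finrank_euclideanSpace_fin]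
    push_cast
    congr 1
    ring
  rw [hc, ← Complex.ofReal_mul, inv_mul_cancel₀ (by positivity), Complex.ofReal_one, one_mul]
  congr 1
  rw [Complex.I_sq]
  ring

lemma integral_stdGaussian {F : Type*} [NormedAddCommGroup F] [NormedSpace ℝ F] (f : E d → F) :
    ∫ v, f v ∂(stdGaussian (E d)) = ∫ v, gaussDens v • f v := by
  rw [stdGaussian_eq_withDensity, integral_withDensity_eq_integral_toReal_smul
    (by have := (contDiff_gaussDens (d := d) (n := 0)).continuous.measurable; fun_prop)
    (by simp)]
  simp [ENNReal.toReal_ofReal (gaussDens_pos _).le]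

lemma integrable_stdGaussian_iff {f : E d → ℝ} :
    Integrable f (stdGaussian (E d)) ↔ Integrable fun v => gaussDens v * f v := by
  rw [stdGaussian_eq_withDensity, integrable_withDensity_iff_integrable_smul']
  · simp [ENNReal.toReal_ofReal (gaussDens_pos _).le]
  · have := (contDiff_gaussDens (d := d) (n := 0)).continuous.measurable; fun_prop
  · simp

lemma fderiv_gaussDens (v u : E d) : fderiv ℝ gaussDens v u = -(gaussDens v * ⟪v, u⟫) := by
  have h : HasFDerivAt (gaussDens (d := d)) _ v :=
    (((hasStrictFDerivAt_norm_sq v).hasFDerivAt.const_mul (-(1 / 2 : ℝ))).exp.const_mul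
      (((2 * Real.pi) ^ ((d : ℝ) / 2))⁻¹))
  rw [h.fderiv]
  simp [gaussDens]
  ring

/-- **Stein's identity** in the direction `u`. -/
lemma stein {f : E d → ℝ} (hf : Differentiable ℝ f) (u : E d)
    (h0 : Integrable f (stdGaussian (E d)))
    (h1 : Integrable (fun v => f v * ⟪v, u⟫) (stdGaussian (E d)))
    (h2 : Integrable (fun v => fderiv ℝ f v u) (stdGaussian (E d))) :
    ∫ v, f v * ⟪v, u⟫ ∂(stdGaussian (E d)) = ∫ v, fderiv ℝ f v u ∂(stdGaussian (E d)) := by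
  rw [integrable_stdGaussian_iff] at h0 h1 h2
  -- Integration by parts for Lebesgue measure against `gaussDens`, whose derivative along u is −⟨v,
  -- u⟩ times itself.
  have := integral_mul_fderiv_eq_neg_fderiv_mul_of_integrable (μ := (volume : Measure (E d)))
    (f := f) (g := gaussDens) (v := u) (by simpa only [mul_comm] using h2)
    (by
      simp_rw [fderiv_gaussDens]
      refine h1.neg.congr (Filter.Eventually.of_forall fun v => ?_)
      simp; ring)
    (by simpa only [mul_comm] using h0) (fun x _ => hf x)
    (fun x _ => (contDiff_gaussDens (n := 1)).differentiable one_ne_zero x)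
  rw [integral_stdGaussian, integral_stdGaussian]
  simp_rw [fderiv_gaussDens, smul_eq_mul] at this ⊢
  calc ∫ v, gaussDens v * (f v * ⟪v, u⟫) = -∫ v, f v * -(gaussDens v * ⟪v, u⟫) := by
        rw [← integral_neg]
        congr 1
        ext v
        ring
    _ = _ := by
        rw [this, neg_neg]
        simp_rw [mul_comm]

lemma hasFDerivAt_inner_left (u v : E d) :
    HasFDerivAt (fun v : E d => ⟪v, u⟫) (innerSL ℝ u) v := by
  simp_rw [real_inner_comm u]
  exact (innerSL ℝ u).hasFDerivAt

lemma integrable_norm_pow_stdGaussian (n : ℕ) :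
    Integrable (fun v : E d => ‖v‖ ^ n) (stdGaussian (E d)) := by
  have h := (IsGaussian.memLp_id (stdGaussian (E d)) n (by simp))
  simpa using h.integrable_norm_pow'

lemma integral_inner_sq_stdGaussian (u : E d) :
    ∫ v, ⟪v, u⟫ ^ 2 ∂(stdGaussian (E d)) = ‖u‖ ^ 2 := by
  have hd := hasFDerivAt_inner_left u
  have h := stein (d := d) (f := fun v => ⟪v, u⟫) (fun v => (hd v).differentiableAt) u ?_ ?_ ?_
  · simp_rw [(hd _).fderiv] at h
    simpa [sq] using h
  · refine ((integrable_norm_pow_stdGaussian (d := d) 1).mul_const ‖u‖).mono'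
      (by fun_prop) (Filter.Eventually.of_forall fun v => ?_)
    simpa using abs_real_inner_le_norm v u
  · refine ((integrable_norm_pow_stdGaussian (d := d) 2).mul_const (‖u‖ ^ 2)).mono'
      (by fun_prop) (Filter.Eventually.of_forall fun v => ?_)
    rw [Real.norm_eq_abs, abs_mul, ← mul_pow, sq]
    gcongr <;> exact abs_real_inner_le_norm v u
  · simp_rw [(hd _).fderiv]
    exact integrable_const _

lemma integral_inner_pow_four_stdGaussian (u : E d) :
    ∫ v, ⟪v, u⟫ ^ 4 ∂(stdGaussian (E d)) = 3 * ‖u‖ ^ 4 := by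
  have hd : ∀ v, HasFDerivAt (fun v : E d => ⟪v, u⟫ ^ 3) ((3 * ⟪v, u⟫ ^ 2) • innerSL ℝ u) v :=
    fun v => by simpa using (hasFDerivAt_inner_left u v).pow 3
  have hb : ∀ n : ℕ, Integrable (fun v : E d => ⟪v, u⟫ ^ n) (stdGaussian (E d)) := fun n => by
    refine ((integrable_norm_pow_stdGaussian (d := d) n).mul_const (‖u‖ ^ n)).mono'
      (by fun_prop) (Filter.Eventually.of_forall fun v => ?_)
    rw [Real.norm_eq_abs, abs_pow, ← mul_pow]
    gcongr
    exact abs_real_inner_le_norm v u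
  -- Stein's identity lowers the fourth moment to 3‖u‖² times the second.
  have h := stein (d := d) (f := fun v => ⟪v, u⟫ ^ 3) (fun v => (hd v).differentiableAt) u
    (hb 3) (by simpa only [← pow_succ] using hb 4) ?_
  · simp_rw [(hd _).fderiv, ← pow_succ] at h
    simp only [smul_apply, innerSL_apply_apply, smul_eq_mul,
      real_inner_self_eq_norm_sq] at h
    rw [h, integral_mul_const, integral_const_mul, integral_inner_sq_stdGaussian]
    ring
  · simp_rw [(hd _).fderiv]
    simpa using ((hb 2).const_mul 3).mul_const _

lemma integral_norm_sq_stdGaussian : ∫ v, ‖v‖ ^ 2 ∂(stdGaussian (E d)) = d := by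
  simp_rw [← (EuclideanSpace.basisFun (Fin d) ℝ).sum_sq_inner_left]
  rw [integral_finsetSum]
  · simp_rw [integral_inner_sq_stdGaussian]
    simp
  · intro i _
    refine (integrable_norm_pow_stdGaussian (d := d) 2).mono'
      (by fun_prop) (Filter.Eventually.of_forall fun v => ?_)
    rw [Real.norm_eq_abs, abs_pow]
    gcongr
    simpa using abs_real_inner_le_norm v (EuclideanSpace.basisFun (Fin d) ℝ i)

lemma integral_norm_pow_four_stdGaussian_le :
    ∫ v, ‖v‖ ^ 4 ∂(stdGaussian (E d)) ≤ 3 * (d : ℝ) ^ 2 := by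
  have hb : ∀ i, Integrable (fun v : E d => ⟪v, EuclideanSpace.basisFun (Fin d) ℝ i⟫ ^ 4)
      (stdGaussian (E d)) := fun i => by
    refine (integrable_norm_pow_stdGaussian (d := d) 4).mono'
      (by fun_prop) (Filter.Eventually.of_forall fun v => ?_)
    rw [Real.norm_eq_abs, abs_pow]
    gcongr
    simpa using abs_real_inner_le_norm v (EuclideanSpace.basisFun (Fin d) ℝ i)
  calc ∫ v, ‖v‖ ^ 4 ∂(stdGaussian (E d))
      ≤ ∫ v, d * ∑ i, ⟪v, EuclideanSpace.basisFun (Fin d) ℝ i⟫ ^ 4 ∂(stdGaussian (E d)) := by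
        refine integral_mono (integrable_norm_pow_stdGaussian 4)
          ((integrable_finsetSum _ fun i _ => hb i).const_mul _) fun v => ?_
        -- Cauchy–Schwarz over the d coordinates: ‖v‖⁴ = (Σ vᵢ²)² ≤ d Σ vᵢ⁴. This avoids the mixed
        -- moments.
        have := sq_sum_le_card_mul_sum_sq (s := Finset.univ)
          (f := fun i => ⟪v, EuclideanSpace.basisFun (Fin d) ℝ i⟫ ^ 2)
        rw [(EuclideanSpace.basisFun (Fin d) ℝ).sum_sq_inner_left] at this
        simpa [← pow_mul] using this
    _ = 3 * (d : ℝ) ^ 2 := by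
        rw [integral_const_mul, integral_finsetSum _ fun i _ => hb i]
        simp_rw [integral_inner_pow_four_stdGaussian]
        simp
        ring
end UHMC

/-! ### The Gaussian divergence of a vector field and its L² norm. -/

namespace UHMC
open scoped RealInnerProductSpace
variable {d : ℕ}

/-- The trace of a linear map, in the standard basis. -/
def diagSum (A : E d →L[ℝ] E d) : ℝ :=
  ∑ i, ⟪A (EuclideanSpace.basisFun (Fin d) ℝ i), EuclideanSpace.basisFun (Fin d) ℝ i⟫

/-- The Gaussian divergence (Skorokhod integral) of a vector field. -/
def gaussDiv (w : E d → E d) (v : E d) : ℝ := ⟪v, w v⟫ - diagSum (fderiv ℝ w v)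

lemma diagSum_add (A B : E d →L[ℝ] E d) : diagSum (A + B) = diagSum A + diagSum B := by
  simp [diagSum, inner_add_left, Finset.sum_add_distrib]

lemma continuous_diagSum : Continuous (diagSum (d := d)) := by
  unfold diagSum
  fun_prop

lemma abs_diagSum_le (A : E d →L[ℝ] E d) : |diagSum A| ≤ d * ‖A‖ := by
  refine (Finset.abs_sum_le_sum_abs _ _).trans ?_
  calc _ ≤ ∑ _i : Fin d, ‖A‖ := by
        refine Finset.sum_le_sum fun i _ => (abs_real_inner_le_norm _ _).trans ?_
        have := A.le_opNorm (EuclideanSpace.basisFun (Fin d) ℝ i)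
        simpa using this
    _ = _ := by simp

lemma integrable_stdGaussian_of_compact {f : E d → ℝ} (hf : Continuous f)
    (hc : HasCompactSupport f) : Integrable f (stdGaussian (E d)) :=
  hf.integrable_of_hasCompactSupport hc

/-- Integration by parts for the standard Gaussian measure and a compactly supported field. -/
lemma integral_fderiv_apply_eq {φ : E d → ℝ} {w : E d → E d} (hφ : ContDiff ℝ 1 φ)
    (hw : ContDiff ℝ 1 w) (hc : HasCompactSupport w) :
    ∫ v, fderiv ℝ φ v (w v) ∂(stdGaussian (E d))
      = ∫ v, φ v * gaussDiv w v ∂(stdGaussian (E d)) := by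
  set b := EuclideanSpace.basisFun (Fin d) ℝ with hb
  have hφ' := hφ.continuous_fderiv one_ne_zero
  have hw' := hw.continuous_fderiv one_ne_zero
  have hφc := hφ.continuous
  have hwc := hw.continuous
  have hci : ∀ i, HasCompactSupport fun v => ⟪w v, b i⟫ := fun i =>
    hc.comp_left (g := fun x => ⟪x, b i⟫) (by simp)
  have hci' : ∀ i, HasCompactSupport fun v => ⟪fderiv ℝ w v (b i), b i⟫ := fun i =>
    (hc.fderiv ℝ).comp_left (g := fun A : E d →L[ℝ] E d => ⟪A (b i), b i⟫) (by simp)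
  have hD : ∀ i v u, fderiv ℝ (fun v => φ v * ⟪w v, b i⟫) v u
      = φ v * ⟪fderiv ℝ w v u, b i⟫ + fderiv ℝ φ v u * ⟪w v, b i⟫ := fun i v u => by
    have h1 := (hφ.differentiable one_ne_zero v).hasFDerivAt
    have h2 := ((hasFDerivAt_inner_left (b i) (w v)).comp v
      (hw.differentiable one_ne_zero v).hasFDerivAt)
    have h3 : HasFDerivAt (fun v => φ v * ⟪w v, b i⟫) _ v := h1.mul h2
    rw [h3.fderiv]
    simp [real_inner_comm, mul_comm]
  have hI1 : ∀ i, Integrable (fun v => φ v * ⟪fderiv ℝ w v (b i), b i⟫) (stdGaussian (E d)) :=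
    fun i => integrable_stdGaussian_of_compact (by fun_prop) (hci' i).mul_left
  have hI2 : ∀ i, Integrable (fun v => fderiv ℝ φ v (b i) * ⟪w v, b i⟫) (stdGaussian (E d)) :=
    fun i => integrable_stdGaussian_of_compact (by fun_prop) (hci i).mul_left
  have hI3 : ∀ i, Integrable (fun v => φ v * ⟪w v, b i⟫ * ⟪v, b i⟫) (stdGaussian (E d)) :=
    fun i => integrable_stdGaussian_of_compact (by fun_prop) ((hci i).mul_left.mul_right)
  -- Stein's identity in the direction bᵢ for φ⟨w, bᵢ⟩; summing over i assembles the divergence.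
  have hst : ∀ i, ∫ v, fderiv ℝ φ v (b i) * ⟪w v, b i⟫ ∂(stdGaussian (E d))
      = ∫ v, φ v * (⟪w v, b i⟫ * ⟪v, b i⟫ - ⟪fderiv ℝ w v (b i), b i⟫)
        ∂(stdGaussian (E d)) := fun i => by
    have h := stein (f := fun v => φ v * ⟪w v, b i⟫)
      ((hφ.mul (hw.inner ℝ contDiff_const)).differentiable one_ne_zero) (b i)
      (integrable_stdGaussian_of_compact (by fun_prop) (hci i).mul_left) (hI3 i)
      (by simp_rw [hD]; exact (hI1 i).add (hI2 i))
    simp_rw [hD] at h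
    rw [integral_add (hI1 i) (hI2 i)] at h
    simp_rw [mul_sub, ← mul_assoc]
    rw [integral_sub (hI3 i) (hI1 i), h]
    ring
  have hexp : ∀ v, fderiv ℝ φ v (w v) = ∑ i, fderiv ℝ φ v (b i) * ⟪w v, b i⟫ := fun v => by
    conv_lhs => rw [← b.sum_repr' (w v)]
    simp [mul_comm, real_inner_comm]
  have hdiv : ∀ v, φ v * gaussDiv w v
      = ∑ i, φ v * (⟪w v, b i⟫ * ⟪v, b i⟫ - ⟪fderiv ℝ w v (b i), b i⟫) := fun v => by
    rw [← Finset.mul_sum, Finset.sum_sub_distrib, gaussDiv, diagSum, ← b.sum_inner_mul_inner]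
    simp [real_inner_comm, mul_comm, hb]
  simp_rw [hexp, hdiv]
  rw [integral_finsetSum _ fun i _ => hI2 i, integral_finsetSum]
  · exact Finset.sum_congr rfl fun i _ => hst i
  · intro i _
    simp_rw [mul_sub, ← mul_assoc]
    exact (hI3 i).sub (hI1 i)

lemma fderiv_diagSum_fderiv {w : E d → E d} (hw : ContDiff ℝ 2 w) (v u : E d) :
    fderiv ℝ (fun v => diagSum (fderiv ℝ w v)) v u = diagSum (fderiv ℝ (fderiv ℝ w) v u) := by
  have h := ((hw.fderiv_right (m := 1) le_rfl).differentiable one_ne_zero v).hasFDerivAt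
  have h2 : HasFDerivAt (fun v => diagSum (fderiv ℝ w v))
      (∑ i, (innerSL ℝ (EuclideanSpace.basisFun (Fin d) ℝ i)).comp
        ((ContinuousLinearMap.apply ℝ (E d) (EuclideanSpace.basisFun (Fin d) ℝ i)).comp
          (fderiv ℝ (fderiv ℝ w) v))) v := by
    unfold diagSum
    refine HasFDerivAt.fun_sum fun i _ => ?_
    exact (hasFDerivAt_inner_left _ _).comp v
      ((ContinuousLinearMap.apply ℝ (E d)
        (EuclideanSpace.basisFun (Fin d) ℝ i)).hasFDerivAt.comp v h)
  rw [h2.fderiv]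
  simp [diagSum, real_inner_comm]

/-- The energy inequality for the Gaussian divergence of a compactly supported field. -/
lemma integral_gaussDiv_sq_le {w : E d → E d} (hw : ContDiff ℝ 2 w) (hc : HasCompactSupport w) :
    ∫ v, gaussDiv w v ^ 2 ∂(stdGaussian (E d))
      ≤ ∫ v, (‖w v‖ ^ 2 + d * ‖fderiv ℝ w v‖ ^ 2) ∂(stdGaussian (E d)) := by
  have hw1 : ContDiff ℝ 1 w := hw.of_le (by norm_num)
  have hw' : ContDiff ℝ 1 (fderiv ℝ w) := hw.fderiv_right le_rfl
  have hwc := hw.continuous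
  have hwc' := hw'.continuous
  have hwc'' := hw'.continuous_fderiv one_ne_zero
  have htr : ContDiff ℝ 1 fun v => diagSum (fderiv ℝ w v) := by
    unfold diagSum
    exact ContDiff.sum fun i _ => (hw'.clm_apply contDiff_const).inner ℝ contDiff_const
  have hδ : ContDiff ℝ 1 (gaussDiv w) := by
    unfold gaussDiv
    exact (contDiff_id.inner ℝ hw1).sub htr
  -- By duality E (δw)² = E D(δw)(w). With z = Dw·w, the integrand equals |w|² + tr(Dw∘Dw) + δz, and
  -- δz has mean zero. Thus second derivatives of w do not enter the bound.
  set z : E d → E d := fun v => fderiv ℝ w v (w v) with hz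
  have hz1 : ContDiff ℝ 1 z := hw'.clm_apply hw1
  have hzc : HasCompactSupport z := by
    refine hc.mono fun v hv h => hv ?_
    simp [hz, h]
  have hDδ : ∀ v, fderiv ℝ (gaussDiv w) v (w v)
      = ‖w v‖ ^ 2 + ⟪v, z v⟫ - diagSum (fderiv ℝ (fderiv ℝ w) v (w v)) := fun v => by
    have h1 : HasFDerivAt (fun v => ⟪v, w v⟫) _ v :=
      (hasFDerivAt_id v).inner ℝ (hw1.differentiable one_ne_zero v).hasFDerivAt
    have h2 := (htr.differentiable one_ne_zero v).hasFDerivAt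
    have h3 : HasFDerivAt (gaussDiv w) _ v := h1.sub h2
    rw [h3.fderiv]
    simp [fderiv_diagSum_fderiv hw, hz]
    ring
  have hDz : ∀ v, diagSum (fderiv ℝ z v)
      = diagSum (fderiv ℝ (fderiv ℝ w) v (w v))
        + diagSum ((fderiv ℝ w v).comp (fderiv ℝ w v)) := fun v => by
    have h1 : HasFDerivAt z _ v := (hw'.differentiable one_ne_zero v).hasFDerivAt.clm_apply
      (hw1.differentiable one_ne_zero v).hasFDerivAt
    -- Symmetry of D²w identifies the second-order term in tr Dz with the one in D(δw)(w), so that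
    -- they cancel.
    have hs : IsSymmSndFDerivAt ℝ w v := hw.contDiffAt.isSymmSndFDerivAt (by simp)
    rw [h1.fderiv, add_comm, diagSum_add]
    congr 2
    ext1 u
    simpa using hs u (w v)
  have e1 := integral_fderiv_apply_eq hδ hw1 hc
  -- Testing against the constant 1 shows that a divergence has mean zero.
  have e2 := integral_fderiv_apply_eq (φ := fun _ => 1) contDiff_const hz1 hzc
  simp only [fderiv_const_apply, zero_apply, integral_zero, one_mul] at e2
  have c1 : Integrable (fun v => ‖w v‖ ^ 2) (stdGaussian (E d)) :=
    integrable_stdGaussian_of_compact (by fun_prop)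
      (hc.comp_left (g := fun x => ‖x‖ ^ 2) (by simp))
  have c2 : Integrable (fun v => ‖fderiv ℝ w v‖ ^ 2) (stdGaussian (E d)) :=
    integrable_stdGaussian_of_compact (by fun_prop)
      ((hc.fderiv ℝ).comp_left (g := fun x => ‖x‖ ^ 2) (by simp))
  have c3 : Integrable (fun v => diagSum ((fderiv ℝ w v).comp (fderiv ℝ w v)))
      (stdGaussian (E d)) :=
    integrable_stdGaussian_of_compact (continuous_diagSum.comp (by fun_prop))
      ((hc.fderiv ℝ).comp_left (g := fun A : E d →L[ℝ] E d => diagSum (A.comp A))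
        (by simp [diagSum]))
  have c4 : Integrable (gaussDiv z) (stdGaussian (E d)) := by
    have hz' := hz1.continuous_fderiv one_ne_zero
    have hzc' := hz1.continuous
    refine integrable_stdGaussian_of_compact ?_ ?_
    · unfold gaussDiv
      exact (continuous_id.inner hzc').sub (continuous_diagSum.comp hz')
    · have k1 : HasCompactSupport fun v => ⟪v, z v⟫ := by
        refine hzc.mono fun v hv h => hv ?_
        simp [h]
      exact k1.sub ((hzc.fderiv ℝ).comp_left (g := diagSum) (by simp [diagSum]))
  have key : ∀ v, fderiv ℝ (gaussDiv w) v (w v)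
      = ‖w v‖ ^ 2 + diagSum ((fderiv ℝ w v).comp (fderiv ℝ w v)) + gaussDiv z v := fun v => by
    rw [hDδ, gaussDiv, hDz]
    ring
  simp_rw [key] at e1
  have e3 := integral_add (c1.add c3) c4
  simp only [Pi.add_apply] at e3
  rw [e3, ← e2, add_zero] at e1
  calc ∫ v, gaussDiv w v ^ 2 ∂(stdGaussian (E d)) = _ := by
        simp_rw [sq]
        exact e1.symm
    _ ≤ _ := by
        refine integral_mono (c1.add c3) (c1.add (c2.const_mul _)) fun v => ?_
        have h1 := (le_abs_self _).trans (abs_diagSum_le ((fderiv ℝ w v).comp (fderiv ℝ w v)))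
        have h2 := (fderiv ℝ w v).opNorm_comp_le (fderiv ℝ w v)
        have h3 : (d : ℝ) * ‖(fderiv ℝ w v).comp (fderiv ℝ w v)‖
            ≤ d * (‖fderiv ℝ w v‖ * ‖fderiv ℝ w v‖) := by gcongr
        simp only
        rw [sq ‖fderiv ℝ w v‖]
        linarith
end UHMC

/-! ### Removing the compact support by cutoffs. -/

namespace UHMC
open scoped RealInnerProductSpace Topology
variable {d : ℕ}

/-- The derivative of φ is moved onto w. Then |φ| ≤ 1/2, Jensen's inequality for the square and the
energy inequality for the divergence finish. -/
lemma abs_integral_fderiv_apply_le_of_compact {φ : E d → ℝ} {w : E d → E d} (hφ : ContDiff ℝ 1 φ)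
    (hφb : ∀ v, |φ v| ≤ 1 / 2) (hw : ContDiff ℝ 2 w) (hc : HasCompactSupport w) :
    |∫ v, fderiv ℝ φ v (w v) ∂(stdGaussian (E d))|
      ≤ 1 / 2 * √(∫ v, (‖w v‖ ^ 2 + d * ‖fderiv ℝ w v‖ ^ 2) ∂(stdGaussian (E d))) := by
  have hw1 : ContDiff ℝ 1 w := hw.of_le (by norm_num)
  have hw' : ContDiff ℝ 1 (fderiv ℝ w) := hw.fderiv_right le_rfl
  have hgc : Continuous (gaussDiv w) := by
    unfold gaussDiv
    exact (continuous_id.inner hw.continuous).sub (continuous_diagSum.comp hw'.continuous)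
  have hgs : HasCompactSupport (gaussDiv w) := by
    have k1 : HasCompactSupport fun v => ⟪v, w v⟫ := by
      refine hc.mono fun v hv h => hv ?_
      simp [h]
    exact k1.sub ((hc.fderiv ℝ).comp_left (g := diagSum) (by simp [diagSum]))
  have hi : Integrable (gaussDiv w) (stdGaussian (E d)) :=
    integrable_stdGaussian_of_compact hgc hgs
  have hi2 : Integrable (fun v => gaussDiv w v ^ 2) (stdGaussian (E d)) :=
    integrable_stdGaussian_of_compact (by fun_prop)
      (hgs.comp_left (g := fun x => x ^ 2) (by simp))
  rw [integral_fderiv_apply_eq hφ hw1 hc]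
  calc |∫ v, φ v * gaussDiv w v ∂(stdGaussian (E d))|
      ≤ ∫ v, |φ v * gaussDiv w v| ∂(stdGaussian (E d)) := abs_integral_le_integral_abs
    _ ≤ ∫ v, 1 / 2 * |gaussDiv w v| ∂(stdGaussian (E d)) := by
        refine integral_mono_of_nonneg (Filter.Eventually.of_forall fun v => abs_nonneg _)
          (hi.abs.const_mul _) (Filter.Eventually.of_forall fun v => ?_)
        simp only [abs_mul]
        gcongr
        exact hφb v
    _ = 1 / 2 * ∫ v, |gaussDiv w v| ∂(stdGaussian (E d)) := integral_const_mul _ _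
    _ ≤ _ := by
        gcongr
        refine Real.le_sqrt_of_sq_le (le_trans ?_ (integral_gaussDiv_sq_le hw hc))
        have := (convexOn_pow (𝕜 := ℝ) 2).map_integral_le (μ := stdGaussian (E d))
          (f := fun v => |gaussDiv w v|) (by fun_prop) isClosed_Ici
          (Filter.Eventually.of_forall fun v => Set.mem_Ici.2 (abs_nonneg _)) hi.abs
          (by simpa [Function.comp_def] using hi2)
        simpa using this

/-- Smooth cutoff functions that exhaust the space and have small gradients. -/
lemma exists_cutoff (d : ℕ) : ∃ (χ : ℕ → E d → ℝ) (c : ℝ), 0 ≤ c ∧ (∀ n, ContDiff ℝ 2 (χ n)) ∧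
    (∀ n, HasCompactSupport (χ n)) ∧ (∀ n v, |χ n v| ≤ 1) ∧
    (∀ n v, ‖fderiv ℝ (χ n) v‖ ≤ c / (n + 1)) ∧
    ∀ v, Filter.Tendsto (fun n => χ n v) Filter.atTop (𝓝 1) := by
  let f : ContDiffBump (0 : E d) := ⟨1, 2, one_pos, one_lt_two⟩
  have hf : ContDiff ℝ 2 f := f.contDiff
  obtain ⟨c, hc⟩ := (hf.continuous_fderiv two_ne_zero).bounded_above_of_compact_support
    (f.hasCompactSupport.fderiv ℝ)
  have hs : ∀ n : ℕ, ((n : ℝ) + 1)⁻¹ ≠ 0 := fun n => by positivity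
  refine ⟨fun n v => f (((n : ℝ) + 1)⁻¹ • v), c, (norm_nonneg _).trans (hc 0), fun n => ?_,
    fun n => ?_, fun n v => ?_, fun n v => ?_, fun v => ?_⟩
  · exact hf.comp (contDiff_const_smul _)
  · exact f.hasCompactSupport.comp_smul (hs n)
  · rw [abs_of_nonneg f.nonneg]
    exact f.le_one
  · have h : HasFDerivAt (fun v : E d => f (((n : ℝ) + 1)⁻¹ • v)) _ v :=
      (hf.differentiable two_ne_zero _).hasFDerivAt.comp v
        ((hasFDerivAt_id v).const_smul (((n : ℝ) + 1)⁻¹))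
    rw [h.fderiv, ContinuousLinearMap.comp_smul, norm_smul, div_eq_inv_mul, norm_inv,
      Real.norm_of_nonneg (by positivity : (0 : ℝ) ≤ n + 1)]
    gcongr
    exact hc _
  · have h0 : Filter.Tendsto (fun n : ℕ => ((n : ℝ) + 1)⁻¹ • v) Filter.atTop (𝓝 0) := by
      have := (tendsto_one_div_add_atTop_nhds_zero_nat (𝕜 := ℝ)).smul_const v
      simpa using this
    have h1 := (f.continuous.tendsto 0).comp h0
    have : f 0 = 1 := f.one_of_mem_closedBall (by simp [f])
    rwa [this] at h1

/-- The compact case applies to χₙw. The gradient of χₙ is O(1/n), so the right side exceeds its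
limit by O(1/n) under the root, and the left side converges by dominated convergence. -/
lemma abs_integral_fderiv_apply_le {φ : E d → ℝ} {w : E d → E d} (hφ : ContDiff ℝ 1 φ)
    (hφb : ∀ v, |φ v| ≤ 1 / 2) (hw : ContDiff ℝ 2 w)
    (h1 : Integrable (fun v => ‖w v‖ ^ 2) (stdGaussian (E d)))
    (h2 : Integrable (fun v => ‖fderiv ℝ w v‖ ^ 2) (stdGaussian (E d)))
    (h3 : Integrable (fun v => fderiv ℝ φ v (w v)) (stdGaussian (E d))) :
    |∫ v, fderiv ℝ φ v (w v) ∂(stdGaussian (E d))|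
      ≤ 1 / 2 * √(∫ v, (‖w v‖ ^ 2 + d * ‖fderiv ℝ w v‖ ^ 2) ∂(stdGaussian (E d))) := by
  obtain ⟨χ, c, hc0, hχ, hχc, hχ1, hχ', hχt⟩ := exists_cutoff d
  have hwc := hw.continuous
  have hw'c := hw.continuous_fderiv two_ne_zero
  have hφ'c := hφ.continuous_fderiv one_ne_zero
  have hχcont := fun n => (hχ n).continuous
  set B := ∫ v, (‖w v‖ ^ 2 + d * ‖fderiv ℝ w v‖ ^ 2) ∂(stdGaussian (E d)) with hB
  -- With s = 1/(n+1), the excess in d‖D(χₙw)‖² is at most d(2sc‖w‖‖Dw‖ + s²c²‖w‖²). The bound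
  -- 2‖w‖‖Dw‖ ≤ ‖w‖² + ‖Dw‖² and s² ≤ s reduce it to s times the integrand of K.
  set K := d * ∫ v, (c * (‖w v‖ ^ 2 + ‖fderiv ℝ w v‖ ^ 2) + c ^ 2 * ‖w v‖ ^ 2)
    ∂(stdGaussian (E d)) with hK
  have hbound : ∀ n : ℕ, |∫ v, χ n v * fderiv ℝ φ v (w v) ∂(stdGaussian (E d))|
      ≤ 1 / 2 * √(B + 1 / ((n : ℝ) + 1) * K) := fun n => by
    have hwn : ContDiff ℝ 2 fun v => χ n v • w v := (hχ n).smul hw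
    have hs : HasCompactSupport fun v => χ n v • w v := (hχc n).smul_right
    have h := abs_integral_fderiv_apply_le_of_compact hφ hφb hwn hs
    simp only [map_smul, smul_eq_mul] at h
    refine h.trans ?_
    gcongr
    have hi1 := (h1.add h2).const_mul c
    have hi2 := h1.const_mul (c ^ 2)
    have hi3 : Integrable (fun v => ‖w v‖ ^ 2 + d * ‖fderiv ℝ w v‖ ^ 2) (stdGaussian (E d)) :=
      h1.add (h2.const_mul _)
    have hi4 : Integrable (fun v => (d : ℝ) * (c * (‖w v‖ ^ 2 + ‖fderiv ℝ w v‖ ^ 2)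
        + c ^ 2 * ‖w v‖ ^ 2)) (stdGaussian (E d)) := (hi1.add hi2).const_mul _
    rw [hK, hB, ← integral_const_mul, ← integral_const_mul, ← integral_add hi3 (hi4.const_mul _)]
    refine integral_mono_of_nonneg (Filter.Eventually.of_forall fun v => by positivity)
      (hi3.add (hi4.const_mul _)) (Filter.Eventually.of_forall fun v => ?_)
    simp only
    have hn : (0 : ℝ) < 1 / ((n : ℝ) + 1) := by positivity
    have hn1 : 1 / ((n : ℝ) + 1) ≤ 1 := by
      rw [div_le_one (by positivity)]
      linarith [(Nat.cast_nonneg n : (0 : ℝ) ≤ n)]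
    have hN1 : ‖χ n v • w v‖ ≤ ‖w v‖ := by
      rw [norm_smul]
      exact mul_le_of_le_one_left (norm_nonneg _) (hχ1 n v)
    have hD : HasFDerivAt (fun v => χ n v • w v) _ v :=
      ((hχ n).differentiable two_ne_zero v).hasFDerivAt.smul
        (hw.differentiable two_ne_zero v).hasFDerivAt
    have hN2 : ‖fderiv ℝ (fun v => χ n v • w v) v‖
        ≤ ‖fderiv ℝ w v‖ + 1 / ((n : ℝ) + 1) * (c * ‖w v‖) := by
      rw [hD.fderiv]
      refine (norm_add_le _ _).trans ?_
      rw [norm_smul, ContinuousLinearMap.norm_smulRight_apply]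
      have a1 : ‖χ n v‖ * ‖fderiv ℝ w v‖ ≤ ‖fderiv ℝ w v‖ :=
        mul_le_of_le_one_left (norm_nonneg _) (hχ1 n v)
      have a2 : ‖fderiv ℝ (χ n) v‖ * ‖w v‖ ≤ c / (n + 1) * ‖w v‖ := by
        gcongr
        exact hχ' n v
      calc _ ≤ _ := add_le_add a1 a2
        _ = _ := by ring
    generalize 1 / ((n : ℝ) + 1) = s at *
    have hd0 : (0 : ℝ) ≤ d := Nat.cast_nonneg d
    calc ‖χ n v • w v‖ ^ 2 + d * ‖fderiv ℝ (fun v => χ n v • w v) v‖ ^ 2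
        ≤ ‖w v‖ ^ 2 + d * (‖fderiv ℝ w v‖ + s * (c * ‖w v‖)) ^ 2 := by gcongr
      _ = ‖w v‖ ^ 2 + d * (‖fderiv ℝ w v‖ ^ 2
          + s * (c * (2 * (‖w v‖ * ‖fderiv ℝ w v‖)) + s * (c ^ 2 * ‖w v‖ ^ 2))) := by ring
      _ ≤ ‖w v‖ ^ 2 + d * (‖fderiv ℝ w v‖ ^ 2
          + s * (c * (‖w v‖ ^ 2 + ‖fderiv ℝ w v‖ ^ 2) + 1 * (c ^ 2 * ‖w v‖ ^ 2))) := by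
          gcongr
          nlinarith [sq_nonneg (‖w v‖ - ‖fderiv ℝ w v‖)]
      _ = _ := by ring
  have hlim : Filter.Tendsto (fun n => ∫ v, χ n v * fderiv ℝ φ v (w v) ∂(stdGaussian (E d)))
      Filter.atTop (𝓝 (∫ v, fderiv ℝ φ v (w v) ∂(stdGaussian (E d)))) := by
    refine tendsto_integral_of_dominated_convergence (fun v => ‖fderiv ℝ φ v (w v)‖)
      (fun n => ?_) h3.norm (fun n => Filter.Eventually.of_forall fun v => ?_)
      (Filter.Eventually.of_forall fun v => ?_)
    · have := hχcont n
      exact Continuous.aestronglyMeasurable (by fun_prop)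
    · rw [norm_mul]
      exact mul_le_of_le_one_left (norm_nonneg _) (hχ1 n v)
    · simpa using (hχt v).mul_const (fderiv ℝ φ v (w v))
  have hlim2 : Filter.Tendsto (fun n : ℕ => 1 / 2 * √(B + 1 / ((n : ℝ) + 1) * K))
      Filter.atTop (𝓝 (1 / 2 * √(B + 0 * K))) :=
    ((tendsto_const_nhds.add
      ((tendsto_one_div_add_atTop_nhds_zero_nat (𝕜 := ℝ)).mul_const K)).sqrt).const_mul _
  rw [zero_mul, add_zero] at hlim2
  exact le_of_tendsto_of_tendsto' hlim.abs hlim2 hbound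
end UHMC

/-! ### Total variation between the laws of two maps of a Gaussian vector. -/

namespace UHMC
open scoped RealInnerProductSpace Topology Manifold ContDiff
variable {d : ℕ}

/-- The total variation distance can be tested on smooth compactly supported functions. -/
lemma abs_measureReal_sub_le_of_smooth {ν η : Measure (E d)} [IsProbabilityMeasure ν]
    [IsProbabilityMeasure η] {C : ℝ}
    (h : ∀ f : E d → ℝ, ContDiff ℝ 1 f → HasCompactSupport f → (∀ x, 0 ≤ f x) → (∀ x, f x ≤ 1) →
      |∫ x, f x ∂ν - ∫ x, f x ∂η| ≤ C) {A : Set (E d)} (hA : MeasurableSet A) :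
    |ν.real A - η.real A| ≤ C := by
  refine le_of_forall_pos_le_add fun ε hε => ?_
  have hε' : ENNReal.ofReal (ε / 4) ≠ 0 := by simpa using hε
  -- Regularity is used for ν + η, so that one compact set K and one open set V serve both measures.
  obtain ⟨K, hKA, hK, hKm⟩ := hA.exists_isCompact_sdiff_lt (μ := ν + η) (by simp) hε'
  obtain ⟨V, hAV, hV, -, hVm⟩ := hA.exists_isOpen_sdiff_lt (μ := ν + η) (by simp) hε'
  obtain ⟨R, hR⟩ := hK.isBounded.subset_ball 0
  have hKVR : K ⊆ V ∩ Metric.ball 0 R := Set.subset_inter (hKA.trans hAV) hR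
  -- A smooth Urysohn function, 1 on K and 0 off V; intersecting V with a ball makes its support
  -- compact.
  obtain ⟨f, hf0, hf1, hf⟩ := exists_contMDiffMap_zero_one_of_isClosed (n := 1) 𝓘(ℝ, E d)
    (hV.inter Metric.isOpen_ball).isClosed_compl hK.isClosed
    (Set.disjoint_compl_left_iff_subset.2 hKVR)
  have hfc : HasCompactSupport f := by
    refine HasCompactSupport.of_support_subset_isCompact
      (isCompact_closedBall (0 : E d) R) fun x hx => ?_
    by_contra hxR
    exact hx (hf0 fun hx' => hxR (Metric.ball_subset_closedBall hx'.2))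
  have hfs : ContDiff ℝ 1 f := f.contMDiff.contDiff
  have hVK : MeasurableSet (V \ K) := hV.measurableSet.diff hK.measurableSet
  have hm : (ν + η) (V \ K) ≤ ENNReal.ofReal (ε / 2) := by
    calc (ν + η) (V \ K) ≤ (ν + η) ((V \ A) ∪ (A \ K)) := measure_mono fun x hx => by
          by_cases hxA : x ∈ A
          · exact Or.inr ⟨hxA, hx.2⟩
          · exact Or.inl ⟨hx.1, hxA⟩
      _ ≤ ENNReal.ofReal (ε / 4) + ENNReal.ofReal (ε / 4) :=
          (measure_union_le _ _).trans (add_le_add hVm.le hKm.le)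
      _ = _ := by
          rw [← ENNReal.ofReal_add (by positivity) (by positivity)]
          ring_nf
  -- The function f and the indicator of A differ only on V \ K, and by at most 1.
  have key : ∀ ρ : Measure (E d), IsProbabilityMeasure ρ → ρ ≤ ν + η →
      |∫ x, f x ∂ρ - ρ.real A| ≤ ε / 2 := fun ρ _ hρ => by
    have hi1 : Integrable f ρ := hfs.continuous.integrable_of_hasCompactSupport hfc
    have hi2 : Integrable (A.indicator fun _ => (1 : ℝ)) ρ := (integrable_const 1).indicator hA
    have e : ρ.real A = ∫ x, A.indicator (fun _ => (1 : ℝ)) x ∂ρ := by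
      rw [integral_indicator hA]
      simp
    rw [e, ← integral_sub hi1 hi2]
    refine abs_integral_le_integral_abs.trans ?_
    calc ∫ x, |f x - A.indicator (fun _ => (1 : ℝ)) x| ∂ρ
        ≤ ∫ x, (V \ K).indicator (fun _ => (1 : ℝ)) x ∂ρ := by
          refine integral_mono (hi1.sub hi2).abs ((integrable_const 1).indicator hVK) fun x => ?_
          by_cases hxK : x ∈ K
          · have : x ∈ A := hKA hxK
            have h1 : f x = 1 := hf1 hxK
            simp [this, h1, hxK]
          · by_cases hxV : x ∈ V
            · have h2 := hf x
              by_cases hxA : x ∈ A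
              · simp only [hxA, Set.indicator_of_mem, Set.mem_sdiff, hxV, hxK, not_false_eq_true,
                  and_self]
                rw [abs_le]
                constructor <;> linarith [h2.1, h2.2]
              · simp only [hxA, Set.indicator_of_mem, Set.mem_sdiff, hxV, hxK, not_false_eq_true,
                  and_self, Set.indicator_of_notMem, sub_zero]
                rw [abs_le]
                constructor <;> linarith [h2.1, h2.2]
            · have h3 : x ∉ A := fun h => hxV (hAV h)
              have h1 : f x = 0 := hf0 fun h => hxV h.1
              simp [h3, h1, hxV]
      _ = ρ.real (V \ K) := by
          rw [integral_indicator hVK]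
          simp
      _ ≤ ε / 2 := ENNReal.toReal_le_of_le_ofReal (by positivity) ((hρ _).trans hm)
  have k1 := key ν inferInstance (Measure.le_add_right le_rfl)
  have k2 := key η inferInstance (Measure.le_add_left le_rfl)
  have k3 := h f hfs hfc (fun x => (hf x).1) (fun x => (hf x).2)
  rw [abs_le] at *
  constructor <;> linarith [k1.1, k1.2, k2.1, k2.2, k3.1, k3.2]

/-- An operator close to a positive multiple of the identity has a right inverse that is a smooth
function of the operator. -/
lemma isUnit_of_norm_sub_le {T : ℝ} (hT : 0 < T) {A : E d →L[ℝ] E d}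
    (hA : ‖A - T • ContinuousLinearMap.id ℝ (E d)‖ ≤ T / 11) : IsUnit A := by
  have h1 : ‖1 - T⁻¹ • A‖ < 1 := by
    have : (1 : E d →L[ℝ] E d) - T⁻¹ • A = (-T⁻¹) • (A - T • ContinuousLinearMap.id ℝ (E d)) := by
      rw [smul_sub, smul_smul, neg_mul, inv_mul_cancel₀ hT.ne', ContinuousLinearMap.one_def]
      module
    rw [this, norm_smul, norm_neg, norm_inv, Real.norm_of_nonneg hT.le]
    calc T⁻¹ * ‖A - T • ContinuousLinearMap.id ℝ (E d)‖ ≤ T⁻¹ * (T / 11) := by gcongr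
      _ = 1 / 11 := by field_simp
      _ < 1 := by norm_num
  have h2 : IsUnit (T⁻¹ • A) := ⟨Units.oneSub _ h1, by simp⟩
  have h3 := ((isUnit_iff_ne_zero.2 hT.ne').map (algebraMap ℝ (E d →L[ℝ] E d))).mul h2
  rwa [← Algebra.smul_def, smul_smul, mul_inv_cancel₀ hT.ne', one_smul] at h3

/-- The perturbation can cost at most T/11, so A expands norms by at least 10T/11. This is the
source of the factor 11/10 in the later estimates. -/
lemma norm_le_of_norm_sub_le {T : ℝ} {A : E d →L[ℝ] E d}
    (hA : ‖A - T • ContinuousLinearMap.id ℝ (E d)‖ ≤ T / 11) (u : E d) :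
    T * ‖u‖ ≤ 11 / 10 * ‖A u‖ := by
  have h := (A - T • ContinuousLinearMap.id ℝ (E d)).le_of_opNorm_le hA u
  have h2 : T * ‖u‖ ≤ ‖T • u‖ := by
    rw [norm_smul]
    gcongr
    exact Real.le_norm_self T
  have h3 : ‖T • u‖ ≤ ‖A u‖ + ‖(A - T • ContinuousLinearMap.id ℝ (E d)) u‖ := by
    refine le_trans (le_of_eq ?_) (norm_sub_le _ _)
    simp
  linarith

/-- Solving `DG · w = e` for a vector field `w` when `DG` is close to a multiple of the identity. -/
lemma exists_field_of_fderiv {G e : E d → E d} {T κ : ℝ} {α β : E d → ℝ} (hT : 0 < T)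
    (hG : ContDiff ℝ 3 G) (hec : ContDiff ℝ 3 e)
    (hD : ∀ v, ‖fderiv ℝ G v - T • ContinuousLinearMap.id ℝ (E d)‖ ≤ T / 11)
    (hκ0 : 0 ≤ κ) (hκ : ∀ v v', ‖fderiv ℝ G v - fderiv ℝ G v'‖ ≤ κ * ‖v - v'‖)
    (hα : ∀ v, 11 / 10 * ‖e v‖ ≤ T * α v)
    (hβ : ∀ v, 11 / 10 * (‖fderiv ℝ e v‖ + κ * α v) ≤ T * β v) :
    ∃ w : E d → E d, ContDiff ℝ 2 w ∧ (∀ v, fderiv ℝ G v (w v) = e v) ∧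
      (∀ v, ‖w v‖ ≤ α v) ∧ ∀ v, ‖fderiv ℝ w v‖ ≤ β v := by
  have hDGc : ContDiff ℝ 2 (fderiv ℝ G) := hG.fderiv_right (by norm_num)
  have hunit : ∀ v, IsUnit (fderiv ℝ G v) := fun v => isUnit_of_norm_sub_le hT (hD v)
  -- Inversion is smooth at units, so w = (DG)⁻¹e inherits the C² regularity of DG.
  obtain ⟨w, hw⟩ : ∃ w : E d → E d, w = fun v => Ring.inverse (fderiv ℝ G v) (e v) := ⟨_, rfl⟩
  have hwc : ContDiff ℝ 2 w := by
    rw [hw]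
    refine ContDiff.clm_apply (contDiff_iff_contDiffAt.2 fun v => ?_) (hec.of_le (by norm_num))
    obtain ⟨u, hu⟩ := hunit v
    have := contDiffAt_ringInverse (n := 2) ℝ u
    rw [hu] at this
    exact this.comp v hDGc.contDiffAt
  have hGw : ∀ v, fderiv ℝ G v (w v) = e v := fun v => by
    rw [hw, ← mul_apply_eq_comp, Ring.mul_inverse_cancel _ (hunit v),
      one_apply_eq_self]
  have hwα : ∀ v, ‖w v‖ ≤ α v := fun v => by
    have h1 := norm_le_of_norm_sub_le (hD v) (w v)
    rw [hGw] at h1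
    exact le_of_mul_le_mul_left (h1.trans (hα v)) hT
  refine ⟨w, hwc, hGw, hwα, fun v => ?_⟩
  have hκ' : ‖fderiv ℝ (fderiv ℝ G) v‖ ≤ κ := by
    refine norm_fderiv_le_of_lipschitz (C := ⟨κ, hκ0⟩) ℝ (LipschitzWith.of_dist_le_mul ?_)
    intro x y
    rw [dist_eq_norm, dist_eq_norm]
    exact hκ x y
  have hα0 := (norm_nonneg _).trans (hwα v)
  have hβ0 : 0 ≤ β v := by
    refine nonneg_of_mul_nonneg_right (le_trans ?_ (hβ v)) hT
    positivity
  refine ContinuousLinearMap.opNorm_le_bound _ hβ0 fun u => ?_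
  have hprod : HasFDerivAt (fun v => fderiv ℝ G v (w v)) _ v :=
    (hDGc.differentiable two_ne_zero v).hasFDerivAt.clm_apply
      (hwc.differentiable two_ne_zero v).hasFDerivAt
  have h1 := hprod.fderiv
  simp_rw [hGw] at h1
  -- Differentiating DG·w = e along u expresses DG(Dw u) through De and D²G; inverting DG then
  -- bounds Dw.
  have h2 : fderiv ℝ G v (fderiv ℝ w v u) = fderiv ℝ e v u - fderiv ℝ (fderiv ℝ G) v u (w v) := by
    have := congrArg (fun A => A u) h1
    simp only [add_apply, ContinuousLinearMap.comp_apply,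
      ContinuousLinearMap.flip_apply] at this
    rw [show fderiv ℝ e v u = _ from this]
    abel
  have h3 := norm_le_of_norm_sub_le (hD v) (fderiv ℝ w v u)
  have h4 : ‖fderiv ℝ G v (fderiv ℝ w v u)‖ ≤ (‖fderiv ℝ e v‖ + κ * α v) * ‖u‖ := by
    rw [h2]
    refine (norm_sub_le _ _).trans ?_
    rw [add_mul]
    refine add_le_add (ContinuousLinearMap.le_opNorm _ _) ?_
    calc ‖fderiv ℝ (fderiv ℝ G) v u (w v)‖
        ≤ ‖fderiv ℝ (fderiv ℝ G) v‖ * ‖u‖ * ‖w v‖ := ContinuousLinearMap.le_opNorm₂ _ _ _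
      _ ≤ κ * ‖u‖ * α v := by
          gcongr
          exact hwα v
      _ = _ := by ring
  have h5 := hβ v
  refine le_of_mul_le_mul_left ?_ hT
  calc T * ‖fderiv ℝ w v u‖ ≤ 11 / 10 * ((‖fderiv ℝ e v‖ + κ * α v) * ‖u‖) :=
        h3.trans (by gcongr)
    _ = 11 / 10 * (‖fderiv ℝ e v‖ + κ * α v) * ‖u‖ := by ring
    _ ≤ T * β v * ‖u‖ := by gcongr
    _ = _ := by ring

/-- If DG·w = e, then Df(G)(e) is the derivative of f∘G − 1/2 along w. Subtracting 1/2 centres the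
values of f and produces the prefactor 1/2. -/
lemma abs_integral_fderiv_comp_le {G e : E d → E d} {T κ : ℝ} {α β : E d → ℝ} (hT : 0 < T)
    (hG : ContDiff ℝ 3 G) (hec : ContDiff ℝ 3 e)
    (hD : ∀ v, ‖fderiv ℝ G v - T • ContinuousLinearMap.id ℝ (E d)‖ ≤ T / 11)
    (hκ0 : 0 ≤ κ) (hκ : ∀ v v', ‖fderiv ℝ G v - fderiv ℝ G v'‖ ≤ κ * ‖v - v'‖)
    (hα : ∀ v, 11 / 10 * ‖e v‖ ≤ T * α v)
    (hβ : ∀ v, 11 / 10 * (‖fderiv ℝ e v‖ + κ * α v) ≤ T * β v)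
    (hα2 : Integrable (fun v => α v ^ 2) (stdGaussian (E d)))
    (hβ2 : Integrable (fun v => β v ^ 2) (stdGaussian (E d)))
    {f : E d → ℝ} (hf : ContDiff ℝ 1 f) (hf0 : ∀ x, 0 ≤ f x) (hf1 : ∀ x, f x ≤ 1)
    (hi : Integrable (fun v => fderiv ℝ f (G v) (e v)) (stdGaussian (E d))) :
    |∫ v, fderiv ℝ f (G v) (e v) ∂(stdGaussian (E d))|
      ≤ 1 / 2 * √(∫ v, (α v ^ 2 + d * β v ^ 2) ∂(stdGaussian (E d))) := by
  obtain ⟨w, hwc, hGw, hwα, hwβ⟩ := exists_field_of_fderiv hT hG hec hD hκ0 hκ hα hβ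
  have hwcont := hwc.continuous
  have hw'cont := hwc.continuous_fderiv two_ne_zero
  have i1 : Integrable (fun v => ‖w v‖ ^ 2) (stdGaussian (E d)) :=
    hα2.mono' (by fun_prop) (Filter.Eventually.of_forall fun v => by
      rw [norm_pow, norm_norm]
      gcongr
      exact hwα v)
  have i2 : Integrable (fun v => ‖fderiv ℝ w v‖ ^ 2) (stdGaussian (E d)) :=
    hβ2.mono' (by fun_prop) (Filter.Eventually.of_forall fun v => by
      rw [norm_pow, norm_norm]
      gcongr
      exact hwβ v)
  have hφD : ∀ v, fderiv ℝ (fun v => f (G v) - 1 / 2) v (w v)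
      = fderiv ℝ f (G v) (e v) := fun v => by
    have h := ((hf.differentiable one_ne_zero (G v)).hasFDerivAt.comp v
      (hG.differentiable (by norm_num) v).hasFDerivAt).sub_const (1 / 2)
    rw [HasFDerivAt.fderiv (f := fun v => f (G v) - 1 / 2) h,
      ContinuousLinearMap.comp_apply, hGw]
  have h := abs_integral_fderiv_apply_le (φ := fun v => f (G v) - 1 / 2) (w := w)
    ((hf.comp (hG.of_le (by norm_num))).sub contDiff_const)
    (fun v => abs_le.2 ⟨by linarith [hf0 (G v)], by linarith [hf1 (G v)]⟩) hwc i1 i2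
    (by simp_rw [hφD]; exact hi)
  simp_rw [hφD] at h
  refine h.trans ?_
  gcongr
  · exact i1.add (i2.const_mul _)
  · exact hα2.add (hβ2.const_mul _)
  · intro v
    simp only
    gcongr
    · exact hwα v
    · exact hwβ v

/-- If two maps have derivatives close to a multiple of the identity, the distance of the laws of
their values at a Gaussian vector is bounded by first-order norms of their difference. -/
lemma abs_integral_comp_sub_le {F₀ F₁ : E d → E d} {T κ : ℝ} {α β : E d → ℝ} (hT : 0 < T)
    (hF₀ : ContDiff ℝ 3 F₀) (hF₁ : ContDiff ℝ 3 F₁)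
    (hD₀ : ∀ v, ‖fderiv ℝ F₀ v - T • ContinuousLinearMap.id ℝ (E d)‖ ≤ T / 11)
    (hD₁ : ∀ v, ‖fderiv ℝ F₁ v - T • ContinuousLinearMap.id ℝ (E d)‖ ≤ T / 11)
    (hκ0 : 0 ≤ κ) (hκ₀ : ∀ v v', ‖fderiv ℝ F₀ v - fderiv ℝ F₀ v'‖ ≤ κ * ‖v - v'‖)
    (hκ₁ : ∀ v v', ‖fderiv ℝ F₁ v - fderiv ℝ F₁ v'‖ ≤ κ * ‖v - v'‖)
    (hα : ∀ v, 11 / 10 * ‖F₁ v - F₀ v‖ ≤ T * α v)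
    (hβ : ∀ v, 11 / 10 * (‖fderiv ℝ F₁ v - fderiv ℝ F₀ v‖ + κ * α v) ≤ T * β v)
    (hα2 : Integrable (fun v => α v ^ 2) (stdGaussian (E d)))
    (hβ2 : Integrable (fun v => β v ^ 2) (stdGaussian (E d)))
    {f : E d → ℝ} (hf : ContDiff ℝ 1 f) (hfc : HasCompactSupport f) (hf0 : ∀ x, 0 ≤ f x)
    (hf1 : ∀ x, f x ≤ 1) :
    |∫ v, f (F₁ v) ∂(stdGaussian (E d)) - ∫ v, f (F₀ v) ∂(stdGaussian (E d))|
      ≤ 1 / 2 * √(∫ v, (α v ^ 2 + d * β v ^ 2) ∂(stdGaussian (E d))) := by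
  set e : E d → E d := fun v => F₁ v - F₀ v with he
  have hec : ContDiff ℝ 3 e := hF₁.sub hF₀
  -- The conditions on the derivatives of F₀ and F₁ are convex, so they pass to every interpolated
  -- map with t in [0, 1].
  set G : ℝ → E d → E d := fun t v => F₀ v + t • e v with hG
  have hGc : ∀ t, ContDiff ℝ 3 (G t) := fun t => hF₀.add (hec.const_smul t)
  have hd₀ : Differentiable ℝ F₀ := hF₀.differentiable (by norm_num)
  have hd₁ : Differentiable ℝ F₁ := hF₁.differentiable (by norm_num)
  have hDe : fderiv ℝ e = fun v => fderiv ℝ F₁ v - fderiv ℝ F₀ v := by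
    ext1 v
    exact fderiv_fun_sub (hd₁ v) (hd₀ v)
  have hDG : ∀ t, fderiv ℝ (G t) = fun v => (1 - t) • fderiv ℝ F₀ v + t • fderiv ℝ F₁ v := by
    intro t
    ext1 v
    have h := (hd₀ v).hasFDerivAt.add
      ((((hd₁ v).hasFDerivAt.sub (hd₀ v).hasFDerivAt)).const_smul t)
    refine (HasFDerivAt.fderiv (f := G t) h).trans ?_
    module
  have hc2₀ : ContDiff ℝ 2 (fderiv ℝ F₀) := hF₀.fderiv_right (by norm_num)
  have hc2₁ : ContDiff ℝ 2 (fderiv ℝ F₁) := hF₁.fderiv_right (by norm_num)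
  have hDGT : ∀ t ∈ Set.Icc (0 : ℝ) 1, ∀ v,
      ‖fderiv ℝ (G t) v - T • ContinuousLinearMap.id ℝ (E d)‖ ≤ T / 11 := fun t ht v => by
    rw [hDG]
    have : (1 - t) • fderiv ℝ F₀ v + t • fderiv ℝ F₁ v - T • ContinuousLinearMap.id ℝ (E d)
        = (1 - t) • (fderiv ℝ F₀ v - T • ContinuousLinearMap.id ℝ (E d))
          + t • (fderiv ℝ F₁ v - T • ContinuousLinearMap.id ℝ (E d)) := by module
    rw [this]
    have := convex_closedBall (0 : E d →L[ℝ] E d) (T / 11)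
      (mem_closedBall_zero_iff.2 (hD₀ v)) (mem_closedBall_zero_iff.2 (hD₁ v))
      (sub_nonneg.2 ht.2) ht.1 (by ring)
    exact mem_closedBall_zero_iff.1 this
  have hDGκ : ∀ t ∈ Set.Icc (0 : ℝ) 1, ∀ v v',
      ‖fderiv ℝ (G t) v - fderiv ℝ (G t) v'‖ ≤ κ * ‖v - v'‖ := fun t ht v v' => by
    have : fderiv ℝ (G t) v - fderiv ℝ (G t) v' = (1 - t) • (fderiv ℝ F₀ v - fderiv ℝ F₀ v')
        + t • (fderiv ℝ F₁ v - fderiv ℝ F₁ v') := by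
      rw [hDG]
      module
    rw [this]
    exact mem_closedBall_zero_iff.1 (convex_closedBall (0 : E d →L[ℝ] E d) (κ * ‖v - v'‖)
      (mem_closedBall_zero_iff.2 (hκ₀ v v')) (mem_closedBall_zero_iff.2 (hκ₁ v v'))
      (sub_nonneg.2 ht.2) ht.1 (by ring))
  obtain ⟨c, hc⟩ := (hf.continuous_fderiv one_ne_zero).bounded_above_of_compact_support
    (hfc.fderiv ℝ)
  have hf' := hf.continuous_fderiv one_ne_zero
  have hfcont := hf.continuous
  have hecont := hec.continuous
  have hGcont := fun t => (hGc t).continuous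
  have hc0 : 0 ≤ c := (norm_nonneg _).trans (hc 0)
  -- The dominating function for differentiating under the integral; α ≤ 1 + α² reduces it to the
  -- square integrability of α.
  have hei : Integrable (fun v => c * ‖e v‖) (stdGaussian (E d)) := by
    refine (((integrable_const (1 : ℝ)).add hα2).const_mul (c * T)).mono' (by fun_prop)
      (Filter.Eventually.of_forall fun v => ?_)
    rw [Real.norm_of_nonneg (by positivity), mul_assoc]
    gcongr
    calc ‖e v‖ ≤ 11 / 10 * ‖e v‖ := by linarith [norm_nonneg (e v)]
      _ ≤ T * α v := hα v
      _ ≤ _ := by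
        gcongr
        simp only [Pi.add_apply]
        nlinarith [sq_nonneg (α v - 1)]
  have hder : ∀ t, Integrable (fun v => fderiv ℝ f (G t v) (e v)) (stdGaussian (E d)) ∧
      HasDerivAt (fun t => ∫ v, f (G t v) ∂(stdGaussian (E d)))
        (∫ v, fderiv ℝ f (G t v) (e v) ∂(stdGaussian (E d))) t := fun t => by
    refine hasDerivAt_integral_of_dominated_loc_of_deriv_le (s := Set.univ)
      (F' := fun t v => fderiv ℝ f (G t v) (e v)) (bound := fun v => c * ‖e v‖) Filter.univ_mem
      (Filter.Eventually.of_forall fun t => ?_) ?_ ?_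
      (Filter.Eventually.of_forall fun v t _ => ?_) hei
      (Filter.Eventually.of_forall fun v t _ => ?_)
    · exact (hfcont.comp (hGcont t)).aestronglyMeasurable
    · refine (integrable_const (1 : ℝ)).mono' (hfcont.comp (hGcont t)).aestronglyMeasurable
        (Filter.Eventually.of_forall fun v => ?_)
      rw [Real.norm_of_nonneg (hf0 _)]
      exact hf1 _
    · have := hGcont t
      exact Continuous.aestronglyMeasurable (by fun_prop)
    · exact (fderiv ℝ f (G t v)).le_of_opNorm_le (hc _) _
    · have h1 : HasDerivAt (fun t => G t v) (e v) t := by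
        have h0 := ((hasDerivAt_id t).smul_const (e v)).const_add (F₀ v)
        rwa [one_smul] at h0
      exact (hf.differentiable one_ne_zero _).hasFDerivAt.comp_hasDerivAt t h1
  have hmain : ∀ t ∈ Set.Ico (0 : ℝ) 1, ‖∫ v, fderiv ℝ f (G t v) (e v) ∂(stdGaussian (E d))‖
      ≤ 1 / 2 * √(∫ v, (α v ^ 2 + d * β v ^ 2) ∂(stdGaussian (E d))) := fun t ht' => by
    have ht : t ∈ Set.Icc (0 : ℝ) 1 := Set.Ico_subset_Icc_self ht'
    exact abs_integral_fderiv_comp_le hT (hGc t) hec (hDGT t ht) hκ0 (hDGκ t ht) hα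
      (by rwa [hDe]) hα2 hβ2 hf hf0 hf1 (hder t).1
  have := norm_image_sub_le_of_norm_deriv_le_segment_01'
    (fun t _ => (hder t).2.hasDerivWithinAt) hmain
  simpa [hG, he] using this

lemma abs_map_stdGaussian_sub_le {F₀ F₁ : E d → E d} {T κ : ℝ} {α β : E d → ℝ} (hT : 0 < T)
    (hF₀ : ContDiff ℝ 3 F₀) (hF₁ : ContDiff ℝ 3 F₁)
    (hD₀ : ∀ v, ‖fderiv ℝ F₀ v - T • ContinuousLinearMap.id ℝ (E d)‖ ≤ T / 11)
    (hD₁ : ∀ v, ‖fderiv ℝ F₁ v - T • ContinuousLinearMap.id ℝ (E d)‖ ≤ T / 11)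
    (hκ0 : 0 ≤ κ) (hκ₀ : ∀ v v', ‖fderiv ℝ F₀ v - fderiv ℝ F₀ v'‖ ≤ κ * ‖v - v'‖)
    (hκ₁ : ∀ v v', ‖fderiv ℝ F₁ v - fderiv ℝ F₁ v'‖ ≤ κ * ‖v - v'‖)
    (hα : ∀ v, 11 / 10 * ‖F₁ v - F₀ v‖ ≤ T * α v)
    (hβ : ∀ v, 11 / 10 * (‖fderiv ℝ F₁ v - fderiv ℝ F₀ v‖ + κ * α v) ≤ T * β v)
    (hα2 : Integrable (fun v => α v ^ 2) (stdGaussian (E d)))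
    (hβ2 : Integrable (fun v => β v ^ 2) (stdGaussian (E d)))
    {A : Set (E d)} (hA : MeasurableSet A) :
    |((stdGaussian (E d)).map F₁).real A - ((stdGaussian (E d)).map F₀).real A|
      ≤ 1 / 2 * √(∫ v, (α v ^ 2 + d * β v ^ 2) ∂(stdGaussian (E d))) := by
  have m₀ := hF₀.continuous.measurable.aemeasurable (μ := stdGaussian (E d))
  have m₁ := hF₁.continuous.measurable.aemeasurable (μ := stdGaussian (E d))
  have := Measure.isProbabilityMeasure_map m₀
  have := Measure.isProbabilityMeasure_map m₁
  refine abs_measureReal_sub_le_of_smooth (fun f hf hfc hf0 hf1 => ?_) hA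
  rw [integral_map m₁ hf.continuous.aestronglyMeasurable,
    integral_map m₀ hf.continuous.aestronglyMeasurable]
  exact abs_integral_comp_sub_le hT hF₀ hF₁ hD₀ hD₁ hκ0 hκ₀ hκ₁ hα hβ hα2 hβ2 hf hfc hf0 hf1
end UHMC

namespace UHMC

/-! ### Bounds on the force field -/

/-- Bounds on a vector field `g`, its derivative `H`, and their second differences. -/
structure ForceBounds {d : ℕ} (g : E d → E d) (H : E d → E d →L[ℝ] E d) (L LH LI : ℝ) : Prop where
  contDiff : ContDiff ℝ 3 g
  hasFDerivAt : ∀ x, HasFDerivAt g (H x) x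
  norm_le : ∀ x, ‖g x‖ ≤ L * ‖x‖
  L_nonneg : 0 ≤ L
  LH_nonneg : 0 ≤ LH
  LI_nonneg : 0 ≤ LI
  bound : ∀ x, ‖H x‖ ≤ L
  lip : ∀ x y, ‖g x - g y‖ ≤ L * ‖x - y‖
  lip' : ∀ x y, ‖H x - H y‖ ≤ LH * ‖x - y‖
  second : ∀ x y z, ‖g x - (2 : ℝ) • g y + g z‖
    ≤ L * ‖x - (2 : ℝ) • y + z‖ + LH * (‖x - y‖ ^ 2 + ‖z - y‖ ^ 2)
  second' : ∀ x y z, ‖H x - (2 : ℝ) • H y + H z‖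
    ≤ LH * ‖x - (2 : ℝ) • y + z‖ + LI * (‖x - y‖ ^ 2 + ‖z - y‖ ^ 2)

lemma norm_sub_le_of_fderiv_le {V W : Type*} [NormedAddCommGroup V] [NormedSpace ℝ V]
    [NormedAddCommGroup W] [NormedSpace ℝ W] {G : V → W} {B : ℝ} (hG : Differentiable ℝ G)
    (hB : ∀ x, ‖fderiv ℝ G x‖ ≤ B) (x y : V) : ‖G x - G y‖ ≤ B * ‖x - y‖ :=
  convex_univ.norm_image_sub_le_of_norm_fderiv_le (fun z _ => hG z) (fun z _ => hB z)
    (Set.mem_univ y) (Set.mem_univ x)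

lemma norm_fderiv_sub_le {V W : Type*} [NormedAddCommGroup V] [NormedSpace ℝ V]
    [NormedAddCommGroup W] [NormedSpace ℝ W] {f : V → W} {B : ℝ} (hf : ContDiff ℝ 2 f)
    (hB : ∀ x, ‖iteratedFDeriv ℝ 2 f x‖ ≤ B) (x y : V) :
    ‖fderiv ℝ f x - fderiv ℝ f y‖ ≤ B * ‖x - y‖ := by
  have h : ContDiff ℝ 1 (fderiv ℝ f) := hf.fderiv_right le_rfl
  refine norm_sub_le_of_fderiv_le (h.differentiable one_ne_zero) (fun x => ?_) x y
  rw [← norm_iteratedFDeriv_one, norm_iteratedFDeriv_fderiv]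
  exact hB x

/-- Taylor expansion about the middle point y: the linear terms combine into DG(y)(x − 2y + z), and
the two remainders are quadratic. -/
lemma norm_second_diff_le {V W : Type*} [NormedAddCommGroup V] [NormedSpace ℝ V]
    [NormedAddCommGroup W] [NormedSpace ℝ W] {G : V → W} {A B : ℝ} (hG : Differentiable ℝ G)
    (hA : ∀ x, ‖fderiv ℝ G x‖ ≤ A)
    (hB : ∀ x y, ‖fderiv ℝ G x - fderiv ℝ G y‖ ≤ B * ‖x - y‖) (hB0 : 0 ≤ B) (x y z : V) :
    ‖G x - (2 : ℝ) • G y + G z‖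
      ≤ A * ‖x - (2 : ℝ) • y + z‖ + B * (‖x - y‖ ^ 2 + ‖z - y‖ ^ 2) := by
  have taylor : ∀ x, ‖G x - G y - fderiv ℝ G y (x - y)‖ ≤ B * ‖x - y‖ ^ 2 := fun x => by
    have h := (convex_segment y x).norm_image_sub_le_of_norm_fderiv_le' (𝕜 := ℝ) (f := G)
      (C := B * ‖x - y‖) (φ := fderiv ℝ G y) (fun z _ => hG z) (fun z hz => ?_)
      (left_mem_segment ℝ y x) (right_mem_segment ℝ y x)
    · calc _ ≤ _ := h
        _ = _ := by ring
    · refine (hB z y).trans ?_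
      gcongr
      exact norm_sub_le_of_mem_segment hz
  have e : G x - (2 : ℝ) • G y + G z = fderiv ℝ G y (x - (2 : ℝ) • y + z)
      + (G x - G y - fderiv ℝ G y (x - y)) + (G z - G y - fderiv ℝ G y (z - y)) := by
    simp only [map_sub, map_add, map_smul]
    module
  rw [e]
  calc _ ≤ _ := norm_add₃_le
    _ ≤ A * ‖x - (2 : ℝ) • y + z‖ + B * ‖x - y‖ ^ 2 + B * ‖z - y‖ ^ 2 := by
      gcongr
      · exact (fderiv ℝ G y).le_of_opNorm_le (hA y) _
      · exact taylor x
      · exact taylor z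
    _ = _ := by ring

/-- The Riesz isometry preserves norms of derivatives, so order n for ∇U is order n + 1 for U. The
force vanishes at the minimum 0, which turns the Lipschitz bound into linear growth. -/
lemma PotentialAssumptions.forceBounds {d : ℕ} {U : E d → ℝ} {L LH LI : ℝ}
    (hU : PotentialAssumptions U L LH LI) : ForceBounds (∇ U) (fderiv ℝ (∇ U)) L LH LI := by
  have e : ∇ U = (InnerProductSpace.toDual ℝ (E d)).symm ∘ fderiv ℝ U := rfl
  have hc : ContDiff ℝ 3 (∇ U) := by
    rw [e]
    exact (LinearIsometryEquiv.contDiff _).comp (hU.smooth.fderiv_right (by norm_num))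
  have hn : ∀ n x, ‖iteratedFDeriv ℝ n (∇ U) x‖ = ‖iteratedFDeriv ℝ (n + 1) U x‖ := fun n x => by
    rw [e, LinearIsometryEquiv.norm_iteratedFDeriv_comp_left, norm_iteratedFDeriv_fderiv]
  have hc2 : ContDiff ℝ 2 (fderiv ℝ (∇ U)) := hc.fderiv_right (by norm_num)
  have b1 : ∀ x, ‖fderiv ℝ (∇ U) x‖ ≤ L := fun x => by
    rw [← norm_iteratedFDeriv_one, hn]
    exact hU.bound2 x
  have b2 : ∀ x, ‖fderiv ℝ (fderiv ℝ (∇ U)) x‖ ≤ LH := fun x => by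
    rw [← norm_iteratedFDeriv_one, norm_iteratedFDeriv_fderiv, hn]
    exact hU.bound3 x
  have d0 := hc.differentiable (by norm_num)
  have d1 := hc2.differentiable two_ne_zero
  have hz : ∇ U 0 = 0 := by
    have : fderiv ℝ U 0 = 0 :=
      IsLocalMin.fderiv_eq_zero (Filter.Eventually.of_forall fun x => hU.min x)
    simp [gradient, this]
  refine ⟨hc, fun x => (d0 x).hasFDerivAt, fun x => ?_, (norm_nonneg _).trans (hU.bound2 0),
    (norm_nonneg _).trans (hU.bound3 0), (norm_nonneg _).trans (hU.bound4 0), b1,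
    norm_sub_le_of_fderiv_le d0 b1, norm_sub_le_of_fderiv_le d1 b2, ?_, ?_⟩
  · simpa [hz] using norm_sub_le_of_fderiv_le d0 b1 x 0
  · exact norm_second_diff_le d0 b1 (norm_sub_le_of_fderiv_le d1 b2)
      ((norm_nonneg _).trans (hU.bound3 0))
  · exact norm_second_diff_le d1 b2 (norm_fderiv_sub_le hc2 fun x => by
        rw [norm_iteratedFDeriv_fderiv, hn]
        exact hU.bound4 x)
      ((norm_nonneg _).trans (hU.bound4 0))

/-! ### Perturbed Verlet recursions -/

/-- The sequences `q`, `p` satisfy the Verlet recursion with accelerations `-a` and local errors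
`ρ`, `σ`, for `N` steps of size `h`. -/
structure VerletRec {V : Type*} [NormedAddCommGroup V] [NormedSpace ℝ V] (h : ℝ) (N : ℕ)
    (q p a ρ σ : ℕ → V) : Prop where
  pos : ∀ k < N, q (k + 1) = q k + h • p k - (h ^ 2 / 2) • a k + ρ k
  vel : ∀ k < N, p (k + 1) = p k - (h / 2) • (a k + a (k + 1)) + σ k

section
variable {V : Type*} [NormedAddCommGroup V] [NormedSpace ℝ V] {h R S : ℝ} {N : ℕ}
  {q p a ρ σ : ℕ → V}

lemma VerletRec.norm_vel_sub_le (hr : VerletRec h N q p a ρ σ) (hh : 0 ≤ h)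
    (hS : ∀ k < N, ‖σ k‖ ≤ S) {A : ℝ} {k : ℕ} (hk : k ≤ N) (hA : ∀ i ≤ k, ‖a i‖ ≤ A) :
    ‖p k - p 0‖ ≤ k * h * A + k * S := by
  induction k with
  | zero => simp
  | succ k ih =>
    have h1 := ih (by omega) fun i hi => hA i (by omega)
    have e : p (k + 1) - p 0 = (p k - p 0) + -((h / 2) • (a k + a (k + 1))) + σ k := by
      rw [hr.vel k (by omega)]
      abel
    rw [e]
    calc _ ≤ _ := norm_add₃_le
      _ ≤ (k * h * A + k * S) + h / 2 * (A + A) + S := by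
          rw [norm_neg, norm_smul, Real.norm_of_nonneg (by positivity)]
          gcongr
          · exact (norm_add_le _ _).trans (add_le_add (hA k (by omega)) (hA _ le_rfl))
          · exact hS k (by omega)
      _ = _ := by
          push_cast
          ring

/-- Summing the velocity bound over the steps: accelerations integrate to (kh)²/2 as in continuous
time, position errors add up once, velocity errors twice. -/
lemma VerletRec.norm_pos_sub_le (hr : VerletRec h N q p a ρ σ) (hh : 0 ≤ h)
    (hR : ∀ k < N, ‖ρ k‖ ≤ R) (hS : ∀ k < N, ‖σ k‖ ≤ S) (hS0 : 0 ≤ S) {A : ℝ} {k : ℕ}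
    (hk : k ≤ N) (hA : ∀ i < k, ‖a i‖ ≤ A) :
    ‖q k - q 0 - (k * h) • p 0‖ ≤ (k * h) ^ 2 / 2 * A + k * R + h * k ^ 2 / 2 * S := by
  induction k with
  | zero => simp
  | succ k ih =>
    have h1 := ih (by omega) fun i hi => hA i (by omega)
    have h2 := hr.norm_vel_sub_le hh hS (k := k) (by omega) fun i hi => hA i (by omega)
    have e : q (k + 1) - q 0 - ((k + 1 : ℕ) * h) • p 0 = (q k - q 0 - (k * h) • p 0)
        + h • (p k - p 0) + (-((h ^ 2 / 2) • a k) + ρ k) := by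
      rw [hr.pos k (by omega)]
      push_cast
      module
    rw [e]
    have h3 : ‖-((h ^ 2 / 2) • a k) + ρ k‖ ≤ h ^ 2 / 2 * A + R := by
      refine (norm_add_le _ _).trans ?_
      rw [norm_neg, norm_smul, Real.norm_of_nonneg (by positivity)]
      gcongr
      · exact hA k (by omega)
      · exact hR k (by omega)
    calc _ ≤ _ := norm_add₃_le
      _ ≤ ((k * h) ^ 2 / 2 * A + k * R + h * k ^ 2 / 2 * S) + h * (k * h * A + k * S)
          + (h ^ 2 / 2 * A + R) := by
          rw [norm_smul h, Real.norm_of_nonneg hh]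
          gcongr
      _ ≤ _ := by
          push_cast
          have : 0 ≤ h * S := by positivity
          nlinarith

/-- A discrete Gronwall bound for perturbed Verlet recursions over short time intervals. -/
lemma VerletRec.norm_pos_le (hr : VerletRec h N q p a ρ σ) {T L c B : ℝ} (hh : 0 ≤ h)
    (hT : T = N * h) (hL0 : 0 ≤ L) (hL : L * T ^ 2 ≤ 1 / 6) (hc : 0 ≤ c) (hR0 : 0 ≤ R)
    (hR : ∀ k < N, ‖ρ k‖ ≤ R) (hS : ∀ k < N, ‖σ k‖ ≤ S) (hS0 : 0 ≤ S)
    (ha : ∀ k ≤ N, ‖a k‖ ≤ L * ‖q k‖ + c)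
    (hB : ‖q 0‖ + T * ‖p 0‖ + T ^ 2 / 2 * c + N * R + h * N ^ 2 / 2 * S ≤ B) {k : ℕ}
    (hk : k ≤ N) : ‖q k‖ ≤ 12 / 11 * B := by
  have hT0 : 0 ≤ T := by rw [hT]; positivity
  have hB0 : 0 ≤ B := le_trans (by positivity) hB
  -- The position after k steps involves only accelerations at earlier steps, so the induction
  -- closes. The constant solves x = 1 + x/12, since LT²/2 ≤ 1/12.
  induction k using Nat.strong_induction_on with
  | _ k ih =>
    have hkN : (k : ℝ) ≤ N := by exact_mod_cast hk
    have hkT : k * h ≤ T := by rw [hT]; gcongr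
    have h1 := hr.norm_pos_sub_le hh hR hS hS0 hk (A := L * (12 / 11 * B) + c) fun i hi =>
      (ha i (by omega)).trans (by gcongr; exact ih i hi (by omega))
    have e : q k = (q k - q 0 - (k * h) • p 0) + q 0 + (k * h) • p 0 := by abel
    rw [e]
    calc _ ≤ _ := norm_add₃_le
      _ ≤ ((k * h) ^ 2 / 2 * (L * (12 / 11 * B) + c) + k * R + h * k ^ 2 / 2 * S) + ‖q 0‖
          + k * h * ‖p 0‖ := by
          rw [norm_smul, Real.norm_of_nonneg (by positivity)]
          gcongr
      _ ≤ (T ^ 2 / 2 * (L * (12 / 11 * B) + c) + N * R + h * N ^ 2 / 2 * S) + ‖q 0‖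
          + T * ‖p 0‖ := by gcongr
      _ = (L * T ^ 2) * (6 / 11 * B) + (‖q 0‖ + T * ‖p 0‖ + T ^ 2 / 2 * c + N * R
          + h * N ^ 2 / 2 * S) := by ring
      _ ≤ 1 / 6 * (6 / 11 * B) + B := by gcongr
      _ = _ := by ring
end
end UHMC

/-! ### Verlet trajectories and their derivatives in the initial velocity. -/

namespace UHMC

/-- The recursion is linear in all its data, so differences of trajectories or of their derivatives
fall under the same Gronwall bound. -/
lemma VerletRec.sub {V : Type*} [NormedAddCommGroup V] [NormedSpace ℝ V] {h : ℝ} {N : ℕ}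
    {q p a ρ σ q' p' a' ρ' σ' : ℕ → V} (h1 : VerletRec h N q p a ρ σ)
    (h2 : VerletRec h N q' p' a' ρ' σ') :
    VerletRec h N (fun k => q k - q' k) (fun k => p k - p' k) (fun k => a k - a' k)
      (fun k => ρ k - ρ' k) (fun k => σ k - σ' k) := by
  refine ⟨fun k hk => ?_, fun k hk => ?_⟩
  · rw [h1.pos k hk, h2.pos k hk]
    module
  · rw [h1.vel k hk, h2.vel k hk]
    module

variable {d : ℕ} {U : E d → ℝ}

/-- The velocity after `N` Verlet steps. -/
def verletVel {d : ℕ} (U : E d → ℝ) (h : ℝ) (N : ℕ) (z : E d × E d) : E d :=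
  ((verletStep U h)^[N] z).2

@[simp] lemma verletPos_zero (h : ℝ) (z : E d × E d) : verletPos U h 0 z = z.1 := rfl

@[simp] lemma verletVel_zero (h : ℝ) (z : E d × E d) : verletVel U h 0 z = z.2 := rfl

lemma verletPos_succ (h : ℝ) (k : ℕ) (z : E d × E d) :
    verletPos U h (k + 1) z = verletPos U h k z + h • verletVel U h k z
      - (h ^ 2 / 2) • ∇ U (verletPos U h k z) := by
  simp only [verletPos, verletVel, Function.iterate_succ_apply', verletStep]

lemma verletVel_succ (h : ℝ) (k : ℕ) (z : E d × E d) :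
    verletVel U h (k + 1) z = verletVel U h k z
      - (h / 2) • (∇ U (verletPos U h k z) + ∇ U (verletPos U h (k + 1) z)) := by
  simp only [verletPos, verletVel, Function.iterate_succ_apply', verletStep]

lemma verletRec_traj (U : E d → ℝ) (h : ℝ) (N : ℕ) (z : E d × E d) :
    VerletRec h N (fun k => verletPos U h k z) (fun k => verletVel U h k z)
      (fun k => ∇ U (verletPos U h k z)) (fun _ => 0) (fun _ => 0) :=
  ⟨fun k _ => by rw [verletPos_succ, add_zero], fun k _ => by rw [verletVel_succ, add_zero]⟩

lemma contDiff_verlet {n : WithTop ℕ∞} (hg : ContDiff ℝ n (∇ U)) (h : ℝ) (k : ℕ) (x : E d) :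
    ContDiff ℝ n (fun v => verletPos U h k (x, v)) ∧
      ContDiff ℝ n (fun v => verletVel U h k (x, v)) := by
  induction k with
  | zero => exact ⟨contDiff_const, contDiff_id⟩
  | succ k ih =>
    have h1 : ContDiff ℝ n (fun v => verletPos U h (k + 1) (x, v)) := by
      simp_rw [verletPos_succ]
      exact (ih.1.add (ih.2.const_smul h)).sub ((hg.comp ih.1).const_smul _)
    refine ⟨h1, ?_⟩
    simp_rw [verletVel_succ]
    exact ih.2.sub (((hg.comp ih.1).add (hg.comp h1)).const_smul _)

/-- The derivative of the position with respect to the initial velocity. -/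
def posD {d : ℕ} (U : E d → ℝ) (h : ℝ) (k : ℕ) (z : E d × E d) : E d →L[ℝ] E d :=
  fderiv ℝ (fun v => verletPos U h k (z.1, v)) z.2

/-- The derivative of the velocity with respect to the initial velocity. -/
def velD {d : ℕ} (U : E d → ℝ) (h : ℝ) (k : ℕ) (z : E d × E d) : E d →L[ℝ] E d :=
  fderiv ℝ (fun v => verletVel U h k (z.1, v)) z.2

@[simp] lemma posD_zero (h : ℝ) (z : E d × E d) : posD U h 0 z = 0 := by
  simp [posD]

@[simp] lemma velD_zero (h : ℝ) (z : E d × E d) :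
    velD U h 0 z = ContinuousLinearMap.id ℝ (E d) := by
  simp [velD]

/-- Differentiating Verlet in the initial velocity gives the Verlet recursion with acceleration
D²U(q)Q, started from Q = 0 and P = Id. -/
lemma verletRec_deriv {L LH LI : ℝ} (hf : ForceBounds (∇ U) (fderiv ℝ (∇ U)) L LH LI) (h : ℝ)
    (N : ℕ) (z : E d × E d) :
    VerletRec h N (fun k => posD U h k z) (fun k => velD U h k z)
      (fun k => (fderiv ℝ (∇ U) (verletPos U h k z)).comp (posD U h k z))
      (fun _ => 0) (fun _ => 0) := by
  have hp : ∀ k, HasFDerivAt (fun v => verletPos U h k (z.1, v)) (posD U h k z) z.2 := fun k =>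
    ((contDiff_verlet hf.contDiff h k z.1).1.differentiable (by norm_num) z.2).hasFDerivAt
  have hv : ∀ k, HasFDerivAt (fun v => verletVel U h k (z.1, v)) (velD U h k z) z.2 := fun k =>
    ((contDiff_verlet hf.contDiff h k z.1).2.differentiable (by norm_num) z.2).hasFDerivAt
  have hg : ∀ k, HasFDerivAt (fun v => ∇ U (verletPos U h k (z.1, v)))
      ((fderiv ℝ (∇ U) (verletPos U h k z)).comp (posD U h k z)) z.2 := fun k =>
    (hf.hasFDerivAt _).comp z.2 (hp k)
  refine ⟨fun k _ => ?_, fun k _ => ?_⟩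
  · have e : (fun v => verletPos U h (k + 1) (z.1, v)) = fun v => verletPos U h k (z.1, v)
        + h • verletVel U h k (z.1, v) - (h ^ 2 / 2) • ∇ U (verletPos U h k (z.1, v)) := by
      ext1 v
      exact verletPos_succ _ _ _
    have := ((hp k).add ((hv k).const_smul h)).sub ((hg k).const_smul (h ^ 2 / 2))
    rw [add_zero]
    refine (hp (k + 1)).unique ?_
    rw [e]
    exact this
  · have e : (fun v => verletVel U h (k + 1) (z.1, v)) = fun v => verletVel U h k (z.1, v)
        - (h / 2) • (∇ U (verletPos U h k (z.1, v)) + ∇ U (verletPos U h (k + 1) (z.1, v))) := by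
      ext1 v
      exact verletVel_succ _ _ _
    have := (hv k).sub (((hg k).add (hg (k + 1))).const_smul (h / 2))
    rw [add_zero]
    refine (hv (k + 1)).unique ?_
    rw [e]
    exact this

section
variable {L LH LI T h : ℝ} {N : ℕ}

/-- The short-time regime: `N` steps of size `h` reach time `T`, and `L T² ≤ 1/6`. -/
structure ShortTime (L T h : ℝ) (N : ℕ) : Prop where
  h_nonneg : 0 ≤ h
  T_eq : T = N * h
  le : L * T ^ 2 ≤ 1 / 6

lemma ShortTime.T_nonneg (hs : ShortTime L T h N) : 0 ≤ T := by
  rw [hs.T_eq]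
  have := hs.h_nonneg
  positivity

lemma norm_verletPos_le (hf : ForceBounds (∇ U) (fderiv ℝ (∇ U)) L LH LI)
    (hs : ShortTime L T h N) (z : E d × E d) {k : ℕ} (hk : k ≤ N) :
    ‖verletPos U h k z‖ ≤ 12 / 11 * (‖z.1‖ + T * ‖z.2‖) :=
  (verletRec_traj U h N z).norm_pos_le hs.h_nonneg hs.T_eq hf.L_nonneg hs.le le_rfl le_rfl
    (by simp) (by simp) le_rfl (fun k _ => by simpa using hf.norm_le _) (by simp) hk

lemma norm_verletVel_sub_le (hf : ForceBounds (∇ U) (fderiv ℝ (∇ U)) L LH LI)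
    (hs : ShortTime L T h N) (z : E d × E d) {k : ℕ} (hk : k ≤ N) :
    ‖verletVel U h k z - z.2‖ ≤ T * (L * (12 / 11 * (‖z.1‖ + T * ‖z.2‖))) := by
  have h1 := (verletRec_traj U h N z).norm_vel_sub_le (S := 0) hs.h_nonneg (by simp) hk
    (A := L * (12 / 11 * (‖z.1‖ + T * ‖z.2‖))) fun i hi => (hf.norm_le _).trans
      (mul_le_mul_of_nonneg_left (norm_verletPos_le hf hs z (hi.trans hk)) hf.L_nonneg)
  refine h1.trans ?_
  have hT0 := hs.T_nonneg
  have hL0 := hf.L_nonneg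
  rw [mul_zero, add_zero, hs.T_eq]
  have := hs.h_nonneg
  rw [hs.T_eq] at hT0
  gcongr

lemma norm_verletPos_sub_le (hf : ForceBounds (∇ U) (fderiv ℝ (∇ U)) L LH LI)
    (hs : ShortTime L T h N) (z z' : E d × E d) {k : ℕ} (hk : k ≤ N) :
    ‖verletPos U h k z - verletPos U h k z'‖
      ≤ 12 / 11 * (‖z.1 - z'.1‖ + T * ‖z.2 - z'.2‖) :=
  ((verletRec_traj U h N z).sub (verletRec_traj U h N z')).norm_pos_le hs.h_nonneg hs.T_eq
    hf.L_nonneg hs.le le_rfl le_rfl (by simp) (by simp) le_rfl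
    (fun k _ => by simpa using hf.lip _ _) (by simp) hk

lemma norm_comp_le_of_bound (hf : ForceBounds (∇ U) (fderiv ℝ (∇ U)) L LH LI) (x : E d)
    (A : E d →L[ℝ] E d) : ‖(fderiv ℝ (∇ U) x).comp A‖ ≤ L * ‖A‖ :=
  (ContinuousLinearMap.opNorm_comp_le _ _).trans
    (mul_le_mul_of_nonneg_right (hf.bound x) (norm_nonneg _))

lemma norm_posD_le (hf : ForceBounds (∇ U) (fderiv ℝ (∇ U)) L LH LI)
    (hs : ShortTime L T h N) (z : E d × E d) {k : ℕ} (hk : k ≤ N) :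
    ‖posD U h k z‖ ≤ 12 / 11 * T := by
  have hT0 := hs.T_nonneg
  refine (verletRec_deriv hf h N z).norm_pos_le hs.h_nonneg hs.T_eq
    hf.L_nonneg hs.le le_rfl le_rfl (by simp) (by simp) le_rfl
    (fun k _ => by simpa using norm_comp_le_of_bound hf _ _) ?_ hk
  simp only [posD_zero, norm_zero, velD_zero]
  have := ContinuousLinearMap.norm_id_le (𝕜 := ℝ) (E := E d)
  nlinarith

lemma norm_velD_le (hf : ForceBounds (∇ U) (fderiv ℝ (∇ U)) L LH LI)
    (hs : ShortTime L T h N) (z : E d × E d) {k : ℕ} (hk : k ≤ N) :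
    ‖velD U h k z‖ ≤ 13 / 11 := by
  have hT0 := hs.T_nonneg
  have hL0 := hf.L_nonneg
  have hh := hs.h_nonneg
  have h1 := (verletRec_deriv hf h N z).norm_vel_sub_le (S := 0) hs.h_nonneg (by simp) hk
    (A := L * (12 / 11 * T)) fun i hi => (norm_comp_le_of_bound hf _ _).trans
      (mul_le_mul_of_nonneg_left (norm_posD_le hf hs z (hi.trans hk)) hf.L_nonneg)
  simp only [velD_zero] at h1
  have h2 := ContinuousLinearMap.norm_id_le (𝕜 := ℝ) (E := E d)
  have h3 := norm_le_norm_add_norm_sub' (velD U h k z) (ContinuousLinearMap.id ℝ (E d))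
  have h4 : k * h ≤ T := by
    rw [hs.T_eq]
    gcongr
  have h5 : k * h * (L * (12 / 11 * T)) ≤ T * (L * (12 / 11 * T)) := by gcongr
  -- The constant 13/11 is 1 + (12/11)·LT² at LT² = 1/6.
  have h6 := hs.le
  nlinarith

/-- This is the closeness to T·Id required by the transport estimate: (T²/2)·L·(12/11)T ≤ T/11. -/
lemma norm_posD_sub_smul_le (hf : ForceBounds (∇ U) (fderiv ℝ (∇ U)) L LH LI)
    (hs : ShortTime L T h N) (z : E d × E d) :
    ‖posD U h N z - T • ContinuousLinearMap.id ℝ (E d)‖ ≤ T / 11 := by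
  have hT0 := hs.T_nonneg
  have h1 := (verletRec_deriv hf h N z).norm_pos_sub_le (R := 0) (S := 0) hs.h_nonneg
    (by simp) (by simp) le_rfl le_rfl
    (A := L * (12 / 11 * T)) fun i hi => (norm_comp_le_of_bound hf _ _).trans
      (mul_le_mul_of_nonneg_left (norm_posD_le hf hs z hi.le) hf.L_nonneg)
  simp only [posD_zero, velD_zero, sub_zero, mul_zero, add_zero, ← hs.T_eq] at h1
  have h6 := hs.le
  nlinarith

/-- The Lipschitz estimate for products `H(q) Q`. -/
lemma norm_comp_sub_comp_le (hf : ForceBounds (∇ U) (fderiv ℝ (∇ U)) L LH LI) {x y : E d}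
    {A B : E d →L[ℝ] E d} {r M : ℝ} (hr : ‖x - y‖ ≤ r) (hM : ‖B‖ ≤ M) :
    ‖(fderiv ℝ (∇ U) x).comp A - (fderiv ℝ (∇ U) y).comp B‖ ≤ L * ‖A - B‖ + LH * r * M := by
  have hLH := hf.LH_nonneg
  have hr0 := (norm_nonneg _).trans hr
  have e : (fderiv ℝ (∇ U) x).comp A - (fderiv ℝ (∇ U) y).comp B
      = (fderiv ℝ (∇ U) x).comp (A - B)
        + (fderiv ℝ (∇ U) x - fderiv ℝ (∇ U) y).comp B := by
    rw [ContinuousLinearMap.comp_sub, ContinuousLinearMap.sub_comp]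
    abel
  rw [e]
  refine (norm_add_le _ _).trans (add_le_add (norm_comp_le_of_bound hf _ _) ?_)
  refine (ContinuousLinearMap.opNorm_comp_le _ _).trans ?_
  gcongr
  exact (hf.lip' x y).trans (by gcongr)

/-- The initial values of the derivatives agree, so the only source is the change of the Hessian
between the two trajectories. The constant is (12/11)³/2 ≤ 2/3. For equal positions the bound serves
as κ in the transport estimate, for equal velocities it bounds De. -/
lemma norm_posD_sub_le (hf : ForceBounds (∇ U) (fderiv ℝ (∇ U)) L LH LI)
    (hs : ShortTime L T h N) (z z' : E d × E d) {k : ℕ} (hk : k ≤ N) :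
    ‖posD U h k z - posD U h k z'‖
      ≤ 2 / 3 * LH * T ^ 3 * (‖z.1 - z'.1‖ + T * ‖z.2 - z'.2‖) := by
  have hT0 := hs.T_nonneg
  have hLH := hf.LH_nonneg
  set r := ‖z.1 - z'.1‖ + T * ‖z.2 - z'.2‖ with hr
  have hr0 : 0 ≤ r := by positivity
  have h1 := ((verletRec_deriv hf h N z).sub (verletRec_deriv hf h N z')).norm_pos_le
    (R := 0) (S := 0) (L := L) (T := T) (c := LH * (12 / 11 * r) * (12 / 11 * T))
    hs.h_nonneg hs.T_eq hf.L_nonneg hs.le (by positivity) le_rfl (by simp) (by simp) le_rfl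
    (fun k hk => norm_comp_sub_comp_le hf (norm_verletPos_sub_le hf hs z z' hk)
      (norm_posD_le hf hs z' hk)) le_rfl hk
  simp only [posD_zero, velD_zero, sub_self, norm_zero, mul_zero, zero_add, add_zero] at h1
  refine h1.trans ?_
  have : 0 ≤ LH * T ^ 3 * r := by positivity
  nlinarith
end

/-! ### Regularization of the transition kernel -/

/-- The laws after one uHMC transition from nearby points are close in total variation. -/
lemma abs_uhmcKernel_sub_le {L LH LI T h : ℝ} {N : ℕ} (hU : PotentialAssumptions U L LH LI)
    (hs : ShortTime L T h N) (hT : 0 < T) (x y : E d) {A : Set (E d)} (hA : MeasurableSet A) :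
    |(uhmcKernel U h N x).real A - (uhmcKernel U h N y).real A|
      ≤ 2 / 5 * regConst d T LH * ‖x - y‖ := by
  have hf := hU.forceBounds
  have hLH := hf.LH_nonneg
  have hU1 : ContDiff ℝ 1 U := hU.smooth.of_le (by norm_num)
  set r := ‖x - y‖ with hr
  -- Here α = (11/10)(12/11)r/T, while β rounds (11/10)(2/3)(1 + 6/5) = 121/75 up to 17/10.
  have h1 := abs_map_stdGaussian_sub_le (F₀ := fun v => verletPos U h N (y, v))
    (F₁ := fun v => verletPos U h N (x, v)) (T := T) (κ := 2 / 3 * LH * T ^ 4)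
    (α := fun _ => 6 / 5 * r / T) (β := fun _ => 17 / 10 * LH * T ^ 2 * r) hT
    (contDiff_verlet hf.contDiff h N y).1 (contDiff_verlet hf.contDiff h N x).1
    (fun v => norm_posD_sub_smul_le hf hs (y, v)) (fun v => norm_posD_sub_smul_le hf hs (x, v))
    (by positivity)
    (fun v v' => by
      refine (norm_posD_sub_le hf hs (y, v) (y, v') le_rfl).trans (le_of_eq ?_)
      simp
      ring)
    (fun v v' => by
      refine (norm_posD_sub_le hf hs (x, v) (x, v') le_rfl).trans (le_of_eq ?_)
      simp
      ring)
    (fun v => by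
      have hv := norm_verletPos_sub_le hf hs (x, v) (y, v) le_rfl
      simp only [sub_self, norm_zero, mul_zero, add_zero] at hv
      calc 11 / 10 * ‖verletPos U h N (x, v) - verletPos U h N (y, v)‖
          ≤ 11 / 10 * (12 / 11 * r) := by gcongr
        _ = _ := by field_simp; ring)
    (fun v => by
      have hv := norm_posD_sub_le hf hs (x, v) (y, v) le_rfl
      simp only [sub_self, norm_zero, mul_zero, add_zero] at hv
      calc 11 / 10 * (‖posD U h N (x, v) - posD U h N (y, v)‖
            + 2 / 3 * LH * T ^ 4 * (6 / 5 * r / T))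
          ≤ 11 / 10 * (2 / 3 * LH * T ^ 3 * r + 2 / 3 * LH * T ^ 4 * (6 / 5 * r / T)) := by
            gcongr
        _ = 121 / 75 * (LH * T ^ 3 * r) := by field_simp; ring
        _ ≤ 17 / 10 * (LH * T ^ 3 * r) :=
            mul_le_mul_of_nonneg_right (by norm_num) (by positivity)
        _ = _ := by ring)
    (integrable_const _) (integrable_const _) hA
  rw [uhmcKernel_apply hU1, uhmcKernel_apply hU1]
  refine h1.trans ?_
  simp only [integral_const, probReal_univ, one_smul, regConst]
  -- The leading constant is (1/2)(6/5) = (2/5)(3/2). The other term has ample room: (17/10)²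
  -- against 27·(6/5)².
  have e : 2 / 5 * (3 / 2 * √(T⁻¹ ^ 2 + 27 * d * LH ^ 2 * T ^ 4)) * r
      = 1 / 2 * √((6 / 5 * r) ^ 2 * (T⁻¹ ^ 2 + 27 * d * LH ^ 2 * T ^ 4)) := by
    rw [Real.sqrt_mul (by positivity), Real.sqrt_sq (by positivity)]
    ring
  rw [e]
  gcongr
  have : 0 ≤ d * LH ^ 2 * T ^ 4 * r ^ 2 := by positivity
  rw [div_eq_mul_inv]
  nlinarith
end UHMC

namespace UHMC

/-! ### Comparison of Verlet with step sizes `h` and `h / 2` -/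

section
variable {V : Type*} [NormedAddCommGroup V] [NormedSpace ℝ V] {δ : ℝ} {N : ℕ} {q p a : ℕ → V}

/-- Two steps of size `δ` are one step of size `2 δ` with local errors. -/
lemma VerletRec.double (hr : VerletRec δ (2 * N) q p a (fun _ => 0) (fun _ => 0)) :
    VerletRec (2 * δ) N (fun k => q (2 * k)) (fun k => p (2 * k)) (fun k => a (2 * k))
      (fun k => δ ^ 2 • (a (2 * k) - a (2 * k + 1)))
      (fun k => (δ / 2) • (a (2 * k) - (2 : ℝ) • a (2 * k + 1) + a (2 * k + 2))) := by
  refine ⟨fun k hk => ?_, fun k hk => ?_⟩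
  · have h1 := hr.pos (2 * k) (by omega)
    have h2 := hr.pos (2 * k + 1) (by omega)
    have h3 := hr.vel (2 * k) (by omega)
    rw [show 2 * (k + 1) = 2 * k + 1 + 1 by ring, h2, h3, h1]
    module
  · have h3 := hr.vel (2 * k) (by omega)
    have h4 := hr.vel (2 * k + 1) (by omega)
    rw [show 2 * (k + 1) = 2 * k + 1 + 1 by ring, h4, h3]
    module

/-- Eliminating the velocities leaves the Störmer three-term recursion, so second differences of
positions are O(δ²). -/
lemma VerletRec.second_diff (hr : VerletRec δ N q p a (fun _ => 0) (fun _ => 0)) {k : ℕ}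
    (hk : k + 1 < N) :
    q k - (2 : ℝ) • q (k + 1) + q (k + 2) = -(δ ^ 2 • a (k + 1)) := by
  have h1 := hr.pos k (by omega)
  have h2 := hr.pos (k + 1) hk
  have h3 := hr.vel k (by omega)
  rw [h2, h3, h1]
  module

lemma VerletRec.norm_step_le (hr : VerletRec δ N q p a (fun _ => 0) (fun _ => 0)) (hδ : 0 ≤ δ)
    {k : ℕ} (hk : k < N) {P A : ℝ} (hP : ‖p k‖ ≤ P) (hA : ‖a k‖ ≤ A) :
    ‖q (k + 1) - q k‖ ≤ δ * (P + δ / 2 * A) := by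
  have e : q (k + 1) - q k = δ • p k + -((δ ^ 2 / 2) • a k) := by
    rw [hr.pos k hk]
    module
  rw [e]
  refine (norm_add_le _ _).trans ?_
  rw [norm_neg, norm_smul, norm_smul, Real.norm_of_nonneg hδ, Real.norm_of_nonneg (by positivity)]
  calc δ * ‖p k‖ + δ ^ 2 / 2 * ‖a k‖ ≤ δ * P + δ ^ 2 / 2 * A := by gcongr
    _ = _ := by ring
end

section
variable {d : ℕ} {U : E d → ℝ} {L LH LI T h : ℝ} {N : ℕ}

lemma ShortTime.half (hs : ShortTime L T h N) : ShortTime L T (h / 2) (2 * N) :=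
  ⟨by linarith [hs.h_nonneg], by rw [hs.T_eq]; push_cast; ring, hs.le⟩

/-- The scale of the velocities along a trajectory. -/
def speed {d : ℕ} (T : ℝ) (z : E d × E d) : ℝ := ‖z.2‖ + ‖z.1‖ / T

lemma speed_nonneg (hT : 0 < T) (z : E d × E d) : 0 ≤ speed T z := by
  unfold speed
  positivity

lemma mul_speed (hT : 0 < T) (z : E d × E d) : T * speed T z = ‖z.1‖ + T * ‖z.2‖ := by
  unfold speed
  field_simp
  ring

lemma norm_verletPos_step_le (hf : ForceBounds (∇ U) (fderiv ℝ (∇ U)) L LH LI)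
    (hs : ShortTime L T h N) (hT : 0 < T) (hhT : h ≤ T / 2) (z : E d × E d) {k : ℕ} (hk : k < N) :
    ‖verletPos U h (k + 1) z - verletPos U h k z‖ ≤ h * (5 / 4 * speed T z) := by
  have hL0 := hf.L_nonneg
  have hh := hs.h_nonneg
  have hS := speed_nonneg hT z
  have h1 := norm_verletPos_le hf hs z hk.le
  have h2 := norm_verletVel_sub_le hf hs z hk.le
  rw [← mul_speed hT] at h1 h2
  have h3 : ‖verletVel U h k z‖ ≤ ‖z.2‖ + T * (L * (12 / 11 * (T * speed T z))) := by
    have := norm_le_norm_add_norm_sub' (verletVel U h k z) z.2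
    linarith
  have hv : ‖z.2‖ ≤ speed T z := by
    unfold speed
    have : 0 ≤ ‖z.1‖ / T := by positivity
    linarith
  refine ((verletRec_traj U h N z).norm_step_le hh hk h3
    ((hf.norm_le _).trans (mul_le_mul_of_nonneg_left h1 hL0))).trans ?_
  gcongr
  -- From h/2 ≤ T/4 the factor is 1 + (1/6)(5/4)(12/11) = 27/22 < 5/4.
  calc ‖z.2‖ + T * (L * (12 / 11 * (T * speed T z))) + h / 2 * (L * (12 / 11 * (T * speed T z)))
      ≤ speed T z + T * (L * (12 / 11 * (T * speed T z)))
        + T / 2 / 2 * (L * (12 / 11 * (T * speed T z))) := by gcongr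
    _ = speed T z + L * T ^ 2 * (15 / 11 * speed T z) := by ring
    _ ≤ speed T z + 1 / 6 * (15 / 11 * speed T z) := by
        gcongr
        exact hs.le
    _ ≤ _ := by linarith

lemma norm_posD_step_le (hf : ForceBounds (∇ U) (fderiv ℝ (∇ U)) L LH LI)
    (hs : ShortTime L T h N) (hT : 0 < T) (hhT : h ≤ T / 2) (z : E d × E d) {k : ℕ} (hk : k < N) :
    ‖posD U h (k + 1) z - posD U h k z‖ ≤ h * (5 / 4) := by
  have hL0 := hf.L_nonneg
  have hh := hs.h_nonneg
  refine ((verletRec_deriv hf h N z).norm_step_le hh hk (norm_velD_le hf hs z hk.le)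
    ((norm_comp_le_of_bound hf _ _).trans
      (mul_le_mul_of_nonneg_left (norm_posD_le hf hs z hk.le) hL0))).trans ?_
  gcongr
  calc 13 / 11 + h / 2 * (L * (12 / 11 * T)) ≤ 13 / 11 + T / 2 / 2 * (L * (12 / 11 * T)) := by
        gcongr
    _ = 13 / 11 + L * T ^ 2 * (3 / 11) := by ring
    _ ≤ 13 / 11 + 1 / 6 * (3 / 11) := by
        gcongr
        exact hs.le
    _ ≤ _ := by norm_num

/-- The distance between the coarse and the fine trajectory. -/
lemma norm_verletPos_half_sub_le (hf : ForceBounds (∇ U) (fderiv ℝ (∇ U)) L LH LI)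
    (hs : ShortTime L T h N) (hT : 0 < T) (hhT : h ≤ T) (z : E d × E d) {k : ℕ} (hk : k ≤ N) :
    ‖verletPos U (h / 2) (2 * k) z - verletPos U h k z‖
      ≤ h ^ 2 * T * (2 / 11 * L * speed T z + 5 / 44 * T * LH * speed T z ^ 2) := by
  have hL0 := hf.L_nonneg
  have hLH0 := hf.LH_nonneg
  have hh := hs.h_nonneg
  have hS := speed_nonneg hT z
  set S := speed T z with hSdef
  have hinc : ∀ i < 2 * N, ‖verletPos U (h / 2) (i + 1) z - verletPos U (h / 2) i z‖
      ≤ h / 2 * (5 / 4 * S) := fun i hi =>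
    norm_verletPos_step_le hf hs.half hT (by linarith) z hi
  have hdec : ∀ i < 2 * N, ‖verletPos U (h / 2) i z - verletPos U (h / 2) (i + 1) z‖
      ≤ h / 2 * (5 / 4 * S) := fun i hi => by
    rw [norm_sub_rev]
    exact hinc i hi
  have hbd : ∀ i ≤ 2 * N, ‖verletPos U (h / 2) i z‖ ≤ 12 / 11 * (T * S) := fun i hi => by
    rw [hSdef, mul_speed hT]
    exact norm_verletPos_le hf hs.half z hi
  have h2 := verletRec_traj U (h / 2) (2 * N) z
  have hr := h2.double
  rw [show 2 * (h / 2) = h by ring] at hr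
  -- Both local errors are O(h³): the position error is (h/2)² times a first difference of forces,
  -- and the velocity error is h/4 times a second difference, itself O(h²) by
  -- `VerletRec.second_diff`. Summed over N = T/h steps, once and twice respectively, they
  -- contribute O(h²).
  have hmain := (hr.sub (verletRec_traj U h N z)).norm_pos_le (T := T) (L := L) (c := 0)
    (R := (h / 2) ^ 2 * (L * (h / 2 * (5 / 4 * S))))
    (S := h / 2 / 2 * (L * ((h / 2) ^ 2 * (L * (12 / 11 * (T * S))))
      + LH * ((h / 2 * (5 / 4 * S)) ^ 2 + (h / 2 * (5 / 4 * S)) ^ 2)))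
    hh hs.T_eq hL0 hs.le le_rfl (by positivity)
    (fun k hk => ?_) (fun k hk => ?_) (by positivity)
    (fun k hk => by simpa using hf.lip _ _) le_rfl hk
  · refine hmain.trans ?_
    simp only [mul_zero, verletPos_zero, verletVel_zero, sub_self, norm_zero, zero_add]
    have e1 : (N : ℝ) * ((h / 2) ^ 2 * (L * (h / 2 * (5 / 4 * S))))
        = (N * h) * (5 / 32 * h ^ 2 * L * S) := by ring
    have e2 : h * (N : ℝ) ^ 2 / 2 * (h / 2 / 2 * (L * ((h / 2) ^ 2 * (L * (12 / 11 * (T * S))))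
        + LH * ((h / 2 * (5 / 4 * S)) ^ 2 + (h / 2 * (5 / 4 * S)) ^ 2)))
        = (N * h) ^ 2 * (h ^ 2 * (3 / 88 * L * L * T * S + 25 / 256 * LH * S ^ 2)) := by ring
    rw [e1, e2, ← hs.T_eq]
    calc 12 / 11 * (T * (5 / 32 * h ^ 2 * L * S)
          + T ^ 2 * (h ^ 2 * (3 / 88 * L * L * T * S + 25 / 256 * LH * S ^ 2)))
        = 12 / 11 * (h ^ 2 * T * L * S * 5 / 32 + (L * T ^ 2) * (3 / 88 * h ^ 2 * T * L * S)
          + 25 / 256 * (h ^ 2 * T ^ 2 * LH * S ^ 2)) := by ring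
      _ ≤ 12 / 11 * (h ^ 2 * T * L * S * 5 / 32 + 1 / 6 * (3 / 88 * h ^ 2 * T * L * S)
          + 25 / 256 * (h ^ 2 * T ^ 2 * LH * S ^ 2)) := by
          gcongr
          exact hs.le
      _ ≤ _ := by
          have p1 : 0 ≤ h ^ 2 * T * L * S := by positivity
          have p2 : 0 ≤ h ^ 2 * T ^ 2 * LH * S ^ 2 := by positivity
          nlinarith
  · rw [sub_zero, norm_smul, Real.norm_of_nonneg (by positivity)]
    gcongr
    exact (hf.lip _ _).trans (mul_le_mul_of_nonneg_left (hdec _ (by omega)) hL0)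
  · rw [sub_zero, norm_smul, Real.norm_of_nonneg (by positivity)]
    gcongr
    refine (hf.second _ _ _).trans ?_
    gcongr
    · rw [h2.second_diff (by omega), norm_neg, norm_smul, Real.norm_of_nonneg (by positivity)]
      gcongr
      exact (hf.norm_le _).trans (mul_le_mul_of_nonneg_left (hbd _ (by omega)) hL0)
    · exact hdec _ (by omega)
    · exact hinc _ (by omega)

/-- The second difference of a product `H(q) Q` along a trajectory. -/
lemma norm_second_diff_comp_le (hf : ForceBounds (∇ U) (fderiv ℝ (∇ U)) L LH LI)
    {x y z : E d} {A B C : E d →L[ℝ] E d} {w W m M : ℝ} (hx : ‖x - y‖ ≤ w) (hz : ‖z - y‖ ≤ w)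
    (hxz : ‖x - (2 : ℝ) • y + z‖ ≤ W) (hA : ‖A - B‖ ≤ m) (hC : ‖C - B‖ ≤ m)
    (hAC : ‖A - (2 : ℝ) • B + C‖ ≤ M) {b : ℝ} (hB : ‖B‖ ≤ b) :
    ‖(fderiv ℝ (∇ U) x).comp A - (2 : ℝ) • (fderiv ℝ (∇ U) y).comp B
        + (fderiv ℝ (∇ U) z).comp C‖
      ≤ L * M + (LH * W + LI * (w ^ 2 + w ^ 2)) * b + (LH * w * m + LH * w * m) := by
  have hL := hf.L_nonneg
  have hLH := hf.LH_nonneg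
  have hLI := hf.LI_nonneg
  have hw := (norm_nonneg _).trans hx
  have hW := (norm_nonneg _).trans hxz
  set Hx := fderiv ℝ (∇ U) x
  set Hy := fderiv ℝ (∇ U) y
  set Hz := fderiv ℝ (∇ U) z
  -- Discrete Leibniz rule for second differences, centred at the middle factors.
  have e : Hx.comp A - (2 : ℝ) • Hy.comp B + Hz.comp C
      = Hy.comp (A - (2 : ℝ) • B + C) + (Hx - (2 : ℝ) • Hy + Hz).comp B
        + ((Hx - Hy).comp (A - B) + (Hz - Hy).comp (C - B)) := by
    ext1 u
    simp only [sub_apply, add_apply, smul_apply, ContinuousLinearMap.comp_apply, map_sub, map_add,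
      map_smul]
    module
  rw [e]
  have hprod : ∀ {X : E d →L[ℝ] E d} {Y : E d →L[ℝ] E d} {s t : ℝ}, ‖X‖ ≤ s → ‖Y‖ ≤ t →
      ‖X.comp Y‖ ≤ s * t := fun {X Y s t} hX hY =>
    (ContinuousLinearMap.opNorm_comp_le _ _).trans
      (mul_le_mul hX hY (norm_nonneg _) ((norm_nonneg _).trans hX))
  refine norm_add₃_le.trans (add_le_add (add_le_add (hprod (hf.bound y) hAC) ?_)
    ((norm_add_le _ _).trans (add_le_add ?_ ?_)))
  · exact hprod ((hf.second' x y z).trans (by gcongr)) hB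
  · exact hprod ((hf.lip' x y).trans (by gcongr)) hA
  · exact hprod ((hf.lip' z y).trans (by gcongr)) hC

/-- The distance between the derivatives of the coarse and the fine trajectory. -/
lemma norm_posD_half_sub_le (hf : ForceBounds (∇ U) (fderiv ℝ (∇ U)) L LH LI)
    (hs : ShortTime L T h N) (hT : 0 < T) (hhT : h ≤ T) (z : E d × E d) :
    ‖posD U (h / 2) (2 * N) z - posD U h N z‖
      ≤ h ^ 2 * T * (9 / 50 * L + 8 / 25 * LH * T * speed T z
        + 3 / 25 * LI * T ^ 2 * speed T z ^ 2 + 7 / 100 * LH ^ 2 * T ^ 4 * speed T z ^ 2) := by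
  have hL0 := hf.L_nonneg
  have hLH0 := hf.LH_nonneg
  have hLI0 := hf.LI_nonneg
  have hh := hs.h_nonneg
  have hS := speed_nonneg hT z
  set S := speed T z with hSdef
  have hinc : ∀ i < 2 * N, ‖verletPos U (h / 2) (i + 1) z - verletPos U (h / 2) i z‖
      ≤ h / 2 * (5 / 4 * S) := fun i hi =>
    norm_verletPos_step_le hf hs.half hT (by linarith) z hi
  have hdec : ∀ i < 2 * N, ‖verletPos U (h / 2) i z - verletPos U (h / 2) (i + 1) z‖
      ≤ h / 2 * (5 / 4 * S) := fun i hi => by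
    rw [norm_sub_rev]
    exact hinc i hi
  have hincD : ∀ i < 2 * N, ‖posD U (h / 2) (i + 1) z - posD U (h / 2) i z‖
      ≤ h / 2 * (5 / 4) := fun i hi =>
    norm_posD_step_le hf hs.half hT (by linarith) z hi
  have hdecD : ∀ i < 2 * N, ‖posD U (h / 2) i z - posD U (h / 2) (i + 1) z‖
      ≤ h / 2 * (5 / 4) := fun i hi => by
    rw [norm_sub_rev]
    exact hincD i hi
  have hbd : ∀ i ≤ 2 * N, ‖verletPos U (h / 2) i z‖ ≤ 12 / 11 * (T * S) := fun i hi => by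
    rw [hSdef, mul_speed hT]
    exact norm_verletPos_le hf hs.half z hi
  have hbdD : ∀ i ≤ 2 * N, ‖posD U (h / 2) i z‖ ≤ 12 / 11 * T := fun i hi =>
    norm_posD_le hf hs.half z hi
  have h1 := verletRec_traj U (h / 2) (2 * N) z
  have h2 := verletRec_deriv hf (h / 2) (2 * N) z
  have hr := h2.double
  rw [show 2 * (h / 2) = h by ring] at hr
  set ε := h ^ 2 * T * (2 / 11 * L * S + 5 / 44 * T * LH * S ^ 2) with hε
  have hε0 : 0 ≤ ε := by positivity
  -- Besides the local errors there is now a source c, because the two recursions evaluate the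
  -- Hessian at positions up to ε apart.
  have hmain := (hr.sub (verletRec_deriv hf h N z)).norm_pos_le (T := T) (L := L)
    (c := LH * ε * (12 / 11 * T))
    (R := (h / 2) ^ 2 * (L * (h / 2 * (5 / 4)) + LH * (h / 2 * (5 / 4 * S)) * (12 / 11 * T)))
    (S := h / 2 / 2 * (L * ((h / 2) ^ 2 * (L * (12 / 11 * T)))
      + (LH * ((h / 2) ^ 2 * (L * (12 / 11 * (T * S))))
        + LI * ((h / 2 * (5 / 4 * S)) ^ 2 + (h / 2 * (5 / 4 * S)) ^ 2)) * (12 / 11 * T)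
      + (LH * (h / 2 * (5 / 4 * S)) * (h / 2 * (5 / 4))
        + LH * (h / 2 * (5 / 4 * S)) * (h / 2 * (5 / 4)))))
    hh hs.T_eq hL0 hs.le (by positivity) (by positivity)
    (fun k hk => ?_) (fun k hk => ?_) (by positivity)
    (fun k hk => norm_comp_sub_comp_le hf (norm_verletPos_half_sub_le hf hs hT hhT z hk)
      (norm_posD_le hf hs z hk)) le_rfl le_rfl
  · refine hmain.trans ?_
    simp only [mul_zero, posD_zero, velD_zero, sub_self, norm_zero, zero_add]
    have e1 : (N : ℝ) * ((h / 2) ^ 2 * (L * (h / 2 * (5 / 4))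
          + LH * (h / 2 * (5 / 4 * S)) * (12 / 11 * T)))
        = (N * h) * (h ^ 2 * (5 / 32 * L + 15 / 88 * LH * T * S)) := by ring
    have e2 : h * (N : ℝ) ^ 2 / 2 * (h / 2 / 2 * (L * ((h / 2) ^ 2 * (L * (12 / 11 * T)))
      + (LH * ((h / 2) ^ 2 * (L * (12 / 11 * (T * S))))
        + LI * ((h / 2 * (5 / 4 * S)) ^ 2 + (h / 2 * (5 / 4 * S)) ^ 2)) * (12 / 11 * T)
      + (LH * (h / 2 * (5 / 4 * S)) * (h / 2 * (5 / 4))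
        + LH * (h / 2 * (5 / 4 * S)) * (h / 2 * (5 / 4)))))
        = (N * h) ^ 2 * (h ^ 2 * (3 / 88 * L * L * T + 9 / 242 * LH * L * T ^ 2 * S
          + 75 / 704 * LI * T * S ^ 2 + 25 / 256 * LH * S)) := by ring
    rw [e1, e2, ← hs.T_eq, hε]
    calc 12 / 11 * (T ^ 2 / 2 * (LH * (h ^ 2 * T * (2 / 11 * L * S + 5 / 44 * T * LH * S ^ 2))
            * (12 / 11 * T)) + T * (h ^ 2 * (5 / 32 * L + 15 / 88 * LH * T * S))
          + T ^ 2 * (h ^ 2 * (3 / 88 * L * L * T + 9 / 242 * LH * L * T ^ 2 * S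
            + 75 / 704 * LI * T * S ^ 2 + 25 / 256 * LH * S)))
        = 12 / 11 * (h ^ 2 * T) * ((L * T ^ 2) * (3 / 88 * L + (12 / 121 + 9 / 242) * LH * T * S)
          + (5 / 32 * L + (15 / 88 + 25 / 256) * LH * T * S + 75 / 704 * LI * T ^ 2 * S ^ 2
            + 15 / 242 * LH ^ 2 * T ^ 4 * S ^ 2)) := by ring
      _ ≤ 12 / 11 * (h ^ 2 * T) * (1 / 6 * (3 / 88 * L + (12 / 121 + 9 / 242) * LH * T * S)
          + (5 / 32 * L + (15 / 88 + 25 / 256) * LH * T * S + 75 / 704 * LI * T ^ 2 * S ^ 2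
            + 15 / 242 * LH ^ 2 * T ^ 4 * S ^ 2)) := by
          gcongr
          exact hs.le
      _ = h ^ 2 * T * (12 / 11 * (1 / 6 * (3 / 88 * L + (12 / 121 + 9 / 242) * LH * T * S)
          + (5 / 32 * L + (15 / 88 + 25 / 256) * LH * T * S + 75 / 704 * LI * T ^ 2 * S ^ 2
            + 15 / 242 * LH ^ 2 * T ^ 4 * S ^ 2))) := by ring
      _ ≤ _ := by
          gcongr
          have p2 : 0 ≤ LH * T * S := by positivity
          have p3 : 0 ≤ LI * T ^ 2 * S ^ 2 := by positivity
          have p4 : 0 ≤ LH ^ 2 * T ^ 4 * S ^ 2 := by positivity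
          linarith
  · rw [sub_zero, norm_smul, Real.norm_of_nonneg (by positivity)]
    gcongr
    refine (norm_comp_sub_comp_le hf (hdec _ (by omega)) (hbdD _ (by omega))).trans ?_
    gcongr
    exact hdecD _ (by omega)
  · rw [sub_zero, norm_smul, Real.norm_of_nonneg (by positivity)]
    gcongr
    refine norm_second_diff_comp_le hf (hdec _ (by omega)) (hinc _ (by omega)) ?_
      (hdecD _ (by omega)) (hincD _ (by omega)) ?_ (hbdD _ (by omega))
    · rw [h1.second_diff (by omega), norm_neg, norm_smul, Real.norm_of_nonneg (by positivity)]
      gcongr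
      exact (hf.norm_le _).trans (mul_le_mul_of_nonneg_left (hbd _ (by omega)) hL0)
    · rw [h2.second_diff (by omega), norm_neg, norm_smul, Real.norm_of_nonneg (by positivity)]
      gcongr
      exact (norm_comp_le_of_bound hf _ _).trans
        (mul_le_mul_of_nonneg_left (hbdD _ (by omega)) hL0)
end
end UHMC

/-! ### Halving the step size: O(h²) in total variation. -/

namespace UHMC

/-- The integrand of the square of `biasConst`. -/
def biasPoly (d : ℕ) (T L LH LI r : ℝ) : ℝ :=
  ((d : ℝ) ^ 3 * (4 * LI ^ 2 * T ^ 4 + 14 * LH ^ 2 * LI * T ^ 6 + 14 * LH ^ 4 * T ^ 8)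
      + (d : ℝ) ^ 2 * (35 * LH ^ 2 * T ^ 2 + 8 * LI ^ 2 * T ^ 4
          + 28 * LH ^ 2 * LI * T ^ 6 + 28 * LH ^ 4 * T ^ 8)
      + d * (16 * L ^ 2 + 4 * LH ^ 2 * T ^ 2))
    + (2 * d * LH ^ 2 + L ^ 2 * T⁻¹ ^ 2) * r ^ 2
    + (d * LI ^ 2 + d * LH ^ 2 * LI * T ^ 2 + d * LH ^ 4 * T ^ 4 + LH ^ 2 * T⁻¹ ^ 2) * r ^ 4

section
variable {d : ℕ} {U : E d → ℝ} {L LH LI T h : ℝ} {N : ℕ}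

/-- A bound for the vector field that transports the coarse to the fine kernel. -/
def fieldBound (T L LH h S : ℝ) : ℝ := h ^ 2 * (1 / 5 * L * S + 1 / 8 * T * LH * S ^ 2)

/-- A bound for the derivative of the vector field that transports the coarse to the fine
kernel. -/
def fieldDerivBound (T L LH LI h S : ℝ) : ℝ :=
  h ^ 2 * (1 / 5 * L + 2 / 5 * LH * T * S + 1 / 7 * LI * T ^ 2 * S ^ 2
    + 1 / 5 * LH ^ 2 * T ^ 4 * S ^ 2)

lemma fieldBound_sq_add_le {D : ℝ} (hD : 0 ≤ D) (T L LH LI h S : ℝ) :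
    fieldBound T L LH h S ^ 2 + D * fieldDerivBound T L LH LI h S ^ 2
      ≤ h ^ 4 * (4 / 25 * D * L ^ 2 + (2 / 25 * L ^ 2 + 16 / 25 * D * LH ^ 2 * T ^ 2) * S ^ 2
        + (1 / 32 * T ^ 2 * LH ^ 2 + D * (4 / 49 * LI ^ 2 * T ^ 4 + 4 / 25 * LH ^ 4 * T ^ 8))
          * S ^ 4) := by
  have h1 : ∀ a b : ℝ, (a + b) ^ 2 ≤ 2 * (a ^ 2 + b ^ 2) := fun a b => add_sq_le
  have h2 : ∀ a b c e : ℝ, (a + b + c + e) ^ 2 ≤ 4 * (a ^ 2 + b ^ 2 + c ^ 2 + e ^ 2) :=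
    fun a b c e => by
      nlinarith [sq_nonneg (a - b), sq_nonneg (a - c), sq_nonneg (a - e),
        sq_nonneg (b - c), sq_nonneg (b - e), sq_nonneg (c - e)]
  unfold fieldBound fieldDerivBound
  rw [mul_pow, mul_pow]
  calc _ ≤ (h ^ 2) ^ 2 * (2 * ((1 / 5 * L * S) ^ 2 + (1 / 8 * T * LH * S ^ 2) ^ 2))
      + D * ((h ^ 2) ^ 2 * (4 * ((1 / 5 * L) ^ 2 + (2 / 5 * LH * T * S) ^ 2
        + (1 / 7 * LI * T ^ 2 * S ^ 2) ^ 2 + (1 / 5 * LH ^ 2 * T ^ 4 * S ^ 2) ^ 2))) := by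
        gcongr
        · exact h1 _ _
        · exact h2 _ _ _ _
    _ = _ := by ring

lemma integrable_speed_pow (hT : 0 < T) (x : E d) (n : ℕ) :
    Integrable (fun v => speed T (x, v) ^ n) (stdGaussian (E d)) := by
  have h : MemLp (fun v : E d => ‖v‖ + ‖x‖ / T) n (stdGaussian (E d)) :=
    (IsGaussian.memLp_id (stdGaussian (E d)) n (by simp)).norm.add (memLp_const _)
  refine h.integrable_norm_pow'.congr (Filter.Eventually.of_forall fun v => ?_)
  simp only [speed]
  rw [Real.norm_of_nonneg (by positivity)]

lemma integral_speed_sq_le (hT : 0 < T) (x : E d) :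
    ∫ v, speed T (x, v) ^ 2 ∂(stdGaussian (E d)) ≤ 2 * (d + (‖x‖ / T) ^ 2) := by
  have hi := (integrable_norm_pow_stdGaussian (d := d) 2)
  calc ∫ v, speed T (x, v) ^ 2 ∂(stdGaussian (E d))
      ≤ ∫ v, 2 * (‖v‖ ^ 2 + (‖x‖ / T) ^ 2) ∂(stdGaussian (E d)) :=
        integral_mono (integrable_speed_pow hT x 2)
          ((hi.add (integrable_const _)).const_mul 2) fun v => add_sq_le
    _ = _ := by
        rw [integral_const_mul, integral_add hi (integrable_const _),
          integral_norm_sq_stdGaussian]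
        simp

lemma integral_speed_pow_four_le (hT : 0 < T) (x : E d) :
    ∫ v, speed T (x, v) ^ 4 ∂(stdGaussian (E d)) ≤ 8 * (3 * (d : ℝ) ^ 2 + (‖x‖ / T) ^ 4) := by
  have hi := (integrable_norm_pow_stdGaussian (d := d) 4)
  calc ∫ v, speed T (x, v) ^ 4 ∂(stdGaussian (E d))
      ≤ ∫ v, 8 * (‖v‖ ^ 4 + (‖x‖ / T) ^ 4) ∂(stdGaussian (E d)) := by
        refine integral_mono (integrable_speed_pow hT x 4)
          ((hi.add (integrable_const _)).const_mul 8) fun v => ?_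
        have := add_pow_le (a := ‖v‖) (b := ‖x‖ / T) (norm_nonneg _) (by positivity) 4
        norm_num at this
        exact this
    _ ≤ _ := by
        rw [integral_const_mul, integral_add hi (integrable_const _)]
        simp only [integral_const, probReal_univ, one_smul]
        gcongr
        exact integral_norm_pow_four_stdGaussian_le

/-- The left side is what the moment bounds for `speed` produce. After r = Tu both sides are
polynomials with nonnegative coefficients, compared term by term. The factor 9/4 = (3/2)² becomes
the 3/4 of the halving estimate. -/
lemma biasPoly_ge (hT : 0 < T) (hLI : 0 ≤ LI) (d : ℕ) (L LH r : ℝ) :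
    4 / 25 * d * L ^ 2 + (2 / 25 * L ^ 2 + 16 / 25 * d * LH ^ 2 * T ^ 2) * (2 * (d + (r / T) ^ 2))
      + (1 / 32 * T ^ 2 * LH ^ 2 + d * (4 / 49 * LI ^ 2 * T ^ 4 + 4 / 25 * LH ^ 4 * T ^ 8))
        * (8 * (3 * (d : ℝ) ^ 2 + (r / T) ^ 4))
      ≤ 9 / 4 * biasPoly d T L LH LI r := by
  obtain ⟨u, rfl⟩ : ∃ u, r = T * u := ⟨r / T, by field_simp⟩
  have e1 : T * u / T = u := by field_simp
  have e2 : biasPoly d T L LH LI (T * u)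
      = ((d : ℝ) ^ 3 * (4 * LI ^ 2 * T ^ 4 + 14 * LH ^ 2 * LI * T ^ 6 + 14 * LH ^ 4 * T ^ 8)
      + (d : ℝ) ^ 2 * (35 * LH ^ 2 * T ^ 2 + 8 * LI ^ 2 * T ^ 4
          + 28 * LH ^ 2 * LI * T ^ 6 + 28 * LH ^ 4 * T ^ 8)
      + d * (16 * L ^ 2 + 4 * LH ^ 2 * T ^ 2))
    + (2 * d * LH ^ 2 * T ^ 2 + L ^ 2) * u ^ 2
    + (d * LI ^ 2 * T ^ 4 + d * LH ^ 2 * LI * T ^ 6 + d * LH ^ 4 * T ^ 8 + LH ^ 2 * T ^ 2)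
      * u ^ 4 := by
    unfold biasPoly
    field_simp
  rw [e1, e2, ← sub_nonneg]
  have hd : (0 : ℝ) ≤ d := Nat.cast_nonneg d
  have p1 : 0 ≤ (d : ℝ) ^ 3 * LI ^ 2 * T ^ 4 := by positivity
  have p2 : 0 ≤ (d : ℝ) ^ 3 * LH ^ 2 * LI * T ^ 6 := by positivity
  have p3 : 0 ≤ (d : ℝ) ^ 3 * LH ^ 4 * T ^ 8 := by positivity
  have p4 : 0 ≤ (d : ℝ) ^ 2 * LH ^ 2 * T ^ 2 := by positivity
  have p5 : 0 ≤ (d : ℝ) ^ 2 * LI ^ 2 * T ^ 4 := by positivity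
  have p6 : 0 ≤ (d : ℝ) ^ 2 * LH ^ 2 * LI * T ^ 6 := by positivity
  have p7 : 0 ≤ (d : ℝ) ^ 2 * LH ^ 4 * T ^ 8 := by positivity
  have p8 : 0 ≤ (d : ℝ) * L ^ 2 := by positivity
  have p9 : 0 ≤ (d : ℝ) * LH ^ 2 * T ^ 2 := by positivity
  have q1 : 0 ≤ (d : ℝ) * LH ^ 2 * T ^ 2 * u ^ 2 := by positivity
  have q2 : 0 ≤ L ^ 2 * u ^ 2 := by positivity
  have q3 : 0 ≤ (d : ℝ) * LI ^ 2 * T ^ 4 * u ^ 4 := by positivity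
  have q4 : 0 ≤ (d : ℝ) * LH ^ 2 * LI * T ^ 6 * u ^ 4 := by positivity
  have q5 : 0 ≤ (d : ℝ) * LH ^ 4 * T ^ 8 * u ^ 4 := by positivity
  have q6 : 0 ≤ LH ^ 2 * T ^ 2 * u ^ 4 := by positivity
  linarith

/-- Halving the step size changes the transition kernel by `O(h²)` in total variation. -/
lemma abs_uhmcKernel_half_sub_le (hU : PotentialAssumptions U L LH LI)
    (hs : ShortTime L T h N) (hT : 0 < T) (hhT : h ≤ T) (x : E d) {A : Set (E d)}
    (hA : MeasurableSet A) :
    |(uhmcKernel U (h / 2) (2 * N) x).real A - (uhmcKernel U h N x).real A|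
      ≤ 3 / 4 * h ^ 2 * √(biasPoly d T L LH LI ‖x‖) := by
  have hf := hU.forceBounds
  have hLH := hf.LH_nonneg
  have hU1 : ContDiff ℝ 1 U := hU.smooth.of_le (by norm_num)
  have hd : (0 : ℝ) ≤ d := Nat.cast_nonneg d
  set α : E d → ℝ := fun v => fieldBound T L LH h (speed T (x, v)) with hα
  set β : E d → ℝ := fun v => fieldDerivBound T L LH LI h (speed T (x, v)) with hβ
  have hi : ∀ n, Integrable (fun v => speed T (x, v) ^ n) (stdGaussian (E d)) :=
    integrable_speed_pow hT x
  have hi1 : Integrable (fun v => speed T (x, v)) (stdGaussian (E d)) := by simpa using hi 1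
  have hsc : Continuous fun v => speed T (x, v) := by
    unfold speed
    fun_prop
  have hαi : Integrable (fun v => α v ^ 2) (stdGaussian (E d)) := by
    have e : (fun v => α v ^ 2) = fun v => h ^ 4 * ((1 / 5 * L) ^ 2 * speed T (x, v) ^ 2
        + 2 * (1 / 5 * L) * (1 / 8 * T * LH) * speed T (x, v) ^ 3
        + (1 / 8 * T * LH) ^ 2 * speed T (x, v) ^ 4) := by
      ext v
      simp only [hα, fieldBound]
      ring
    rw [e]
    exact ((((hi 2).const_mul _).add ((hi 3).const_mul _)).add ((hi 4).const_mul _)).const_mul _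
  have hβi : Integrable (fun v => β v ^ 2) (stdGaussian (E d)) := by
    obtain ⟨a, ha⟩ : ∃ a, a = 1 / 7 * LI * T ^ 2 + 1 / 5 * LH ^ 2 * T ^ 4 := ⟨_, rfl⟩
    have e : (fun v => β v ^ 2) = fun v => h ^ 4 * ((1 / 5 * L) ^ 2
        + 2 * (1 / 5 * L) * (2 / 5 * LH * T) * speed T (x, v)
        + ((2 / 5 * LH * T) ^ 2 + 2 * (1 / 5 * L) * a) * speed T (x, v) ^ 2
        + 2 * (2 / 5 * LH * T) * a * speed T (x, v) ^ 3 + a ^ 2 * speed T (x, v) ^ 4) := by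
      ext v
      simp only [hβ, fieldDerivBound, ha]
      ring
    rw [e]
    exact (((((integrable_const _).add (hi1.const_mul _)).add ((hi 2).const_mul _)).add
      ((hi 3).const_mul _)).add ((hi 4).const_mul _)).const_mul _
  have h1 := abs_map_stdGaussian_sub_le (F₀ := fun v => verletPos U h N (x, v))
    (F₁ := fun v => verletPos U (h / 2) (2 * N) (x, v)) (T := T) (κ := 2 / 3 * LH * T ^ 4)
    (α := α) (β := β) hT
    (contDiff_verlet hf.contDiff h N x).1 (contDiff_verlet hf.contDiff (h / 2) (2 * N) x).1
    (fun v => norm_posD_sub_smul_le hf hs (x, v))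
    (fun v => norm_posD_sub_smul_le hf hs.half (x, v))
    (by positivity)
    (fun v v' => by
      refine (norm_posD_sub_le hf hs (x, v) (x, v') le_rfl).trans (le_of_eq ?_)
      simp
      ring)
    (fun v v' => by
      refine (norm_posD_sub_le hf hs.half (x, v) (x, v') le_rfl).trans (le_of_eq ?_)
      simp
      ring)
    -- Multiplying 2/11 and 5/44 by 11/10 gives the 1/5 and 1/8 of `fieldBound`.
    (fun v => by
      refine (mul_le_mul_of_nonneg_left (norm_verletPos_half_sub_le hf hs hT hhT (x, v) le_rfl)
        (by norm_num)).trans (le_of_eq ?_)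
      simp only [hα, fieldBound]
      ring)
    (fun v => by
      refine (mul_le_mul_of_nonneg_left (add_le_add_left
        (norm_posD_half_sub_le hf hs hT hhT (x, v)) _) (by norm_num)).trans ?_
      simp only [hα, hβ, fieldBound, fieldDerivBound]
      have hS := speed_nonneg hT (x, v)
      generalize speed T (x, v) = S at *
      have hL := hf.L_nonneg
      have hLI := hf.LI_nonneg
      calc _ = h ^ 2 * T * (99 / 500 * L + (44 / 125 * LH * T * S
              + L * T ^ 2 * (11 / 75 * LH * T * S))
            + 33 / 250 * LI * T ^ 2 * S ^ 2
            + 506 / 3000 * LH ^ 2 * T ^ 4 * S ^ 2) := by ring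
        _ ≤ h ^ 2 * T * (1 / 5 * L + 2 / 5 * LH * T * S
            + 1 / 7 * LI * T ^ 2 * S ^ 2 + 1 / 5 * LH ^ 2 * T ^ 4 * S ^ 2) := by
            refine mul_le_mul_of_nonneg_left ?_ (by positivity)
            have p1 : 0 ≤ LH * T * S := by positivity
            have p2 : 0 ≤ LI * T ^ 2 * S ^ 2 := by positivity
            have p3 : 0 ≤ LH ^ 2 * T ^ 4 * S ^ 2 := by positivity
            have p4 := mul_le_mul_of_nonneg_right hs.le
              (by positivity : 0 ≤ 11 / 75 * LH * T * S)
            linarith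
        _ = _ := by ring)
    hαi hβi hA
  rw [uhmcKernel_apply hU1, uhmcKernel_apply hU1]
  refine h1.trans ?_
  have e : 3 / 4 * h ^ 2 * √(biasPoly d T L LH LI ‖x‖)
      = 1 / 2 * √((3 / 2 * h ^ 2) ^ 2 * biasPoly d T L LH LI ‖x‖) := by
    rw [Real.sqrt_mul (by positivity), Real.sqrt_sq (by positivity)]
    ring
  rw [e]
  gcongr
  set k0 := 4 / 25 * d * L ^ 2
  set k2 := 2 / 25 * L ^ 2 + 16 / 25 * d * LH ^ 2 * T ^ 2 with hk2
  set k4 := 1 / 32 * T ^ 2 * LH ^ 2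
    + d * (4 / 49 * LI ^ 2 * T ^ 4 + 4 / 25 * LH ^ 4 * T ^ 8) with hk4
  have hk20 : 0 ≤ k2 := by positivity
  have hk40 : 0 ≤ k4 := by positivity
  have i2 := (hi 2).const_mul k2
  have i4 := (hi 4).const_mul k4
  calc ∫ v, (α v ^ 2 + d * β v ^ 2) ∂(stdGaussian (E d))
      ≤ ∫ v, h ^ 4 * (k0 + k2 * speed T (x, v) ^ 2 + k4 * speed T (x, v) ^ 4)
          ∂(stdGaussian (E d)) :=
        integral_mono (hαi.add (hβi.const_mul _))
          ((((integrable_const k0).add i2).add i4).const_mul _)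
          fun v => fieldBound_sq_add_le hd T L LH LI h (speed T (x, v))
    _ = h ^ 4 * (k0 + k2 * ∫ v, speed T (x, v) ^ 2 ∂(stdGaussian (E d))
          + k4 * ∫ v, speed T (x, v) ^ 4 ∂(stdGaussian (E d))) := by
        rw [integral_const_mul]
        congr 1
        have j1 : Integrable (fun v => k0 + k2 * speed T (x, v) ^ 2) (stdGaussian (E d)) :=
          (integrable_const k0).add i2
        rw [integral_add j1 i4, integral_add (integrable_const k0) i2]
        simp only [integral_const, probReal_univ, one_smul]
        rw [integral_const_mul, integral_const_mul]
    _ ≤ h ^ 4 * (k0 + k2 * (2 * (d + (‖x‖ / T) ^ 2))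
          + k4 * (8 * (3 * (d : ℝ) ^ 2 + (‖x‖ / T) ^ 4))) := by
        gcongr
        · exact integral_speed_sq_le hT x
        · exact integral_speed_pow_four_le hT x
    _ ≤ h ^ 4 * (9 / 4 * biasPoly d T L LH LI ‖x‖) := by
        gcongr
        exact biasPoly_ge hT hf.LI_nonneg d L LH ‖x‖
    _ = _ := by ring
end
end UHMC

namespace UHMC
open scoped RealInnerProductSpace Topology

section
variable {d : ℕ} {U : E d → ℝ} {L LH LI T h : ℝ} {N : ℕ}

lemma continuous_gradient_of_contDiff (hU : ContDiff ℝ 1 U) : Continuous (∇ U) :=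
  (InnerProductSpace.toDual ℝ (E d)).symm.continuous.comp (hU.continuous_fderiv one_ne_zero)

/-! ### Velocity Verlet preserves Lebesgue measure -/

/-- A shear: on each fibre it is a translation of the velocity. -/
lemma measurePreserving_kick {f : E d → E d} (hf : Measurable f) :
    MeasurePreserving (fun z : E d × E d => (z.1, z.2 - f z.1)) := by
  refine (MeasurePreserving.id (volume : Measure (E d))).skew_product
    (g := fun x v => v - f x) (μc := volume) (μd := volume) (by fun_prop)
    (Filter.Eventually.of_forall fun x => ?_)
  exact (measurePreserving_sub_right volume (f x)).map_eq

lemma measurePreserving_drift (h : ℝ) :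
    MeasurePreserving (fun z : E d × E d => (z.1 + h • z.2, z.2)) := by
  have h1 : MeasurePreserving (Prod.swap : E d × E d → E d × E d) volume volume :=
    Measure.measurePreserving_swap
  have h2 := measurePreserving_kick (d := d) (f := fun x => -(h • x)) (by fun_prop)
  have h3 := (h1.comp h2).comp h1
  have e : (fun z : E d × E d => (z.1 + h • z.2, z.2))
      = (Prod.swap ∘ fun z => (z.1, z.2 - -(h • z.1))) ∘ Prod.swap := by
    ext1 z
    simp
  rw [e]
  exact h3

/-- A Verlet step factors into half kick, drift, half kick, all of them shears. -/
lemma measurePreserving_verletStep (hU : ContDiff ℝ 1 U) (h : ℝ) :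
    MeasurePreserving (verletStep U h) := by
  have hg := continuous_gradient_of_contDiff hU
  have hk := measurePreserving_kick (d := d) (f := fun x => (h / 2) • ∇ U x)
    (by have := hg.measurable; fun_prop)
  have h3 := (hk.comp (measurePreserving_drift h)).comp hk
  convert h3 using 1
  ext1 z
  have e : z.1 + h • (z.2 - (h / 2) • ∇ U z.1) = z.1 + h • z.2 - (h ^ 2 / 2) • ∇ U z.1 := by
    module
  simp only [verletStep, Function.comp_apply, e, smul_add, sub_sub]

/-! ### Almost conservation of energy -/

/-- The Hamiltonian. -/
def energy {d : ℕ} (U : E d → ℝ) (z : E d × E d) : ℝ := U z.1 + ‖z.2‖ ^ 2 / 2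

lemma abs_sub_sub_inner_le (hU : Differentiable ℝ U)
    (hf : ForceBounds (∇ U) (fderiv ℝ (∇ U)) L LH LI) (x y : E d) :
    |U y - U x - ⟪∇ U x, y - x⟫| ≤ L * ‖y - x‖ ^ 2 := by
  have hL := hf.L_nonneg
  have hg : ∀ z w, fderiv ℝ U z w = ⟪∇ U z, w⟫ := fun z w => by
    simp [gradient, InnerProductSpace.toDual_symm_apply]
  have h := (convex_segment x y).norm_image_sub_le_of_norm_fderiv_le' (𝕜 := ℝ) (f := U)
    (C := L * ‖y - x‖) (φ := fderiv ℝ U x) (fun z _ => hU z) (fun z hz => ?_)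
    (left_mem_segment ℝ x y) (right_mem_segment ℝ x y)
  · rw [hg, Real.norm_eq_abs] at h
    calc _ ≤ _ := h
      _ = _ := by ring
  · refine ContinuousLinearMap.opNorm_le_bound _ (by positivity) fun w => ?_
    rw [sub_apply, hg, hg, ← inner_sub_left]
    refine (norm_inner_le_norm _ _).trans ?_
    gcongr
    refine (hf.lip z x).trans ?_
    gcongr
    exact norm_sub_le_of_mem_segment hz

/-- To first order U gains h⟨∇U, p⟩ and the kinetic energy loses it. A remainder of order h² per
step is enough, since N steps of size T/N then accumulate only O(1/N). -/
lemma abs_energy_verletStep_sub_le (hU : Differentiable ℝ U)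
    (hf : ForceBounds (∇ U) (fderiv ℝ (∇ U)) L LH LI) (hh : 0 ≤ h) (hhT : h ≤ T) {z : E d × E d}
    {P G : ℝ} (hP : ‖z.2‖ ≤ P) (hG : ‖∇ U z.1‖ ≤ G) (hG' : ‖∇ U (verletStep U h z).1‖ ≤ G) :
    |energy U (verletStep U h z) - energy U z|
      ≤ h ^ 2 * (L * (P + T * G) ^ 2 + G ^ 2 + L * (P + T * G) * P) := by
  obtain ⟨q, p⟩ := z
  have hL := hf.L_nonneg
  have hP0 := (norm_nonneg _).trans hP
  have hG0 := (norm_nonneg _).trans hG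
  have hT0 := hh.trans hhT
  simp only [verletStep] at *
  set q' := q + h • p - (h ^ 2 / 2) • ∇ U q with hq'
  set p' := p - (h / 2) • (∇ U q + ∇ U q') with hp'
  have hdq : ‖q' - q‖ ≤ h * (P + T * G) := by
    have e : q' - q = h • p - (h ^ 2 / 2) • ∇ U q := by
      rw [hq']
      abel
    rw [e]
    refine (norm_sub_le _ _).trans ?_
    rw [norm_smul, norm_smul, Real.norm_of_nonneg hh, Real.norm_of_nonneg (by positivity)]
    calc h * ‖p‖ + h ^ 2 / 2 * ‖∇ U q‖ ≤ h * P + h ^ 2 / 2 * G := by gcongr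
      _ = h * (P + h / 2 * G) := by ring
      _ ≤ _ := by
        gcongr
        linarith
  have hdp : ‖p' - p‖ ≤ h * G := by
    have e : p' - p = -((h / 2) • (∇ U q + ∇ U q')) := by
      rw [hp']
      abel
    rw [e, norm_neg, norm_smul, Real.norm_of_nonneg (by positivity)]
    calc h / 2 * ‖∇ U q + ∇ U q'‖ ≤ h / 2 * (G + G) := by
          gcongr
          exact (norm_add_le _ _).trans (add_le_add hG hG')
      _ = _ := by ring
  have h1 := abs_sub_sub_inner_le hU hf q q'
  have h2 : |⟪∇ U q' - ∇ U q, p⟫| ≤ L * (h * (P + T * G)) * P := by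
    refine (abs_real_inner_le_norm _ _).trans ?_
    gcongr
    exact (hf.lip q' q).trans (by gcongr)
  have h3 : ‖p'‖ ^ 2 = ‖p‖ ^ 2 - 2 * h * ⟪∇ U q, p⟫ - h * ⟪∇ U q' - ∇ U q, p⟫
      + ‖p' - p‖ ^ 2 := by
    have e : p' = p + (p' - p) := by abel
    have e2 : p' - p = -(h • ∇ U q + (h / 2) • (∇ U q' - ∇ U q)) := by
      rw [hp']
      module
    have e3 : ⟪p, p' - p⟫ = -(h * ⟪∇ U q, p⟫ + h / 2 * ⟪∇ U q' - ∇ U q, p⟫) := by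
      rw [e2, inner_neg_right, inner_add_right, inner_smul_right, inner_smul_right,
        real_inner_comm p, real_inner_comm p]
    conv_lhs => rw [e, norm_add_sq_real, e3]
    ring
  have h4 : ⟪∇ U q, q' - q⟫ = h * ⟪∇ U q, p⟫ - h ^ 2 / 2 * ‖∇ U q‖ ^ 2 := by
    have e : q' - q = h • p - (h ^ 2 / 2) • ∇ U q := by
      rw [hq']
      abel
    rw [e, inner_sub_right, inner_smul_right, inner_smul_right, real_inner_self_eq_norm_sq]
  have h5 : L * ‖q' - q‖ ^ 2 ≤ L * (h * (P + T * G)) ^ 2 := by gcongr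
  have h6 : ‖p' - p‖ ^ 2 ≤ (h * G) ^ 2 := by gcongr
  have h7 : ‖∇ U q‖ ^ 2 ≤ G ^ 2 := by gcongr
  have e : energy U (q', p') - energy U (q, p) = (U q' - U q - ⟪∇ U q, q' - q⟫)
      - h ^ 2 / 2 * ‖∇ U q‖ ^ 2 - h / 2 * ⟪∇ U q' - ∇ U q, p⟫ + ‖p' - p‖ ^ 2 / 2 := by
    simp only [energy, h3, h4]
    ring
  rw [e]
  have h8 : h ^ 2 / 2 * ‖∇ U q‖ ^ 2 ≤ h ^ 2 / 2 * G ^ 2 := by gcongr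
  have h9 : |h / 2 * ⟪∇ U q' - ∇ U q, p⟫| ≤ h / 2 * (L * (h * (P + T * G)) * P) := by
    rw [abs_mul, abs_of_nonneg (by positivity : 0 ≤ h / 2)]
    gcongr
  have h10 : 0 ≤ h ^ 2 / 2 * ‖∇ U q‖ ^ 2 := by positivity
  have h11 : 0 ≤ ‖p' - p‖ ^ 2 := by positivity
  have h12 : 0 ≤ h ^ 2 * G ^ 2 := by positivity
  have h13 : 0 ≤ L * (h * (P + T * G)) * P * h := by positivity
  rw [abs_le] at *
  constructor <;> nlinarith

/-- The constant depends on the initial state; pointwise convergence is all that dominated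
convergence needs. -/
lemma exists_abs_energy_sub_le (hU : Differentiable ℝ U)
    (hf : ForceBounds (∇ U) (fderiv ℝ (∇ U)) L LH LI) (hT : 0 ≤ T) (hLT : L * T ^ 2 ≤ 1 / 6)
    (z : E d × E d) : ∃ C, ∀ (N : ℕ), 0 < N →
      |energy U ((verletStep U (T / N))^[N] z) - energy U z| ≤ C / N := by
  have hL := hf.L_nonneg
  set M := 12 / 11 * (‖z.1‖ + T * ‖z.2‖)
  set P := ‖z.2‖ + T * (L * M)
  set D := L * (P + T * (L * M)) ^ 2 + (L * M) ^ 2 + L * (P + T * (L * M)) * P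
  refine ⟨T ^ 2 * D, fun N hN => ?_⟩
  have hN' : (0 : ℝ) < N := by exact_mod_cast hN
  have hs : ShortTime L T (T / N) N := ⟨by positivity, by field_simp, hLT⟩
  have hpos : ∀ k ≤ N, ‖((verletStep U (T / N))^[k] z).1‖ ≤ M := fun k hk =>
    norm_verletPos_le hf hs z hk
  have hg : ∀ k ≤ N, ‖∇ U ((verletStep U (T / N))^[k] z).1‖ ≤ L * M := fun k hk =>
    (hf.norm_le _).trans (mul_le_mul_of_nonneg_left (hpos k hk) hL)
  have hvel : ∀ k ≤ N, ‖((verletStep U (T / N))^[k] z).2‖ ≤ P := fun k hk => by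
    have h1 := norm_verletVel_sub_le hf hs z hk
    have h2 := norm_le_norm_add_norm_sub' (verletVel U (T / N) k z) z.2
    exact h2.trans (add_le_add le_rfl h1)
  have key : ∀ k ≤ N, |energy U ((verletStep U (T / N))^[k] z) - energy U z|
      ≤ k * ((T / N) ^ 2 * D) := by
    intro k
    induction k with
    | zero => simp
    | succ k ih =>
      intro hk
      have h1 := ih (by omega)
      have hg' := hg (k + 1) hk
      rw [Function.iterate_succ_apply'] at hg' ⊢
      have hTN : T / N ≤ T := div_le_self hT (by exact_mod_cast hN)
      have h2 := abs_energy_verletStep_sub_le hU hf hs.h_nonneg hTN (hvel k (by omega))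
        (hg k (by omega)) hg'
      refine (abs_sub_le _ (energy U ((verletStep U (T / N))^[k] z)) _).trans ?_
      push_cast
      linarith
  refine (key N le_rfl).trans (le_of_eq ?_)
  field_simp

/-! ### The canonical measure -/

/-- The density of the canonical measure `μ ⊗ N(0, I)`. -/
def canonDens {d : ℕ} (U : E d → ℝ) (z : E d × E d) : ℝ≥0∞ :=
  ENNReal.ofReal ((∫ x, Real.exp (-U x))⁻¹ * ((2 * Real.pi) ^ ((d : ℝ) / 2))⁻¹
    * Real.exp (-energy U z))

lemma measurable_canonDens (hU : Continuous U) : Measurable (canonDens U) := by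
  unfold canonDens energy
  have := hU.measurable
  fun_prop

lemma target_prod_eq_withDensity (hU : Continuous U) :
    (target U).prod (stdGaussian (E d)) = volume.withDensity (canonDens U) := by
  have hm := hU.measurable
  have hgm := (contDiff_gaussDens (d := d) (n := 0)).continuous.measurable
  rw [target, Measure.tilted, stdGaussian_eq_withDensity, prod_withDensity (by fun_prop)
    (by fun_prop)]
  congr 1
  ext1 z
  rw [← ENNReal.ofReal_mul (by positivity), canonDens, gaussDens, energy]
  congr 1
  have : -(U z.1 + ‖z.2‖ ^ 2 / 2) = -U z.1 + -(1 / 2) * ‖z.2‖ ^ 2 := by ring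
  rw [this, Real.exp_add]
  ring

lemma isProbabilityMeasure_target (hi : Integrable fun x => Real.exp (-U x)) :
    IsProbabilityMeasure (target U) :=
  isProbabilityMeasure_tilted hi

lemma isMarkovKernel_uhmcKernel (hU : ContDiff ℝ 1 U) (h : ℝ) (N : ℕ) :
    IsMarkovKernel (uhmcKernel U h N) :=
  Kernel.IsMarkovKernel.map _ (measurable_verletPos hU h N)

lemma bind_uhmcKernel_apply (hU : ContDiff ℝ 1 U) (ν : Measure (E d)) [SFinite ν] {A : Set (E d)}
    (hA : MeasurableSet A) :
    (ν.bind (uhmcKernel U h N)) A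
      = (ν.prod (stdGaussian (E d))) ((verletStep U h)^[N] ⁻¹' (Prod.fst ⁻¹' A)) := by
  have hm := measurable_verletPos hU h N
  rw [Measure.bind_apply hA (Kernel.aemeasurable _), Measure.prod_apply]
  · refine lintegral_congr fun x => ?_
    rw [uhmcKernel_apply hU, Measure.map_apply (by fun_prop) hA]
    rfl
  · exact hm hA

/-- The exact invariance of the target in the limit of small step sizes. -/
lemma tendsto_bind_uhmcKernel (hU : PotentialAssumptions U L LH LI)
    (hi : Integrable fun x => Real.exp (-U x)) (hT : 0 ≤ T) (hLT : L * T ^ 2 ≤ 1 / 6)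
    {A : Set (E d)} (hA : MeasurableSet A) {n : ℕ → ℕ} (hn : ∀ k, 0 < n k)
    (hn' : Filter.Tendsto n Filter.atTop Filter.atTop) :
    Filter.Tendsto (fun k => ((target U).bind (uhmcKernel U (T / n k) (n k))).real A) Filter.atTop
      (𝓝 ((target U).real A)) := by
  have hf := hU.forceBounds
  have hU1 : ContDiff ℝ 1 U := hU.smooth.of_le (by norm_num)
  have := isProbabilityMeasure_target hi
  have := fun k => isMarkovKernel_uhmcKernel hU1 (T / n k) (n k)
  set Pm := (target U).prod (stdGaussian (E d)) with hPm
  have hPd := target_prod_eq_withDensity (d := d) hU1.continuous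
  have hdm := measurable_canonDens (d := d) hU1.continuous
  set Ψ : ℕ → E d × E d → E d × E d := fun k => (verletStep U (T / n k))^[n k] with hΨ
  have hΨp : ∀ k, MeasurePreserving (Ψ k) := fun k =>
    (measurePreserving_verletStep hU1 (T / n k)).iterate (n k)
  -- Subtraction in `ℝ≥0∞` is truncated, so the integrand is the positive part of ρ − ρ∘Ψₖ,
  -- dominated by the density ρ.
  set ε : ℕ → ℝ≥0∞ := fun k => ∫⁻ z, (canonDens U z - canonDens U (Ψ k z)) with hε
  have htot : ∫⁻ z, canonDens U z = 1 := by
    have : Pm Set.univ = 1 := measure_univ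
    rwa [hPm, hPd, withDensity_apply _ MeasurableSet.univ, Measure.restrict_univ] at this
  have hεle : ∀ k, ε k ≤ 1 := fun k => by
    rw [← htot]
    exact lintegral_mono fun z => tsub_le_self
  have hε0 : Filter.Tendsto ε Filter.atTop (𝓝 0) := by
    have := tendsto_lintegral_of_dominated_convergence
      (F := fun k z => canonDens U z - canonDens U (Ψ k z)) (f := fun _ => 0) (canonDens U)
      (fun k => hdm.sub (hdm.comp (hΨp k).measurable))
      (fun k => Filter.Eventually.of_forall fun z => tsub_le_self) (by rw [htot]; simp)
      (Filter.Eventually.of_forall fun z => ?_)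
    · simpa using this
    · obtain ⟨C, hC⟩ := exists_abs_energy_sub_le (hU1.differentiable one_ne_zero) hf hT hLT z
      have h1 : Filter.Tendsto (fun k => C / (n k : ℝ)) Filter.atTop (𝓝 0) :=
        (tendsto_const_div_atTop_nhds_zero_nat C).comp hn'
      have h2 : Filter.Tendsto (fun k => energy U (Ψ k z)) Filter.atTop (𝓝 (energy U z)) :=
        tendsto_iff_norm_sub_tendsto_zero.2
          (squeeze_zero (fun _ => norm_nonneg _) (fun k => hC (n k) (hn k)) h1)
      have h3 : Filter.Tendsto (fun k => canonDens U (Ψ k z)) Filter.atTop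
          (𝓝 (canonDens U z)) := by
        unfold canonDens
        exact ENNReal.tendsto_ofReal (((Real.continuous_exp.tendsto _).comp h2.neg).const_mul _)
      have h4 := ENNReal.Tendsto.sub (tendsto_const_nhds (x := canonDens U z)) h3
        (Or.inl (by simp [canonDens]))
      simpa using h4
  -- Because Ψₖ preserves volume, the integral of ρ∘Ψₖ over the preimage of B is that of ρ over B;
  -- replacing ρ by ρ∘Ψₖ costs at most ε k.
  have hone : ∀ k (B : Set (E d)), MeasurableSet B →
      ((target U).bind (uhmcKernel U (T / n k) (n k))).real B
        ≤ (target U).real B + (ε k).toReal := fun k B hB => by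
    have hεt : ε k ≠ ∞ := ne_top_of_le_ne_top ENNReal.one_ne_top (hεle k)
    have hB' : MeasurableSet (Prod.fst ⁻¹' B : Set (E d × E d)) := measurable_fst hB
    have h1 : ((target U).bind (uhmcKernel U (T / n k) (n k))) B ≤ target U B + ε k := by
      rw [bind_uhmcKernel_apply hU1 _ hB]
      have h2 : target U B = Pm (Prod.fst ⁻¹' B) := by
        have : Pm.map Prod.fst = target U := by simp [hPm]
        rw [← this, Measure.map_apply measurable_fst hB]
      rw [h2, ← hPm, hPm, hPd, withDensity_apply _ ((hΨp k).measurable hB'),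
        withDensity_apply _ hB', ← (hΨp k).setLIntegral_comp_preimage hB' hdm]
      calc ∫⁻ z in Ψ k ⁻¹' (Prod.fst ⁻¹' B), canonDens U z
          ≤ ∫⁻ z in Ψ k ⁻¹' (Prod.fst ⁻¹' B),
              (canonDens U (Ψ k z) + (canonDens U z - canonDens U (Ψ k z))) :=
            lintegral_mono fun z => le_add_tsub
        _ = (∫⁻ z in Ψ k ⁻¹' (Prod.fst ⁻¹' B), canonDens U (Ψ k z))
              + ∫⁻ z in Ψ k ⁻¹' (Prod.fst ⁻¹' B), (canonDens U z - canonDens U (Ψ k z)) :=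
            lintegral_add_left (hdm.comp (hΨp k).measurable) _
        _ ≤ _ := add_le_add le_rfl (setLIntegral_le_lintegral _ _)
    rw [measureReal_def, measureReal_def, ← ENNReal.toReal_add (by simp) hεt]
    exact ENNReal.toReal_mono (by simp [hεt]) h1
  have hε1 : Filter.Tendsto (fun k => (ε k).toReal) Filter.atTop (𝓝 0) := by
    simpa [Function.comp_def] using (ENNReal.tendsto_toReal ENNReal.zero_ne_top).comp hε0
  refine tendsto_iff_norm_sub_tendsto_zero.2
    (squeeze_zero (fun _ => norm_nonneg _) (fun k => ?_) hε1)
  have h1 := hone k A hA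
  -- The one-sided bound on the complement gives the other inequality.
  have h2 := hone k Aᶜ hA.compl
  rw [probReal_compl_eq_one_sub hA, probReal_compl_eq_one_sub hA] at h2
  rw [Real.norm_eq_abs, abs_le]
  constructor <;> linarith
end
end UHMC

/-! ### One-step bias of the target, and Wasserstein-to-total-variation regularization. -/

namespace UHMC
open scoped RealInnerProductSpace Topology

section
variable {d : ℕ} {U : E d → ℝ} {L LH LI T h : ℝ} {N : ℕ}

lemma measureReal_bind_eq_integral (ν : Measure (E d)) [IsProbabilityMeasure ν]
    (κ : Kernel (E d) (E d)) [IsMarkovKernel κ] {A : Set (E d)} (hA : MeasurableSet A) :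
    (ν.bind κ).real A = ∫ x, (κ x).real A ∂ν := by
  rw [measureReal_def, Measure.bind_apply hA κ.aemeasurable]
  exact (integral_toReal (κ.measurable_coe hA).aemeasurable
    (Filter.Eventually.of_forall fun x => measure_lt_top _ _)).symm

lemma integrable_kernel_real (ν : Measure (E d)) [IsProbabilityMeasure ν]
    (κ : Kernel (E d) (E d)) [IsMarkovKernel κ] {A : Set (E d)} (hA : MeasurableSet A) :
    Integrable (fun x => (κ x).real A) ν := by
  refine (integrable_const (1 : ℝ)).mono'
    (κ.measurable_coe hA).ennreal_toReal.aestronglyMeasurable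
    (Filter.Eventually.of_forall fun x => ?_)
  rw [Real.norm_of_nonneg measureReal_nonneg]
  exact measureReal_le_one

lemma biasPoly_nonneg (hLI : 0 ≤ LI) (hT : 0 ≤ T) (d : ℕ) (L LH r : ℝ) :
    0 ≤ biasPoly d T L LH LI r := by
  have : 0 ≤ T⁻¹ := by positivity
  unfold biasPoly
  positivity

/-- One uHMC transition moves the target measure by `O(h²)` in total variation. -/
lemma abs_target_sub_bind_le (hU : PotentialAssumptions U L LH LI)
    (hi : Integrable fun x => Real.exp (-U x)) (hT : 0 < T) (hN : 0 < N)
    (hLT : L * T ^ 2 ≤ 1 / 6)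
    (hb : Integrable (fun x => biasPoly d T L LH LI ‖x‖) (target U)) {A : Set (E d)}
    (hA : MeasurableSet A) :
    |(target U).real A - ((target U).bind (uhmcKernel U (T / N) N)).real A|
      ≤ (T / N) ^ 2 * √(∫ x, biasPoly d T L LH LI ‖x‖ ∂(target U)) := by
  have hU1 : ContDiff ℝ 1 U := hU.smooth.of_le (by norm_num)
  have hLI := hU.forceBounds.LI_nonneg
  have := isProbabilityMeasure_target hi
  have hM := isMarkovKernel_uhmcKernel hU1
  have hN' : (0 : ℝ) < N := by exact_mod_cast hN
  set s := ∫ x, biasPoly d T L LH LI ‖x‖ ∂(target U) with hs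
  have hp : ∀ x : E d, 0 ≤ biasPoly d T L LH LI ‖x‖ := fun x =>
    biasPoly_nonneg hLI hT.le d L LH ‖x‖
  have hsm : AEStronglyMeasurable (fun x : E d => √(biasPoly d T L LH LI ‖x‖)) (target U) := by
    unfold biasPoly
    exact Continuous.aestronglyMeasurable (by fun_prop)
  have hsi : Integrable (fun x : E d => √(biasPoly d T L LH LI ‖x‖)) (target U) := by
    refine ((integrable_const (1 : ℝ)).add hb).mono' hsm (Filter.Eventually.of_forall fun x => ?_)
    rw [Real.norm_of_nonneg (Real.sqrt_nonneg _), Real.sqrt_le_iff]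
    have := hp x
    simp only [Pi.add_apply]
    constructor <;> nlinarith
  have hss : ∫ x, √(biasPoly d T L LH LI ‖x‖) ∂(target U) ≤ √s := by
    refine Real.le_sqrt_of_sq_le ?_
    have := (convexOn_pow (𝕜 := ℝ) 2).map_integral_le (μ := target U)
      (f := fun x => √(biasPoly d T L LH LI ‖x‖)) (by fun_prop) isClosed_Ici
      (Filter.Eventually.of_forall fun v => Set.mem_Ici.2 (Real.sqrt_nonneg _)) hsi
      (by simpa [Function.comp_def, Real.sq_sqrt (hp _)] using hb)
    simpa [Real.sq_sqrt (hp _)] using this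
  -- Successive halvings of the step at fixed T: each increment is a quarter of the previous one,
  -- and 3/4 divided by 1 − 1/4 is the final constant 1.
  set n : ℕ → ℕ := fun k => N * 2 ^ k with hn
  have hn0 : ∀ k, 0 < n k := fun k => by positivity
  have hnt : Filter.Tendsto n Filter.atTop Filter.atTop :=
    Filter.Tendsto.const_mul_atTop' hN (tendsto_pow_atTop_atTop_of_one_lt one_lt_two)
  have hlim := tendsto_bind_uhmcKernel hU hi hT.le hLT hA hn0 hnt
  have hstep : ∀ k, dist (((target U).bind (uhmcKernel U (T / n k) (n k))).real A)
      (((target U).bind (uhmcKernel U (T / n (k + 1)) (n (k + 1)))).real A)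
      ≤ (3 / 4 * (T / N) ^ 2 * √s) * (1 / 4) ^ k := fun k => by
    have hnk : (0 : ℝ) < n k := by exact_mod_cast hn0 k
    have hst : ShortTime L T (T / n k) (n k) := ⟨by positivity, by field_simp, hLT⟩
    have e1 : T / n (k + 1) = T / n k / 2 := by
      simp only [hn, pow_succ]
      push_cast
      field_simp
    have e2 : n (k + 1) = 2 * n k := by
      simp only [hn, pow_succ]
      ring
    have e3 : T / n k = T / N * (1 / 2) ^ k := by
      simp only [hn]
      push_cast
      rw [one_div, inv_pow]
      field_simp
    have hle : T / n k ≤ T := div_le_self hT.le (by exact_mod_cast hn0 k)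
    rw [dist_comm, Real.dist_eq, e1, e2, measureReal_bind_eq_integral _ _ hA,
      measureReal_bind_eq_integral _ _ hA, ← integral_sub (integrable_kernel_real _ _ hA)
      (integrable_kernel_real _ _ hA)]
    refine abs_integral_le_integral_abs.trans ?_
    calc _ ≤ ∫ x, 3 / 4 * (T / n k) ^ 2 * √(biasPoly d T L LH LI ‖x‖) ∂(target U) :=
          integral_mono ((integrable_kernel_real _ _ hA).sub (integrable_kernel_real _ _ hA)).abs
            (hsi.const_mul _) fun x => abs_uhmcKernel_half_sub_le hU hst hT hle x hA
      _ = 3 / 4 * (T / n k) ^ 2 * ∫ x, √(biasPoly d T L LH LI ‖x‖) ∂(target U) :=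
          integral_const_mul _ _
      _ ≤ 3 / 4 * (T / n k) ^ 2 * √s := by gcongr
      _ = _ := by
          rw [e3, mul_pow, ← pow_mul, mul_comm k 2, pow_mul]
          norm_num
          ring
  have := dist_le_of_le_geometric_of_tendsto₀ _ _ (by norm_num) hstep hlim
  rw [dist_comm, Real.dist_eq] at this
  simp only [hn, pow_zero, mul_one] at this
  refine this.trans (le_of_eq ?_)
  ring

/-! ### The Wasserstein distance -/

lemma wasserstein1_le {ν η : Measure (E d)} {γ : Measure (E d × E d)} (hγ : IsCoupling γ ν η) :
    wasserstein1 ν η ≤ ∫⁻ z, edist z.1 z.2 ∂γ :=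
  iInf₂_le (f := fun (γ : Measure (E d × E d)) (_ : IsCoupling γ ν η) =>
    ∫⁻ z, edist z.1 z.2 ∂γ) γ hγ

lemma wasserstein1_comm (ν η : Measure (E d)) : wasserstein1 ν η = wasserstein1 η ν := by
  have key : ∀ ν η : Measure (E d), wasserstein1 ν η ≤ wasserstein1 η ν := fun ν η => by
    refine le_iInf₂ fun γ hγ => ?_
    have hc : IsCoupling (γ.map Prod.swap) ν η := by
      refine ⟨?_, ?_⟩
      · rw [Measure.map_map measurable_fst measurable_swap]
        exact hγ.2
      · rw [Measure.map_map measurable_snd measurable_swap]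
        exact hγ.1
    refine (wasserstein1_le hc).trans (le_of_eq ?_)
    rw [lintegral_map (by fun_prop) measurable_swap]
    simp [edist_comm]
  exact le_antisymm (key _ _) (key _ _)

lemma lintegral_enorm_le_wasserstein1_add (ν η : Measure (E d)) :
    ∫⁻ x, ‖x‖ₑ ∂η ≤ wasserstein1 ν η + ∫⁻ x, ‖x‖ₑ ∂ν := by
  unfold wasserstein1
  rw [ENNReal.iInf_add]
  refine le_iInf fun γ => ?_
  by_cases hγ : IsCoupling γ ν η
  · rw [iInf_pos hγ, ← hγ.1, ← hγ.2, lintegral_map (by fun_prop) measurable_fst,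
      lintegral_map (by fun_prop) measurable_snd, ← lintegral_add_left (by fun_prop)]
    refine lintegral_mono fun z => ?_
    rw [← edist_zero_right, ← edist_zero_right, edist_comm z.1]
    calc edist z.2 0 ≤ edist z.2 z.1 + edist z.1 0 := edist_triangle _ _ _
      _ = _ := by rw [edist_comm z.2]
  · rw [iInf_neg hγ]
    simp

lemma wasserstein1_dirac_le (x : E d) (η : Measure (E d)) [IsProbabilityMeasure η] :
    wasserstein1 (Measure.dirac x) η ≤ ‖x‖ₑ + ∫⁻ y, ‖y‖ₑ ∂η := by
  have hc : IsCoupling ((Measure.dirac x).prod η) (Measure.dirac x) η := by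
    constructor <;> simp
  refine (wasserstein1_le hc).trans ?_
  rw [Measure.dirac_prod, lintegral_map (by fun_prop) (by fun_prop)]
  calc ∫⁻ y, edist x y ∂η ≤ ∫⁻ y, (‖x‖ₑ + ‖y‖ₑ) ∂η := by
        refine lintegral_mono fun y => ?_
        rw [← edist_zero_right, ← edist_zero_right, edist_comm y]
        exact edist_triangle _ _ _
    _ = _ := by
        rw [lintegral_add_left (by fun_prop)]
        simp

/-- The Wasserstein distance controls the total variation distance after one transition. -/
lemma ofReal_abs_bind_sub_le (hU : PotentialAssumptions U L LH LI)
    (hs : ShortTime L T h N) (hT : 0 < T) (ν η : Measure (E d)) [IsProbabilityMeasure ν]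
    [IsProbabilityMeasure η] {A : Set (E d)} (hA : MeasurableSet A) :
    ENNReal.ofReal |(ν.bind (uhmcKernel U h N)).real A - (η.bind (uhmcKernel U h N)).real A|
      ≤ ENNReal.ofReal (2 / 5 * regConst d T LH) * wasserstein1 ν η := by
  have hU1 : ContDiff ℝ 1 U := hU.smooth.of_le (by norm_num)
  have hM := isMarkovKernel_uhmcKernel hU1 h N
  have hc : 0 < 2 / 5 * regConst d T LH := by
    unfold regConst
    positivity
  unfold wasserstein1
  rw [ENNReal.mul_iInf_of_ne (by simpa using hc) ENNReal.ofReal_ne_top]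
  refine le_iInf fun γ => ?_
  rw [ENNReal.mul_iInf_of_ne (by simpa using hc) ENNReal.ofReal_ne_top]
  refine le_iInf fun hγ => ?_
  have hγp : IsProbabilityMeasure γ := by
    have : IsProbabilityMeasure (γ.map Prod.fst) := by rwa [hγ.1]
    exact Measure.isProbabilityMeasure_of_map Prod.fst
  have hm : Measurable fun x => (uhmcKernel U h N x).real A :=
    (Kernel.measurable_coe _ hA).ennreal_toReal
  have i1 : Integrable (fun z : E d × E d => (uhmcKernel U h N z.1).real A) γ := by
    have := integrable_kernel_real ν (uhmcKernel U h N) hA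
    rw [← hγ.1] at this
    exact this.comp_measurable measurable_fst
  have i2 : Integrable (fun z : E d × E d => (uhmcKernel U h N z.2).real A) γ := by
    have := integrable_kernel_real η (uhmcKernel U h N) hA
    rw [← hγ.2] at this
    exact this.comp_measurable measurable_snd
  have e1 : ∫ x, (uhmcKernel U h N x).real A ∂ν = ∫ z, (uhmcKernel U h N z.1).real A ∂γ := by
    rw [← hγ.1, integral_map (by fun_prop) hm.aestronglyMeasurable]
  have e2 : ∫ x, (uhmcKernel U h N x).real A ∂η = ∫ z, (uhmcKernel U h N z.2).real A ∂γ := by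
    rw [← hγ.2, integral_map (by fun_prop) hm.aestronglyMeasurable]
  -- Under the coupling, the difference is the mean of π̃(x, A) − π̃(y, A), to which the Lipschitz
  -- bound `abs_uhmcKernel_sub_le` applies.
  rw [measureReal_bind_eq_integral _ _ hA, measureReal_bind_eq_integral _ _ hA, e1, e2,
    ← integral_sub i1 i2, ← lintegral_const_mul _ (by fun_prop), ← Real.norm_eq_abs,
    ofReal_norm]
  refine (enorm_integral_le_lintegral_enorm _).trans (lintegral_mono fun z => ?_)
  rw [← ofReal_norm, edist_dist, ← ENNReal.ofReal_mul hc.le, dist_eq_norm]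
  exact ENNReal.ofReal_le_ofReal (abs_uhmcKernel_sub_le hU hs hT z.1 z.2 hA)
end
end UHMC

/-! ### The lower bound on M₁ and the total variation bound. -/

namespace UHMC
open scoped RealInnerProductSpace Topology

section
variable {d : ℕ} {U : E d → ℝ} {L LH LI T h : ℝ} {N : ℕ}

lemma uhmcLaw_succ (U : E d → ℝ) (h : ℝ) (N m : ℕ) (ν : Measure (E d)) :
    uhmcLaw U h N (m + 1) ν = (uhmcLaw U h N m ν).bind (uhmcKernel U h N) := by
  unfold uhmcLaw
  rw [pow_succ' (uhmcKernel U h N) m]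
  exact Measure.comp_assoc.symm

lemma uhmcLaw_zero (U : E d → ℝ) (h : ℝ) (N : ℕ) (ν : Measure (E d)) :
    uhmcLaw U h N 0 ν = ν := by
  unfold uhmcLaw
  rw [pow_zero]
  exact Measure.id_comp

lemma isProbabilityMeasure_uhmcLaw (hU : ContDiff ℝ 1 U) (h : ℝ) (N m : ℕ) (ν : Measure (E d))
    [hν : IsProbabilityMeasure ν] : IsProbabilityMeasure (uhmcLaw U h N m ν) := by
  have := isMarkovKernel_uhmcKernel hU h N
  induction m with
  | zero => rwa [uhmcLaw_zero]
  | succ m ih =>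
    rw [uhmcLaw_succ]
    infer_instance

/-- The trajectory departs from the free flight x + Tv by at most (‖x‖ + T‖v‖)/11, so a far-away
start stays far away. -/
lemma norm_le_norm_verletPos_add (hf : ForceBounds (∇ U) (fderiv ℝ (∇ U)) L LH LI)
    (hs : ShortTime L T h N) (z : E d × E d) :
    10 / 11 * ‖z.1‖ ≤ ‖verletPos U h N z‖ + 12 / 11 * T * ‖z.2‖ := by
  have hT := hs.T_nonneg
  have h1 := (verletRec_traj U h N z).norm_pos_sub_le (R := 0) (S := 0) hs.h_nonneg
    (by simp) (by simp) le_rfl le_rfl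
    (A := L * (12 / 11 * (‖z.1‖ + T * ‖z.2‖))) fun i hi => (hf.norm_le _).trans
      (mul_le_mul_of_nonneg_left (norm_verletPos_le hf hs z hi.le) hf.L_nonneg)
  simp only [verletPos_zero, verletVel_zero, mul_zero, add_zero, ← hs.T_eq] at h1
  have h2 : T ^ 2 / 2 * (L * (12 / 11 * (‖z.1‖ + T * ‖z.2‖)))
      ≤ 1 / 11 * (‖z.1‖ + T * ‖z.2‖) := by
    calc _ = L * T ^ 2 * (6 / 11 * (‖z.1‖ + T * ‖z.2‖)) := by ring
      _ ≤ 1 / 6 * (6 / 11 * (‖z.1‖ + T * ‖z.2‖)) := by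
          gcongr
          exact hs.le
      _ = _ := by ring
  have h3 : ‖z.1‖ ≤ ‖verletPos U h N z‖ + ‖verletPos U h N z - z.1 - T • z.2‖ + T * ‖z.2‖ := by
    have e : z.1 = verletPos U h N z + -(verletPos U h N z - z.1 - T • z.2) + -(T • z.2) := by
      abel
    conv_lhs => rw [e]
    refine norm_add₃_le.trans (le_of_eq ?_)
    rw [norm_neg, norm_neg, norm_smul, Real.norm_of_nonneg hT]
  linarith

lemma enorm_le_lintegral_uhmcKernel (hU : PotentialAssumptions U L LH LI)
    (hs : ShortTime L T h N) (x : E d) :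
    ENNReal.ofReal (10 / 11 * ‖x‖) ≤ ∫⁻ y, ‖y‖ₑ ∂(uhmcKernel U h N x)
      + ENNReal.ofReal (12 / 11 * T * ∫ v, ‖v‖ ∂(stdGaussian (E d))) := by
  have hT := hs.T_nonneg
  have hU1 : ContDiff ℝ 1 U := hU.smooth.of_le (by norm_num)
  have hm := measurable_verletPos hU1 h N
  have hmx : Measurable fun v => verletPos U h N (x, v) := hm.comp measurable_prodMk_left
  have hi : Integrable (fun v : E d => ‖v‖) (stdGaussian (E d)) := by
    simpa using integrable_norm_pow_stdGaussian (d := d) 1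
  rw [uhmcKernel_apply hU1, lintegral_map (by fun_prop) hmx, ← integral_const_mul,
    ofReal_integral_eq_lintegral_ofReal (hi.const_mul _)
      (Filter.Eventually.of_forall fun v => by positivity),
    ← lintegral_add_left (by fun_prop)]
  calc ENNReal.ofReal (10 / 11 * ‖x‖)
      = ∫⁻ _v, ENNReal.ofReal (10 / 11 * ‖x‖) ∂(stdGaussian (E d)) := by simp
    _ ≤ _ := by
        refine lintegral_mono fun v => ?_
        rw [← ofReal_norm, ← ENNReal.ofReal_add (by positivity) (by positivity)]
        exact ENNReal.ofReal_le_ofReal (norm_le_norm_verletPos_add hU.forceBounds hs (x, v))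

lemma lintegral_enorm_invariant_lt_top {M1 c M2 : ℝ} {μt : Measure (E d)}
    (hW : WassersteinAssumptions U h N M1 c M2 μt) (hμ : ∫⁻ x, ‖x‖ₑ ∂(target U) < ∞) :
    ∫⁻ x, ‖x‖ₑ ∂μt < ∞ :=
  (lintegral_enorm_le_wasserstein1_add (target U) μt).trans_lt
    (ENNReal.add_lt_top.2 ⟨hW.bias.trans_lt ENNReal.ofReal_lt_top, hμ⟩)

/-- The constant `M₁` cannot be small, since one transition moves far-away points only by a small
fraction of their distance to the origin. -/
lemma two_fifths_le_of_wassersteinAssumptions (hU : PotentialAssumptions U L LH LI)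
    (hs : ShortTime L T h N) (hd : d ≠ 0) {M1 c M2 : ℝ} {μt : Measure (E d)}
    (hW : WassersteinAssumptions U h N M1 c M2 μt) (hμ : ∫⁻ x, ‖x‖ₑ ∂(target U) < ∞) :
    2 / 5 ≤ M1 := by
  by_contra! hM
  have := hW.prob
  have hT := hs.T_nonneg
  have hmt := lintegral_enorm_invariant_lt_top hW hμ
  set a := (∫⁻ x, ‖x‖ₑ ∂μt).toReal with ha
  have ha0 : 0 ≤ a := ENNReal.toReal_nonneg
  have hae : ∫⁻ x, ‖x‖ₑ ∂μt = ENNReal.ofReal a := (ENNReal.ofReal_toReal hmt.ne).symm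
  set K := 12 / 11 * T * ∫ v, ‖v‖ ∂(stdGaussian (E d)) with hK
  have hK0 : 0 ≤ K := mul_nonneg (by positivity) (integral_nonneg fun v => norm_nonneg _)
  have : NeZero d := ⟨hd⟩
  have : Nontrivial (E d) := inferInstance
  -- Contraction with M₁ < 2/5 would give (10/11)‖x‖ ≤ (2/5)(‖x‖ + a) + a + K. Since 10/11 − 2/5 >
  -- 1/2, this fails beyond 2(2a + K).
  obtain ⟨x, hx⟩ := NormedSpace.exists_lt_norm ℝ (E d) (2 * (2 * a + K))
  have h1 := hW.contraction 1 le_rfl (Measure.dirac x) inferInstance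
  rw [show uhmcLaw U h N 1 (Measure.dirac x) = uhmcKernel U h N x by
    rw [uhmcLaw, pow_one, Measure.dirac_bind (Kernel.measurable _)]] at h1
  have h2 := wasserstein1_dirac_le x μt
  have h3 := lintegral_enorm_le_wasserstein1_add μt (uhmcKernel U h N x)
  have h4 := enorm_le_lintegral_uhmcKernel hU hs x
  rw [← hK] at h4
  clear_value K a
  rw [wasserstein1_comm] at h3
  rw [hae] at h2 h3
  have hexp : M1 * Real.exp (-c * (1 : ℕ)) ≤ 2 / 5 := by
    have : Real.exp (-c * (1 : ℕ)) ≤ 1 := by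
      rw [Real.exp_le_one_iff]
      have := hW.c_pos
      simp
      linarith
    calc M1 * Real.exp (-c * (1 : ℕ)) ≤ M1 * 1 := mul_le_mul_of_nonneg_left this hW.M1_pos.le
      _ ≤ 2 / 5 := by linarith
  have h5 : ENNReal.ofReal (10 / 11 * ‖x‖)
      ≤ ENNReal.ofReal (2 / 5 * (‖x‖ + a) + a + K) := by
    rw [ENNReal.ofReal_add (by positivity) hK0, ENNReal.ofReal_add (by positivity) ha0,
      ENNReal.ofReal_mul (p := 2 / 5) (by norm_num), ENNReal.ofReal_add (norm_nonneg x) ha0,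
      ofReal_norm]
    exact h4.trans (add_le_add (h3.trans (add_le_add
      (h1.trans (mul_le_mul' (ENNReal.ofReal_le_ofReal hexp) h2)) le_rfl)) le_rfl)
  rw [ENNReal.ofReal_le_ofReal_iff (by positivity)] at h5
  linarith

/-- In positive dimension the force of a normalizable potential does not vanish identically. -/
lemma L_pos_of_integrable (hU : PotentialAssumptions U L LH LI)
    (hi : Integrable fun x => Real.exp (-U x)) (hd : d ≠ 0) : 0 < L := by
  have hf := hU.forceBounds
  refine lt_of_le_of_ne hf.L_nonneg fun hL => ?_
  have : NeZero d := ⟨hd⟩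
  have : Nontrivial (E d) := inferInstance
  have hg : ∀ x, ∇ U x = 0 := fun x => by
    have := hf.norm_le x
    rw [← hL, zero_mul] at this
    exact norm_le_zero_iff.1 this
  have h0 : ∀ x, fderiv ℝ U x = 0 := fun x => by
    have := hg x
    rwa [gradient, LinearIsometryEquiv.map_eq_zero_iff] at this
  have hc : ∀ x, U x = 0 := fun x => by
    rw [is_const_of_fderiv_eq_zero (hU.smooth.differentiable (by norm_num)) h0 x 0, hU.zero]
  simp only [hc, neg_zero, Real.exp_zero] at hi
  rw [integrable_const_iff] at hi
  have := NormedSpace.noncompactSpace ℝ (E d)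
  simp [isFiniteMeasure_iff] at hi

/-- As μ has mass one, the constant term of C² is its own integral, and C² becomes a single integral
of `biasPoly`. -/
lemma biasConst_eq (hLI : 0 ≤ LI) (hT : 0 ≤ T) (L LH : ℝ) (μ : Measure (E d))
    [IsProbabilityMeasure μ] :
    biasConst d T L LH LI μ
      = (∫⁻ x, ENNReal.ofReal (biasPoly d T L LH LI ‖x‖) ∂μ) ^ (1 / 2 : ℝ) := by
  have hTi : 0 ≤ T⁻¹ := by positivity
  have hpow : ∀ (k : ℕ) (x : E d), ENNReal.ofReal (‖x‖ ^ k) = ‖x‖ₑ ^ k := fun k x => by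
    rw [ENNReal.ofReal_pow (norm_nonneg _), ofReal_norm]
  unfold biasConst biasPoly
  congr 1
  rw [← lintegral_const_mul _ (by fun_prop), ← lintegral_const_mul _ (by fun_prop)]
  conv_lhs => rw [← mul_one (ENNReal.ofReal _), ← measure_univ (μ := μ), ← lintegral_const]
  rw [← lintegral_add_left (by fun_prop), ← lintegral_add_left (by fun_prop)]
  refine lintegral_congr fun x => Eq.symm ?_
  rw [ENNReal.ofReal_add (by positivity) (by positivity),
    ENNReal.ofReal_add (by positivity) (by positivity),
    ENNReal.ofReal_mul (p := 2 * d * LH ^ 2 + L ^ 2 * T⁻¹ ^ 2) (by positivity),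
    ENNReal.ofReal_mul
      (p := d * LI ^ 2 + d * LH ^ 2 * LI * T ^ 2 + d * LH ^ 4 * T ^ 4 + LH ^ 2 * T⁻¹ ^ 2)
      (by positivity), hpow, hpow]

lemma ofReal_tvDist_le {ν η : Measure (E d)} {R : ℝ≥0∞}
    (h : ∀ A, MeasurableSet A → ENNReal.ofReal |ν.real A - η.real A| ≤ R) :
    ENNReal.ofReal (tvDist ν η) ≤ R := by
  by_cases hR : R = ∞
  · simp [hR]
  · rw [ENNReal.ofReal_le_iff_le_toReal hR]
    have : Nonempty {A : Set (E d) // MeasurableSet A} := ⟨⟨∅, MeasurableSet.empty⟩⟩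
    exact ciSup_le fun A => (ENNReal.ofReal_le_iff_le_toReal hR).1 (h A.1 A.2)

/-- The total variation bound for uHMC. -/
theorem ofReal_tvDist_target_uhmcLaw_le (hU : PotentialAssumptions U L LH LI)
    (hi : Integrable fun x => Real.exp (-U x)) (hT : 0 < T) (hh : 0 < h) (hTN : T = N * h)
    (hLT : L * (T ^ 2 + T * h) ≤ 1 / 6) {M1 c M2 : ℝ} {μt : Measure (E d)}
    (hW : WassersteinAssumptions U h N M1 c M2 μt) (m : ℕ) (ν : Measure (E d))
    [IsProbabilityMeasure ν] :
    ENNReal.ofReal (tvDist (target U) (uhmcLaw U h N (m + 1) ν))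
      ≤ ENNReal.ofReal (regConst d T LH * M1) * wasserstein1 μt ν
            * ENNReal.ofReal (Real.exp (-c * m))
        + ENNReal.ofReal (h ^ 2)
            * (ENNReal.ofReal (regConst d T LH * M2) + biasConst d T L LH LI (target U)) := by
  have hf := hU.forceBounds
  have hL0 := hf.L_nonneg
  have hU1 : ContDiff ℝ 1 U := hU.smooth.of_le (by norm_num)
  have hμp := isProbabilityMeasure_target hi
  have hμtp := hW.prob
  have hlaw := fun k => isProbabilityMeasure_uhmcLaw hU1 h N k ν
  have hN : 0 < N := by
    rcases Nat.eq_zero_or_pos N with rfl | hN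
    · simp [hTN] at hT
    · exact hN
  have hN' : (0 : ℝ) < N := by exact_mod_cast hN
  have hhN : h = T / N := by rw [hTN]; field_simp
  have hLT2 : L * T ^ 2 ≤ 1 / 6 := by
    have : 0 ≤ L * (T * h) := by positivity
    linarith
  have hs : ShortTime L T h N := ⟨hh.le, hTN, hLT2⟩
  have hh2 : ENNReal.ofReal (h ^ 2) ≠ 0 := by simpa using hh.ne'
  have hreg : 0 ≤ regConst d T LH := by unfold regConst; positivity
  refine ofReal_tvDist_le fun A hA => ?_
  -- On a one-point space all probability measures agree. This case is separate because the lower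
  -- bound on M₁ needs points of large norm.
  by_cases hd : d = 0
  · subst hd
    have : Subsingleton (E 0) := inferInstance
    have e : (target U).real A = (uhmcLaw U h N (m + 1) ν).real A := by
      rcases Set.eq_empty_or_nonempty A with rfl | hA'
      · simp
      · rw [Subsingleton.eq_univ_of_nonempty hA']
        simp
    simp [e]
  -- As h² is nonzero, an infinite C makes the right side infinite.
  by_cases hC : biasConst d T L LH LI (target U) = ∞
  · rw [hC, add_top, ENNReal.mul_top hh2, add_top]
    exact le_top
  have hCeq := biasConst_eq hf.LI_nonneg hT.le L LH (target U)
  have hpoly : ∫⁻ x, ENNReal.ofReal (biasPoly d T L LH LI ‖x‖) ∂(target U) ≠ ∞ := by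
    intro htop
    rw [hCeq, htop] at hC
    simp at hC
  have hpoly0 : ∀ x : E d, 0 ≤ biasPoly d T L LH LI ‖x‖ := fun x =>
    biasPoly_nonneg hf.LI_nonneg hT.le d L LH ‖x‖
  have hpm : Continuous fun x : E d => biasPoly d T L LH LI ‖x‖ := by
    unfold biasPoly
    fun_prop
  have hbi : Integrable (fun x => biasPoly d T L LH LI ‖x‖) (target U) :=
    ⟨hpm.aestronglyMeasurable, by
      rw [hasFiniteIntegral_iff_ofReal (Filter.Eventually.of_forall hpoly0)]
      exact lt_top_iff_ne_top.2 hpoly⟩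
  have hbias : ENNReal.ofReal
      |(target U).real A - ((target U).bind (uhmcKernel U h N)).real A|
      ≤ ENNReal.ofReal (h ^ 2) * biasConst d T L LH LI (target U) := by
    rw [hCeq, ← ofReal_integral_eq_lintegral_ofReal hbi (Filter.Eventually.of_forall hpoly0),
      ENNReal.ofReal_rpow_of_nonneg (integral_nonneg hpoly0) (by norm_num), ← Real.sqrt_eq_rpow,
      ← ENNReal.ofReal_mul (by positivity), hhN]
    exact ENNReal.ofReal_le_ofReal (abs_target_sub_bind_le hU hi hT hN hLT2 hbi hA)
  -- The summand L²T⁻²‖x‖² of `biasPoly` has a positive coefficient, so the second moment is finite,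
  -- and hence the first.
  have hmom : ∫⁻ x, ‖x‖ₑ ∂(target U) < ∞ := by
    have hL := L_pos_of_integrable hU hi hd
    have hcoef : 0 < L ^ 2 * T⁻¹ ^ 2 := by positivity
    have hsq : Integrable (fun x : E d => ‖x‖ ^ 2) (target U) := by
      refine (hbi.const_mul (L ^ 2 * T⁻¹ ^ 2)⁻¹).mono' (by fun_prop)
        (Filter.Eventually.of_forall fun x => ?_)
      rw [norm_pow, norm_norm, inv_mul_eq_div, le_div_iff₀ hcoef, biasPoly]
      have hLI := hf.LI_nonneg
      have hTi : 0 ≤ T⁻¹ := by positivity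
      have p1 : 0 ≤ (d : ℝ) ^ 3
          * (4 * LI ^ 2 * T ^ 4 + 14 * LH ^ 2 * LI * T ^ 6 + 14 * LH ^ 4 * T ^ 8)
        + (d : ℝ) ^ 2 * (35 * LH ^ 2 * T ^ 2 + 8 * LI ^ 2 * T ^ 4
            + 28 * LH ^ 2 * LI * T ^ 6 + 28 * LH ^ 4 * T ^ 8)
        + d * (16 * L ^ 2 + 4 * LH ^ 2 * T ^ 2) := by positivity
      have p2 : 0 ≤ 2 * d * LH ^ 2 * ‖x‖ ^ 2 := by positivity
      have p3 : 0 ≤ (d * LI ^ 2 + d * LH ^ 2 * LI * T ^ 2 + d * LH ^ 4 * T ^ 4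
        + LH ^ 2 * T⁻¹ ^ 2) * ‖x‖ ^ 4 := by positivity
      linarith
    have h1 : Integrable (fun x : E d => x) (target U) := by
      refine ((integrable_const (1 : ℝ)).add hsq).mono' (by fun_prop)
        (Filter.Eventually.of_forall fun x => ?_)
      simp only [Pi.add_apply]
      nlinarith [sq_nonneg (‖x‖ - 1)]
    exact h1.2
  have hM1 := two_fifths_le_of_wassersteinAssumptions hU hs hd hW hmom
  have hbnd : ENNReal.ofReal |((target U).bind (uhmcKernel U h N)).real A
        - (μt.bind (uhmcKernel U h N)).real A|
      ≤ ENNReal.ofReal (h ^ 2) * ENNReal.ofReal (regConst d T LH * M2) := by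
    refine (ofReal_abs_bind_sub_le hU hs hT _ _ hA).trans ?_
    refine (mul_le_mul' le_rfl hW.bias).trans ?_
    have hM2 := hW.M2_pos
    rw [← ENNReal.ofReal_mul (by positivity), ← ENNReal.ofReal_mul (by positivity)]
    refine ENNReal.ofReal_le_ofReal ?_
    have : 0 ≤ regConst d T LH * (M2 * h ^ 2) := by positivity
    linarith
  have hcontr : ENNReal.ofReal |(μt.bind (uhmcKernel U h N)).real A
        - (uhmcLaw U h N (m + 1) ν).real A|
      ≤ ENNReal.ofReal (regConst d T LH * M1) * wasserstein1 μt ν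
        * ENNReal.ofReal (Real.exp (-c * m)) := by
    have hM1' := hW.M1_pos
    rw [uhmcLaw_succ]
    refine (ofReal_abs_bind_sub_le hU hs hT _ _ hA).trans ?_
    -- At m = 0 there is no contraction to invoke; 2/5 ≤ M₁ takes its place.
    rcases Nat.eq_zero_or_pos m with rfl | hm
    · rw [uhmcLaw_zero]
      simp only [Nat.cast_zero, mul_zero, Real.exp_zero, ENNReal.ofReal_one, mul_one]
      refine mul_le_mul' (ENNReal.ofReal_le_ofReal ?_) le_rfl
      rw [mul_comm]
      exact mul_le_mul_of_nonneg_left hM1 hreg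
    · rw [wasserstein1_comm μt, wasserstein1_comm μt]
      refine (mul_le_mul' le_rfl (hW.contraction m hm ν inferInstance)).trans ?_
      rw [← mul_assoc, ← ENNReal.ofReal_mul (by positivity),
        mul_right_comm (ENNReal.ofReal (regConst d T LH * M1)),
        ← ENNReal.ofReal_mul (p := regConst d T LH * M1) (by positivity)]
      refine mul_le_mul' (ENNReal.ofReal_le_ofReal ?_) le_rfl
      have : 0 ≤ regConst d T LH * M1 * Real.exp (-c * m) := by positivity
      linarith
  have htri : |(target U).real A - (uhmcLaw U h N (m + 1) ν).real A|
      ≤ |(μt.bind (uhmcKernel U h N)).real A - (uhmcLaw U h N (m + 1) ν).real A|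
        + (|((target U).bind (uhmcKernel U h N)).real A - (μt.bind (uhmcKernel U h N)).real A|
          + |(target U).real A - ((target U).bind (uhmcKernel U h N)).real A|) := by
    have h1 := abs_sub_le ((target U).real A) (((target U).bind (uhmcKernel U h N)).real A)
      ((uhmcLaw U h N (m + 1) ν).real A)
    have h2 := abs_sub_le (((target U).bind (uhmcKernel U h N)).real A)
      ((μt.bind (uhmcKernel U h N)).real A) ((uhmcLaw U h N (m + 1) ν).real A)
    linarith
  refine (ENNReal.ofReal_le_ofReal htri).trans ?_
  rw [ENNReal.ofReal_add (abs_nonneg _) (by positivity),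
    ENNReal.ofReal_add (abs_nonneg _) (abs_nonneg _), mul_add]
  exact add_le_add hcontr (add_le_add hbnd hbias)
end
end UHMC

/-! ### The algorithm and its number of gradient evaluations. -/

namespace UHMC

section
variable {d : ℕ}

/-- The invariant is that the stored vector is the gradient at the current position, so each Verlet
step needs only one new evaluation. -/
lemma law_verletAlg (U : E d → ℝ) (h : ℝ) (N : ℕ) (q v : E d) (next : E d → E d → GradAlg d) :
    (verletAlg h N q v (∇ U q) next).law (∇ U)
      = (next (verletPos U h N (q, v)) (∇ U (verletPos U h N (q, v)))).law (∇ U) := by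
  induction N generalizing q v with
  | zero => rfl
  | succ N ih =>
    simp only [verletPos, Function.iterate_succ_apply] at ih ⊢
    exact ih _ _

lemma law_uhmcLoop {U : E d → ℝ} (hU : ContDiff ℝ 1 U) (h : ℝ) (N n : ℕ) (q : E d) :
    (uhmcLoop h N n q (∇ U q)).law (∇ U) = (uhmcKernel U h N ^ n : Kernel (E d) (E d)) q := by
  induction n generalizing q with
  | zero => rw [pow_zero]; rfl
  | succ n ih =>
    have hm : Measurable fun v => verletPos U h N (q, v) :=
      (measurable_verletPos hU h N).comp measurable_prodMk_left
    have e : (uhmcKernel U h N ^ (n + 1) : Kernel (E d) (E d)) q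
        = (uhmcKernel U h N q).bind (uhmcKernel U h N ^ n : Kernel (E d) (E d)) := by
      rw [pow_succ]
      exact Kernel.comp_apply _ _ _
    rw [e, uhmcKernel_apply hU, Measure.bind, Measure.map_map (Kernel.measurable _) hm]
    simp only [uhmcLoop, GradAlg.law, law_verletAlg, ih]
    rfl

/-- The algorithm samples from the law of uHMC. -/
lemma bind_law_uhmcAlg {U : E d → ℝ} (hU : ContDiff ℝ 1 U) (h : ℝ) (N n : ℕ)
    (ν : Measure (E d)) :
    (ν.bind fun x => (uhmcAlg h N n x).law (∇ U)) = uhmcLaw U h N n ν := by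
  simp only [uhmcAlg, GradAlg.law, law_uhmcLoop hU]
  rfl

lemma evals_verletAlg_le (G : E d → E d) (h : ℝ) (N : ℕ) {B : ℕ∞} (q v g : E d)
    {next : E d → E d → GradAlg d} (hB : ∀ q g, (next q g).evals G ≤ B) :
    (verletAlg h N q v g next).evals G ≤ N + B := by
  induction N generalizing q v g with
  | zero => simpa [verletAlg] using hB q g
  | succ N ih =>
    rw [verletAlg, GradAlg.evals, Nat.cast_succ, add_comm (N : ℕ∞), add_assoc]
    exact add_le_add le_rfl (ih _ _ _)

lemma evals_uhmcLoop_le (G : E d → E d) (h : ℝ) (N n : ℕ) (q g : E d) :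
    (uhmcLoop h N n q g).evals G ≤ (n * N : ℕ) := by
  induction n generalizing q g with
  | zero => simp [uhmcLoop, GradAlg.evals]
  | succ n ih =>
    rw [uhmcLoop, GradAlg.evals]
    refine iSup_le fun v => (evals_verletAlg_le G h N q v g ih).trans (le_of_eq ?_)
    push_cast
    ring

/-- One evaluation at the start, then N per transition, as the last gradient of a transition is
reused by the next. -/
lemma evals_uhmcAlg_le (G : E d → E d) (h : ℝ) (N n : ℕ) (x : E d) :
    (uhmcAlg h N n x).evals G ≤ (1 + n * N : ℕ) := by
  rw [uhmcAlg, GradAlg.evals, Nat.cast_add, Nat.cast_one]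
  exact add_le_add le_rfl (evals_uhmcLoop_le G h N n x _)

lemma regConst_le (hd : 1 ≤ d) (T LH : ℝ) : regConst d T LH ≤ regConst 1 T LH * Real.sqrt d := by
  have hd' : (1 : ℝ) ≤ d := by exact_mod_cast hd
  unfold regConst
  rw [mul_assoc (3 / 2 : ℝ), ← Real.sqrt_mul (by positivity)]
  gcongr
  have : 0 ≤ T⁻¹ ^ 2 * ((d : ℝ) - 1) := mul_nonneg (by positivity) (by linarith)
  push_cast
  linarith

/-- Under the assumptions of the complexity statement, the bound for uHMC with `N` Verlet steps
per transition and `m + 1` transitions, in terms of the dimension. -/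
lemma tvDist_le_of_dimension {U : E d → ℝ} {T L LH LI c h₀ A : ℝ} {p N m : ℕ}
    (hd : 1 ≤ d) (hT : 0 < T) (hA : 0 < A) (hLT : L * (T ^ 2 + T * h₀) ≤ 1 / 6) (hN : 0 < N)
    (hNh : T / N ≤ h₀) {ν : Measure (E d)} [IsProbabilityMeasure ν]
    (hU : PotentialAssumptions U L LH LI) (hi : Integrable fun x => Real.exp (-U x))
    (hC : biasConst d T L LH LI (target U) ≤ ENNReal.ofReal (A * (d : ℝ) ^ (3 / 2 : ℝ)))
    {M1 M2 : ℝ} {μt : Measure (E d)} (hW : WassersteinAssumptions U (T / N) N M1 c M2 μt)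
    (hM1 : M1 ≤ A * (d : ℝ) ^ p) (hM2 : M2 ≤ A * d)
    (hν : wasserstein1 μt ν ≤ ENNReal.ofReal (A * (d : ℝ) ^ p)) :
    tvDist (target U) (uhmcLaw U (T / N) N (m + 1) ν)
      ≤ regConst 1 T LH * A ^ 2 * (d : ℝ) ^ (2 * p + 1) * Real.exp (-c * m)
        + T ^ 2 / (N : ℝ) ^ 2 * (A * (regConst 1 T LH + 1) * (d : ℝ) ^ (3 / 2 : ℝ)) := by
  have hN' : (0 : ℝ) < N := by exact_mod_cast hN
  have hd' : (1 : ℝ) ≤ d := by exact_mod_cast hd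
  have hR0 : 0 ≤ regConst 1 T LH := by unfold regConst; positivity
  have hR0' : 0 ≤ regConst d T LH := by unfold regConst; positivity
  have hL := hU.forceBounds.L_nonneg
  have hM1p := hW.M1_pos
  have hM2p := hW.M2_pos
  have hR := regConst_le hd T LH
  have h1 := ofReal_tvDist_target_uhmcLaw_le hU hi hT (h := T / N) (by positivity)
    (by field_simp) (le_trans (by gcongr) hLT) hW m ν
  have h2 := h1.trans (add_le_add (mul_le_mul' (mul_le_mul' le_rfl hν) le_rfl)
    (mul_le_mul' le_rfl (add_le_add le_rfl hC)))
  rw [← ENNReal.ofReal_mul (by positivity), ← ENNReal.ofReal_mul (by positivity),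
    ← ENNReal.ofReal_add (by positivity) (by positivity), ← ENNReal.ofReal_mul (by positivity),
    ← ENNReal.ofReal_add (by positivity) (by positivity),
    ENNReal.ofReal_le_ofReal_iff (by positivity)] at h2
  refine h2.trans (add_le_add ?_ ?_)
  · refine mul_le_mul_of_nonneg_right ?_ (Real.exp_nonneg _)
    -- A crude bound that keeps the power of d integral; it multiplies an exponentially small factor
    -- and only affects m.
    have hs : Real.sqrt d ≤ d := by
      rw [Real.sqrt_le_left (by positivity)]
      nlinarith
    calc regConst d T LH * M1 * (A * (d : ℝ) ^ p)
        ≤ (regConst 1 T LH * d) * (A * (d : ℝ) ^ p) * (A * (d : ℝ) ^ p) := by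
          gcongr
          exact hR.trans (mul_le_mul_of_nonneg_left hs hR0)
      _ = _ := by ring
  · rw [div_pow]
    refine mul_le_mul_of_nonneg_left ?_ (by positivity)
    -- Regularization at rate √d applied to the W¹ bias of order d has the same order d^{3/2} as C.
    have e : Real.sqrt d * d = (d : ℝ) ^ (3 / 2 : ℝ) := by
      rw [Real.sqrt_eq_rpow, ← Real.rpow_add_one (by positivity)]
      norm_num
    calc regConst d T LH * M2 + A * (d : ℝ) ^ (3 / 2 : ℝ)
        ≤ (regConst 1 T LH * Real.sqrt d) * (A * d) + A * (d : ℝ) ^ (3 / 2 : ℝ) := by gcongr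
      _ = regConst 1 T LH * A * (Real.sqrt d * d) + A * (d : ℝ) ^ (3 / 2 : ℝ) := by ring
      _ = _ := by rw [e]; ring

end

/-- Numbers of Verlet steps and of transitions that achieve accuracy `ε`, with the resulting
number of gradient evaluations. -/
lemma exists_steps {T c h₀ A R : ℝ} (hT : 0 < T) (hc : 0 < c) (hh : 0 < h₀) (hA : 0 < A)
    (hR : 0 ≤ R) (p : ℕ) :
    ∃ K : ℝ, ∀ (d : ℕ) (ε : ℝ), 1 ≤ d → 0 < ε → ε ≤ 1 / 2 → ∃ N m : ℕ, 0 < N ∧ T / N ≤ h₀ ∧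
      ((1 + (m + 1) * N : ℕ) : ℝ)
        ≤ K * ((d : ℝ) ^ (3 / 4 : ℝ) * ε ^ (-(1 / 2) : ℝ) * Real.log (d / ε)) ∧
      R * A ^ 2 * (d : ℝ) ^ (2 * p + 1) * Real.exp (-c * m)
        + T ^ 2 / (N : ℝ) ^ 2 * (A * (R + 1) * (d : ℝ) ^ (3 / 2 : ℝ)) ≤ ε := by
  -- Since d/ε ≥ 2, the power (d/ε)^S absorbs the constant 2RA² into the logarithm.
  obtain ⟨S, hS⟩ := pow_unbounded_of_one_lt (2 * (R * A ^ 2)) (one_lt_two (α := ℝ))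
  set B := 2 * T ^ 2 * (A * (R + 1)) with hB
  have hB0 : 0 ≤ B := by positivity
  -- The summands ensure, in order, that a ≥ 1, that T/N ≤ h₀, and, through a² ≥ B, that the bias is
  -- at most ε/2.
  set a := 1 + T / h₀ + B with ha
  have hTh : 0 < T / h₀ := by positivity
  have ha1 : 1 ≤ a := by linarith
  have hb0 : 0 ≤ ((S + (2 * p + 1) : ℕ) : ℝ) / c := by positivity
  set b := ((S + (2 * p + 1) : ℕ) : ℝ) / c with hb
  -- Rounding up gives N ≤ 2ax and m + 2 ≤ bl + 3, and l ≥ 1/2 turns 3 into at most 6l.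
  refine ⟨(b + 6) * (2 * a), fun d ε hd hε hε2 => ?_⟩
  have hd' : (1 : ℝ) ≤ d := by exact_mod_cast hd
  set x := (d : ℝ) ^ (3 / 4 : ℝ) * ε ^ (-(1 / 2) : ℝ) with hx
  have hx1 : 1 ≤ x := by
    refine one_le_mul_of_one_le_of_one_le (Real.one_le_rpow hd' (by norm_num)) ?_
    exact Real.one_le_rpow_of_pos_of_le_one_of_nonpos hε (by linarith) (by norm_num)
  have hx2 : x ^ 2 = (d : ℝ) ^ (3 / 2 : ℝ) / ε := by
    rw [hx, mul_pow, ← Real.rpow_natCast, ← Real.rpow_natCast, ← Real.rpow_mul (by positivity),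
      ← Real.rpow_mul hε.le]
    norm_num [Real.rpow_neg_one, div_eq_mul_inv]
  have hy2 : 2 ≤ d / ε := by
    rw [le_div_iff₀ hε]
    linarith
  set y := d / ε with hy
  have hl : 1 / 2 ≤ Real.log y := by
    have := Real.log_le_log two_pos hy2
    have := Real.log_two_gt_d9
    linarith
  set l := Real.log y with hl'
  have hax : 0 < a * x := by positivity
  have hNge : a * x ≤ (⌈a * x⌉₊ : ℝ) := Nat.le_ceil _
  have hNle : (⌈a * x⌉₊ : ℝ) < a * x + 1 := Nat.ceil_lt_add_one hax.le
  have hmge : b * l ≤ (⌈b * l⌉₊ : ℝ) := Nat.le_ceil _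
  have hmle : (⌈b * l⌉₊ : ℝ) < b * l + 1 := Nat.ceil_lt_add_one (by positivity)
  have hNpos : 0 < ⌈a * x⌉₊ := Nat.ceil_pos.2 hax
  set N := ⌈a * x⌉₊ with hNdef
  set m := ⌈b * l⌉₊ with hmdef
  clear_value N m
  have hN0 : (0 : ℝ) < N := hax.trans_le hNge
  have hax1 : 1 ≤ a * x := one_le_mul_of_one_le_of_one_le ha1 hx1
  have hle : a ≤ a * x := le_mul_of_one_le_right (by linarith) hx1
  refine ⟨N, m, hNpos, ?_, ?_, ?_⟩
  · rw [div_le_iff₀ hN0, mul_comm, ← div_le_iff₀ hh]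
    linarith
  · push_cast
    calc 1 + ((m : ℝ) + 1) * N ≤ (m + 2) * N := by linarith
      _ ≤ (b * l + 3) * (2 * (a * x)) := by
          refine mul_le_mul (by linarith) (by linarith) hN0.le (by positivity)
      _ ≤ ((b + 6) * l) * (2 * (a * x)) := by
          refine mul_le_mul_of_nonneg_right ?_ (by positivity)
          linarith
      _ = _ := by ring
  · have hfirst : R * A ^ 2 * (d : ℝ) ^ (2 * p + 1) * Real.exp (-c * m) ≤ ε / 2 := by
      have hexp : y ^ (S + (2 * p + 1)) ≤ Real.exp (c * m) := by
        rw [← Real.exp_log (show 0 < y by linarith), ← Real.exp_nat_mul]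
        refine Real.exp_le_exp.2 ?_
        calc ((S + (2 * p + 1) : ℕ) : ℝ) * l = c * (b * l) := by
              rw [hb]
              field_simp
          _ ≤ c * m := by gcongr
      have hSy : 2 * (R * A ^ 2) ≤ y ^ S := hS.le.trans (by gcongr)
      -- One factor d is written as εy, which supplies the ε in the target accuracy; the other
      -- factors are bounded by y.
      have hdy : (d : ℝ) ^ (2 * p + 1) ≤ ε * y ^ (2 * p + 1) := by
        have hdle : (d : ℝ) ≤ y := by
          rw [hy, le_div_iff₀ hε]
          nlinarith
        have e : ε * y = d := by
          rw [hy]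
          field_simp
        calc (d : ℝ) ^ (2 * p + 1) = (d : ℝ) ^ (2 * p) * d := pow_succ _ _
          _ ≤ y ^ (2 * p) * d := by gcongr
          _ = ε * y ^ (2 * p + 1) := by
              rw [← e]
              ring
      rw [neg_mul, Real.exp_neg, ← div_eq_mul_inv, div_le_iff₀ (Real.exp_pos _)]
      calc R * A ^ 2 * (d : ℝ) ^ (2 * p + 1)
          = 1 / 2 * (2 * (R * A ^ 2)) * (d : ℝ) ^ (2 * p + 1) := by ring
        _ ≤ 1 / 2 * y ^ S * (ε * y ^ (2 * p + 1)) := by gcongr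
        _ = ε / 2 * y ^ (S + (2 * p + 1)) := by ring
        _ ≤ _ := by gcongr
    have hsecond : T ^ 2 / (N : ℝ) ^ 2 * (A * (R + 1) * (d : ℝ) ^ (3 / 2 : ℝ)) ≤ ε / 2 := by
      have e : (d : ℝ) ^ (3 / 2 : ℝ) = x ^ 2 * ε := by
        rw [hx2]
        field_simp
      have hBN : B * x ^ 2 ≤ (N : ℝ) ^ 2 := by
        calc B * x ^ 2 ≤ (a * a) * x ^ 2 := by
              gcongr
              nlinarith
          _ = (a * x) ^ 2 := by ring
          _ ≤ _ := by gcongr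
      rw [e, div_mul_eq_mul_div, div_le_iff₀ (by positivity)]
      calc T ^ 2 * (A * (R + 1) * (x ^ 2 * ε)) = ε / 2 * (B * x ^ 2) := by
            rw [hB]
            ring
        _ ≤ _ := by gcongr
    linarith

end UHMC

end

theorem mainTheorem6 :
    -- the bound
    (∀ (d : ℕ) (U : UHMC.E d → ℝ) (L LH LI : ℝ),
      UHMC.PotentialAssumptions U L LH LI →
      Integrable (fun x => Real.exp (-U x)) →
      ∀ (T h : ℝ) (N : ℕ), 0 < T → 0 < h → T = N * h → L * (T ^ 2 + T * h) ≤ 1 / 6 →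
      ∀ (M1 c M2 : ℝ) (μt : Measure (UHMC.E d)),
      UHMC.WassersteinAssumptions U h N M1 c M2 μt →
      ∀ (m : ℕ) (ν : Measure (UHMC.E d)), IsProbabilityMeasure ν →
        ENNReal.ofReal (UHMC.tvDist (UHMC.target U) (UHMC.uhmcLaw U h N (m + 1) ν))
          ≤ ENNReal.ofReal (UHMC.regConst d T LH * M1) * UHMC.wasserstein1 μt ν
                * ENNReal.ofReal (Real.exp (-c * m))
            + ENNReal.ofReal (h ^ 2)
                * (ENNReal.ofReal (UHMC.regConst d T LH * M2)
                  + UHMC.biasConst d T L LH LI (UHMC.target U)))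
    ∧
    -- the number of gradient evaluations
    (∀ (T L LH LI c h₀ A : ℝ) (p : ℕ), 0 < T → 0 < c → 0 < h₀ → 0 < A →
      L * (T ^ 2 + T * h₀) ≤ 1 / 6 →
      ∃ K : ℝ, ∀ (d : ℕ) (ε : ℝ), 1 ≤ d → 0 < ε → ε ≤ 1 / 2 →
      ∃ N m : ℕ, 0 < N ∧ T / N ≤ h₀ ∧
        (∀ (G : UHMC.E d → UHMC.E d) (x : UHMC.E d),
          (((UHMC.uhmcAlg (T / N) N (m + 1) x).evals G : ℕ∞) : ℝ≥0∞)
            ≤ ENNReal.ofReal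
                (K * ((d : ℝ) ^ (3 / 4 : ℝ) * ε ^ (-(1 / 2) : ℝ) * Real.log (d / ε)))) ∧
        ∀ (U : UHMC.E d → ℝ) (ν : Measure (UHMC.E d)), IsProbabilityMeasure ν →
          UHMC.PotentialAssumptions U L LH LI →
          Integrable (fun x => Real.exp (-U x)) →
          UHMC.biasConst d T L LH LI (UHMC.target U) ≤ ENNReal.ofReal (A * (d : ℝ) ^ (3 / 2 : ℝ)) →
          (∀ n : ℕ, 0 < n → T / n ≤ h₀ →
            ∃ (M1 M2 : ℝ) (μt : Measure (UHMC.E d)),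
              UHMC.WassersteinAssumptions U (T / n) n M1 c M2 μt ∧
              M1 ≤ A * (d : ℝ) ^ p ∧ M2 ≤ A * d ∧
              UHMC.wasserstein1 μt ν ≤ ENNReal.ofReal (A * (d : ℝ) ^ p)) →
          (ν.bind fun x => (UHMC.uhmcAlg (T / N) N (m + 1) x).law (∇ U))
              = UHMC.uhmcLaw U (T / N) N (m + 1) ν ∧
          UHMC.tvDist (UHMC.target U) (UHMC.uhmcLaw U (T / N) N (m + 1) ν) ≤ ε) := by
  refine ⟨fun d U L LH LI hU hi T h N hT hh hTN hLT M1 c M2 μt hW m ν hν =>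
    UHMC.ofReal_tvDist_target_uhmcLaw_le hU hi hT hh hTN hLT hW m ν, ?_⟩
  intro T L LH LI c h₀ A p hT hc hh hA hLT
  have hR : 0 ≤ UHMC.regConst 1 T LH := by
    unfold UHMC.regConst
    positivity
  obtain ⟨K, hK⟩ := UHMC.exists_steps hT hc hh hA hR p
  refine ⟨K, fun d ε hd hε hε2 => ?_⟩
  obtain ⟨N, m, hN, hNh, hev, hTV⟩ := hK d ε hd hε hε2
  refine ⟨N, m, hN, hNh, fun G x => ?_, fun U ν hν hU hi hC hW => ?_⟩
  · refine le_trans ?_ (ENNReal.ofReal_le_ofReal hev)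
    rw [ENNReal.ofReal_natCast]
    exact_mod_cast UHMC.evals_uhmcAlg_le G (T / N) N (m + 1) x
  · obtain ⟨M1, M2, μt, hWt, hM1, hM2, hW1⟩ := hW N hN hNh
    exact ⟨UHMC.bind_law_uhmcAlg (hU.smooth.of_le (by norm_num)) _ _ _ _,
      (UHMC.tvDist_le_of_dimension hd hT hA hLT hN hNh hU hi hC hWt hM1 hM2 hW1).trans hTV⟩
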